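/- Plane graphs are finite, may have multiple edges, are considered on the sphere (the exterior face counts as a face), and are taken up to isomorphism of plane graphs, orientation-reversing isomorphisms (reflections) included. An $i$-hedrite is a $2$-connected $4$-valent plane graph all of whose faces are $2$-, $3$- or $4$-gons and which has exactly $p_2=8-i$ faces that are $2$-gons. A central circuit is a closed walk obtained by starting with an edge and continuing at each vertex by the edge opposite to the entering one (its direction is disregarded); the central circuits partition the edge set. A central circuit is self-intersecting if it passes twice through some vertex. An $i$-hedrite is pure if no central circuit is self-intersecting. A rail-road is a (possibly self-intersecting) circuit of $4$-gonal faces in which every $4$-gon is adjacent to its two neighbors on opposite edges; an $i$-hedrite is irreducible if it has no rail-road. **Theorem.** The pure irreducible $i$-hedrites are exactly the following: every $4$-hedrite with exactly two central circuits; the $5$-hedrite **6-2**; the $6$-hedrites **8-5** and **14-20**; and the eight $8$-hedrites **6-1**, **12-4**, **12-5**, **14-7**, **20-1**, **22-1**, **30-1**, **32-1**. In particular there is no pure irreducible $7$-hedrite. Here the eleven individual graphs are given as follows, with vertices $0,\dots,n-1$. Each parenthesis is a central circuit, listed as the cyclic sequence of vertices it passes, in the direction of traversal; every vertex occurs exactly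 twice. At its second occurrence (in reading order) a vertex $v$ is written $v$ if there the second circuit crosses the first one from right to left (seen in the direction of the first), and $\overline{v}$ if it crosses it from left to right. This determines the plane graph. - $5$-hedrite **6-2** ($n=6$): $(0\,1\,2\,3)\ (0\,\overline{1}\,4\,5)\ (2\,\overline{3}\,\overline{5}\,4)$ - $6$-hedrite **8-5** ($n=8$): $(0\,1\,2\,3)\ (0\,4\,5\,\overline{1}\,6\,7)\ (2\,\overline{5}\,4\,\overline{3}\,\overline{7}\,6)$ - $6$-hedrite **14-20** ($n=14$): $(0\,1\,2\,3\,4\,5)\ (0\,6\,7\,\overline{3}\,8\,9)\ (1\,6\,10\,11\,\overline{7}\,\overline{2}\,12\,13)\ (4\,\overline{11}\,10\,\overline{5}\,\overline{9}\,\overline{13}\,12\,8)$ - $8$-hedrite **6-1** ($n=6$): $(0\,1\,2\,3)\ (0\,4\,\overline{2}\,5)\ (1\,4\,\overline{3}\,\overline{5})$ - $8$-hedrite **12-4** ($n=12$): $(0\,1\,2\,3\,4\,5)\ (0\,6\,7\,\overline{3}\,8\,9)\ (1\,6\,10\,\overline{4}\,\overline{8}\,11)\ (2\,7\,10\,\overline{5}\,\overline{9}\,\overline{11})$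 - $8$-hedrite **12-5** ($n=12$): $(0\,1\,2\,3\,4\,5)\ (0\,6\,\overline{2}\,7\,8\,9)\ (1\,6\,10\,\overline{4}\,\overline{8}\,11)\ (3\,10\,\overline{5}\,\overline{9}\,\overline{11}\,7)$ - $8$-hedrite **14-7** ($n=14$): $(0\,1\,2\,3\,4\,5)\ (0\,6\,7\,\overline{3}\,8\,9)\ (1\,10\,7\,11\,\overline{5}\,12\,\overline{8}\,13)\ (2\,10\,6\,\overline{11}\,\overline{4}\,12\,\overline{9}\,\overline{13})$ - $8$-hedrite **20-1** ($n=20$): $(0\,1\,2\,3\,4\,5\,6\,7)\ (0\,8\,9\,\overline{3}\,10\,11\,12\,13)\ (1\,8\,14\,15\,\overline{5}\,\overline{11}\,16\,17)\ (2\,9\,18\,15\,\overline{6}\,\overline{12}\,\overline{16}\,19)\ (4\,18\,14\,\overline{7}\,\overline{13}\,\overline{17}\,\overline{19}\,10)$ - $8$-hedrite **22-1** ($n=22$): $(0\,1\,2\,3\,4\,5\,6\,7)\ (0\,8\,9\,10\,\overline{4}\,11\,12\,13)\ (1\,14\,9\,15\,\overline{5}\,16\,\overline{12}\,17)\ (2\,18\,10\,15\,19\,\overline{7}\,20\,\overline{16}\,\overline{11}\,21)\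 (3\,18\,14\,8\,\overline{19}\,\overline{6}\,20\,\overline{13}\,\overline{17}\,\overline{21})$ - $8$-hedrite **30-1** ($n=30$): $(0\,1\,2\,3\,4\,5\,6\,7\,8\,9)\ (0\,10\,11\,12\,\overline{4}\,13\,14\,15\,16\,17)\ (1\,18\,11\,19\,20\,\overline{6}\,\overline{14}\,21\,22\,23)\ (2\,24\,12\,25\,20\,26\,\overline{8}\,\overline{16}\,\overline{22}\,27)\ (3\,24\,18\,10\,28\,\overline{26}\,\overline{7}\,\overline{15}\,\overline{21}\,29)\ (5\,25\,19\,28\,\overline{9}\,\overline{17}\,\overline{23}\,\overline{27}\,\overline{29}\,13)$ - $8$-hedrite **32-1** ($n=32$): $(0\,1\,2\,3\,4\,5\,6\,7\,8\,9)\ (0\,10\,11\,12\,13\,\overline{3}\,14\,15\,16\,17\,18\,19)\ (1\,20\,21\,12\,22\,\overline{6}\,\overline{16}\,23\,24\,25)\ (2\,26\,21\,11\,27\,\overline{7}\,\overline{17}\,\overline{23}\,28\,29)\ (4\,30\,22\,27\,31\,\overline{9}\,\overline{19}\,\overline{25}\,\overline{29}\,14)\ (5\,30\,\overline{13}\,26\,20\,10\,\overline{31}\,\overline{8}\,\overline{18}\,\overline{24}\,\overline{28}\,15)$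 -/

import Mathlib

open Equiv

/-- A combinatorial map (rotation system): a multigraph drawn on an oriented closed surface, given by
its darts (edges with a chosen direction; loops and multiple edges are allowed).
`rot` sends a dart `d` to the next dart, in counterclockwise order, with the same initial vertex;
`edge` sends `d` to the same edge with the opposite direction. -/
structure CombMap (D : Type*) where
  rot : Perm D
  edge : Perm D
  edge_edge : ∀ d, edge (edge d) = d
  edge_ne : ∀ d, edge d ≠ d

namespace CombMap

/-- The cycles of a permutation, fixed points included. -/
abbrev Cycles {D : Type*} (π : Perm D) : Type _ := Quotient (Perm.SameCycle.setoid π)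

/-- The cycle to which an element belongs. -/
def cycleMk {D : Type*} (π : Perm D) (d : D) : Cycles π := Quotient.mk _ d

/-- The number of elements of a cycle. -/
noncomputable def cycleLength {D : Type*} {π : Perm D} (c : Cycles π) : ℕ :=
  Nat.card {d : D // cycleMk π d = c}

section

variable {D : Type*} (M : CombMap D)

/-- Walk along `d`, then take the next edge of the face on the left of `d`. -/
def facePerm : Perm D := M.rot⁻¹ * M.edge

/-- Vertices: the darts with a common initial vertex form a cycle of `rot`. -/
abbrev Vertex : Type _ := Cycles M.rot

/-- Edges: the two darts of an edge. -/
abbrev Edge : Type _ := Cycles M.edge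

/-- Faces (the exterior one included): the darts with a given face on their left form a cycle
of `facePerm`. -/
abbrev Face : Type _ := Cycles M.facePerm

/-- The initial vertex of a dart. -/
def vertex (d : D) : M.Vertex := cycleMk M.rot d

/-- The face on the left of a dart. -/
def face (d : D) : M.Face := cycleMk M.facePerm d

/-- The simple graph that underlies the map. -/
def graph : SimpleGraph M.Vertex where
  Adj u v := u ≠ v ∧ ∃ d, M.vertex d = u ∧ M.vertex (M.edge d) = v
  symm := ⟨fun _ _ ⟨h, d, h₁, h₂⟩ => ⟨h.symm, M.edge d, h₂, by rw [M.edge_edge, h₁]⟩⟩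
  loopless := ⟨fun _ h => h.1 rfl⟩

/-- A (finite) plane graph, viewed on the sphere: a connected map with Euler characteristic 2. -/
def IsPlane : Prop :=
  M.graph.Connected ∧
    Nat.card M.Vertex + Nat.card M.Face = Nat.card M.Edge + 2

/-- Connected, and still connected after the removal of any one vertex. -/
def IsTwoConnected : Prop :=
  M.graph.Connected ∧ ∀ v, (M.graph.induce {v}ᶜ).Preconnected

/-- The number `p_k` of `k`-gonal faces. -/
noncomputable def faceCount (k : ℕ) : ℕ := Nat.card {F : M.Face // cycleLength F = k}

/-- An `i`-hedrite: a 2-connected 4-valent plane graph all of whose faces are 2-, 3- or 4-gons,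
with `p₂ = 8 - i`. -/
structure IsHedrite (i : ℕ) : Prop where
  plane : M.IsPlane
  twoConnected : M.IsTwoConnected
  fourValent : ∀ v : M.Vertex, cycleLength v = 4
  faces : ∀ F : M.Face, cycleLength F = 2 ∨ cycleLength F = 3 ∨ cycleLength F = 4
  count : M.faceCount 2 + i = 8

/-- At a 4-valent vertex, `rot ^ 2` sends a dart to the opposite one. Two darts lie on the same
central circuit (regardless of its direction) iff one gets from one to the other by following edges
and leaving each vertex by the edge opposite to the entering one, that is, iff they are in the same
orbit of the group generated by `rot ^ 2` and `edge`. -/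
abbrev CentralCircuit : Type _ :=
  Quotient (MulAction.orbitRel (Subgroup.closure {M.rot ^ 2, M.edge}) D)

/-- The central circuit that contains a given dart. -/
def circuit (d : D) : M.CentralCircuit := Quotient.mk _ d

/-- A central circuit of a 4-valent map is self-intersecting if it traverses some vertex twice, i.e.
if it contains two consecutive (non-opposite) darts of that vertex. -/
def SelfIntersecting (C : M.CentralCircuit) : Prop :=
  ∃ d, M.circuit d = C ∧ M.circuit (M.rot d) = C

/-- No central circuit is self-intersecting. -/
def IsPure : Prop := ∀ C : M.CentralCircuit, ¬ M.SelfIntersecting C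

/-- Cross the edge `d` from the face on its left to the face on its other side, and take the edge of
that new face which comes two edges later (the opposite edge, if the new face is a 4-gon). -/
def cross : Perm D := M.facePerm ^ 2 * M.edge

/-- There is a rail-road: a circuit (possibly self-intersecting) of 4-gons, each of which is adjacent
to its predecessor and to its successor on opposite edges. On a finite map the sequence of darts
`(M.cross ^ k) d` is periodic, so it closes up to a circuit of faces. -/
def HasRailroad : Prop := ∃ d, ∀ k : ℕ, cycleLength (M.face ((M.cross ^ k) d)) = 4

/-- No rail-road. -/
def IsIrreducible : Prop := ¬ M.HasRailroad

/-- Isomorphism of plane graphs, preserving or reversing the orientation. -/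
def Iso {D' : Type*} (M' : CombMap D') : Prop :=
  ∃ e : D ≃ D', (∀ d, e (M.edge d) = M'.edge (e d)) ∧
    ((∀ d, e (M.rot d) = M'.rot (e d)) ∨ (∀ d, e (M.rot d) = M'.rot.symm (e d)))

end

section

variable {n : ℕ}

/-- The edges given by a list of central circuits. The darts are the pairs `(v, k)`: the `k`-th dart,
counterclockwise, of the vertex `v`. A circuit is the cyclic list of the darts by which it leaves the
vertices that it passes; it enters the vertex left by `(w, k)` through the opposite dart
`(w, k + 2)`. -/
def circuitEdges (c : List (List (Fin n × Fin 4))) : List ((Fin n × Fin 4) × (Fin n × Fin 4)) :=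
  c.flatMap fun w => List.zipWith (fun a b => (a, (b.1, b.2 + 2))) w (w.rotate 1)

/-- The other dart of the edge of `d`. -/
def partner (c : List (List (Fin n × Fin 4))) (d : Fin n × Fin 4) : Fin n × Fin 4 :=
  match (circuitEdges c).find? fun e => e.1 = d ∨ e.2 = d with
  | some e => if e.1 = d then e.2 else e.1
  | none => d

/-- The 4-valent map with vertices `0, …, n - 1` and the given central circuits. -/
def ofCircuits (c : List (List (Fin n × Fin 4)))
    (h : ∀ d, partner c (partner c d) = d ∧ partner c d ≠ d) : CombMap (Fin n × Fin 4) where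
  rot := Equiv.prodCongr (Equiv.refl _) (Equiv.addRight 1)
  edge := Function.Involutive.toPerm (partner c) fun d => (h d).1
  edge_edge d := (h d).1
  edge_ne d := (h d).2

end

/-- The 5-hedrite 6-2: 6 vertices, central circuits of lengths 4, 4, 4, symmetry group D_3h of
order 12. -/
def hedrite5_6_2 : CombMap (Fin 6 × Fin 4) :=
  ofCircuits
    [[(0,0), (1,0), (2,0), (3,0)],
     [(0,1), (1,3), (4,0), (5,0)],
     [(2,1), (3,3), (5,3), (4,1)]]
    (by decide +kernel)

/-- The 6-hedrite 8-5: 8 vertices, central circuits of lengths 4, 6, 6, symmetry group D_2h of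
order 8. -/
def hedrite6_8_5 : CombMap (Fin 8 × Fin 4) :=
  ofCircuits
    [[(0,0), (1,0), (2,0), (3,0)],
     [(0,1), (4,0), (5,0), (1,3), (6,0), (7,0)],
     [(2,1), (5,3), (4,1), (3,3), (7,3), (6,1)]]
    (by decide +kernel)

/-- The 6-hedrite 14-20: 14 vertices, central circuits of lengths 6, 6, 8, 8, symmetry group D_2h
of order 8. -/
def hedrite6_14_20 : CombMap (Fin 14 × Fin 4) :=
  ofCircuits
    [[(0,0), (1,0), (2,0), (3,0), (4,0), (5,0)],
     [(0,1), (6,0), (7,0), (3,3), (8,0), (9,0)],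
     [(1,1), (6,1), (10,0), (11,0), (7,3), (2,3), (12,0), (13,0)],
     [(4,1), (11,3), (10,1), (5,3), (9,3), (13,3), (12,1), (8,1)]]
    (by decide +kernel)

/-- The 8-hedrite 6-1 (the octahedron): 6 vertices, central circuits of lengths 4, 4, 4, symmetry
group O_h of order 48. -/
def hedrite8_6_1 : CombMap (Fin 6 × Fin 4) :=
  ofCircuits
    [[(0,0), (1,0), (2,0), (3,0)],
     [(0,1), (4,0), (2,3), (5,0)],
     [(1,1), (4,1), (3,3), (5,3)]]
    (by decide +kernel)

/-- The 8-hedrite 12-4 (the cuboctahedron, the medial graph of the octahedron): 12 vertices,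
central circuits of lengths 6, 6, 6, 6, symmetry group O_h of order 48. -/
def hedrite8_12_4 : CombMap (Fin 12 × Fin 4) :=
  ofCircuits
    [[(0,0), (1,0), (2,0), (3,0), (4,0), (5,0)],
     [(0,1), (6,0), (7,0), (3,3), (8,0), (9,0)],
     [(1,1), (6,1), (10,0), (4,3), (8,3), (11,0)],
     [(2,1), (7,1), (10,1), (5,3), (9,3), (11,3)]]
    (by decide +kernel)

/-- The 8-hedrite 12-5 (the twisted cuboctahedron): 12 vertices, central circuits of lengths 6, 6,
6, 6, symmetry group D_3h of order 12. -/
def hedrite8_12_5 : CombMap (Fin 12 × Fin 4) :=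
  ofCircuits
    [[(0,0), (1,0), (2,0), (3,0), (4,0), (5,0)],
     [(0,1), (6,0), (2,3), (7,0), (8,0), (9,0)],
     [(1,1), (6,1), (10,0), (4,3), (8,3), (11,0)],
     [(3,1), (10,1), (5,3), (9,3), (11,3), (7,1)]]
    (by decide +kernel)

/-- The 8-hedrite 14-7: 14 vertices, central circuits of lengths 6, 6, 8, 8, symmetry group D_4h
of order 16. -/
def hedrite8_14_7 : CombMap (Fin 14 × Fin 4) :=
  ofCircuits
    [[(0,0), (1,0), (2,0), (3,0), (4,0), (5,0)],
     [(0,1), (6,0), (7,0), (3,3), (8,0), (9,0)],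
     [(1,1), (10,0), (7,1), (11,0), (5,3), (12,0), (8,3), (13,0)],
     [(2,1), (10,1), (6,1), (11,3), (4,3), (12,1), (9,3), (13,3)]]
    (by decide +kernel)

/-- The 8-hedrite 20-1: 20 vertices, central circuits of lengths 8, 8, 8, 8, 8, symmetry group
D_2d of order 8. -/
def hedrite8_20_1 : CombMap (Fin 20 × Fin 4) :=
  ofCircuits
    [[(0,0), (1,0), (2,0), (3,0), (4,0), (5,0), (6,0), (7,0)],
     [(0,1), (8,0), (9,0), (3,3), (10,0), (11,0), (12,0), (13,0)],
     [(1,1), (8,1), (14,0), (15,0), (5,3), (11,3), (16,0), (17,0)],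
     [(2,1), (9,1), (18,0), (15,1), (6,3), (12,3), (16,3), (19,0)],
     [(4,1), (18,1), (14,1), (7,3), (13,3), (17,3), (19,3), (10,1)]]
    (by decide +kernel)

/-- The 8-hedrite 22-1: 22 vertices, central circuits of lengths 8, 8, 8, 10, 10, symmetry group
D_2h of order 8. -/
def hedrite8_22_1 : CombMap (Fin 22 × Fin 4) :=
  ofCircuits
    [[(0,0), (1,0), (2,0), (3,0), (4,0), (5,0), (6,0), (7,0)],
     [(0,1), (8,0), (9,0), (10,0), (4,3), (11,0), (12,0), (13,0)],
     [(1,1), (14,0), (9,1), (15,0), (5,3), (16,0), (12,3), (17,0)],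
     [(2,1), (18,0), (10,1), (15,1), (19,0), (7,3), (20,0), (16,3), (11,3), (21,0)],
     [(3,1), (18,1), (14,1), (8,1), (19,3), (6,3), (20,1), (13,3), (17,3), (21,3)]]
    (by decide +kernel)

/-- The 8-hedrite 30-1: 30 vertices, central circuits of lengths 10, 10, 10, 10, 10, 10, symmetry
group O of order 24. -/
def hedrite8_30_1 : CombMap (Fin 30 × Fin 4) :=
  ofCircuits
    [[(0,0), (1,0), (2,0), (3,0), (4,0), (5,0), (6,0), (7,0), (8,0), (9,0)],
     [(0,1), (10,0), (11,0), (12,0), (4,3), (13,0), (14,0), (15,0), (16,0), (17,0)],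
     [(1,1), (18,0), (11,1), (19,0), (20,0), (6,3), (14,3), (21,0), (22,0), (23,0)],
     [(2,1), (24,0), (12,1), (25,0), (20,1), (26,0), (8,3), (16,3), (22,3), (27,0)],
     [(3,1), (24,1), (18,1), (10,1), (28,0), (26,3), (7,3), (15,3), (21,3), (29,0)],
     [(5,1), (25,1), (19,1), (28,1), (9,3), (17,3), (23,3), (27,3), (29,3), (13,1)]]
    (by decide +kernel)

/-- The 8-hedrite 32-1: 32 vertices, central circuits of lengths 10, 10, 10, 10, 12, 12, symmetry
group D_4h of order 16. -/
def hedrite8_32_1 : CombMap (Fin 32 × Fin 4) :=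
  ofCircuits
    [[(0,0), (1,0), (2,0), (3,0), (4,0), (5,0), (6,0), (7,0), (8,0), (9,0)],
     [(0,1), (10,0), (11,0), (12,0), (13,0), (3,3), (14,0), (15,0), (16,0), (17,0), (18,0),
      (19,0)],
     [(1,1), (20,0), (21,0), (12,1), (22,0), (6,3), (16,3), (23,0), (24,0), (25,0)],
     [(2,1), (26,0), (21,1), (11,1), (27,0), (7,3), (17,3), (23,3), (28,0), (29,0)],
     [(4,1), (30,0), (22,1), (27,1), (31,0), (9,3), (19,3), (25,3), (29,3), (14,1)],
     [(5,1), (30,1), (13,3), (26,1), (20,1), (10,1), (31,3), (8,3), (18,3), (24,3), (28,3),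
      (15,1)]]
    (by decide +kernel)

end CombMap

/-! The proof is a finite enumeration made possible by a local Euler formula. Let `S` be a set of
edges of a 4-valent map with faces of length at most 4, such that at each of its vertices `S` either
goes straight on or has at least three darts (`NoBend`). For a component of the complement of `S`,
four times the number of its boundary walks, plus the number of its corners, plus the sum of `4 -
length` over its faces, is at most 8 (`IsTame.region_bound`). This follows from the genus inequality
for two permutations, which is proved by linear algebra. All three terms are nonnegative. So a
component has at most four corners; with two boundary walks it would have no corner and only 4-gons,
and the 4-gons along its boundary would form a rail-road. Without rail-roads, each component that
touches `S` has a single boundary walk, with at most four corners (`IsTaut`).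

It follows that any two central circuits cross, and that a straight walk which enters a component
from its boundary next meets `S` on the same boundary walk. The circuits can therefore be drawn one
after the other on the level of finite codes (`Realizes`): from a loose end the walk either closes
up at another loose end or makes a new crossing on a segment of the boundary walk, and a cut that
would leave more than four corners on one side is discarded (`Realizes.stepsAll`).

The search terminates because two circuits have at most four common vertices as soon as there is a
third one (`IsTaut.fewCrossings`). On a suitable side of a circuit `A`, every arc of `B` crosses
every arc of `C`. If `x`, `y`, `z` are the numbers of common vertices of `A, B`, of `A, C` and of
`B, C`, this gives `x * y ≤ 4 * z`, and likewise `x * z ≤ 4 * y`, whence `x ≤ 4`. Evaluation in the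
kernel then shows that `r` of the circuits form one of the arrangements in `codes r`, and that there
are none for `r = 7`. So a map with at least three circuits is one of the eleven graphs, the chiral
30-1 occurring in both orientations. That these graphs have the required properties is checked by
evaluation too.

If there are only two circuits, they alternate around each face, so there are no triangles, and
Euler's formula `2 * p₂ + p₃ = 8` gives `i = 4`. Conversely, in a hedrite without triangles the same
linear algebra, with signs, yields a function that is constant on circuits and changes sign at each
crossing, so the hedrite is pure. If it has two circuits, a rail-road would be one entire side of a
circuit; the other side would carry the whole curvature 8, which the local Euler formula forbids. -/

namespace CombMap

/-! ### The genus inequality for two permutations -/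

section Ree

variable {X : Type*}

/-- The functions which `π` multiplies by `a`. -/
def eigenfunctions (π : Perm X) (a : ℝ) : Submodule ℝ (X → ℝ) where
  carrier := {f | ∀ x, f (π x) = a * f x}
  add_mem' hf hg x := by simp [hf x, hg x, mul_add]
  zero_mem' x := by simp
  smul_mem' c f hf x := by simp [hf x]; ring

theorem mem_eigenfunctions {π : Perm X} {a : ℝ} {f : X → ℝ} :
    f ∈ eigenfunctions π a ↔ ∀ x, f (π x) = a * f x := Iff.rfl

/-- On the eigenfunctions `h` of `α * β`, the operator `h ↦ h - a • (h ∘ α)` takes values orthogonal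
to the sum of the other two eigenspaces, and its kernel consists of common eigenfunctions of `α` and
`β`. Counting dimensions gives the bound. The case `a = b = 1` is the nonnegativity of the genus;
the case `a = -1`, `b = 1` serves for the hedrites without triangles. -/
theorem finrank_eigenfunctions_add_le [Fintype X] (α β : Perm X) {a b : ℝ} (ha : a * a = 1)
    (hb : b * b = 1) :
    Module.finrank ℝ (eigenfunctions α a) + Module.finrank ℝ (eigenfunctions β b) +
      Module.finrank ℝ (eigenfunctions (α * β) (a * b)) ≤
    Fintype.card X +
      2 * Module.finrank ℝ (eigenfunctions α a ⊓ eigenfunctions β b : Submodule ℝ (X → ℝ)) := by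
  let θ : (X → ℝ) →ₗ[ℝ] (X → ℝ) := LinearMap.id - a • LinearMap.funLeft ℝ ℝ α
  have hθ (h : X → ℝ) (x : X) : θ h x = h x - a * h (α x) := by
    simp [θ, LinearMap.funLeft]
  let W := eigenfunctions α a ⊔ eigenfunctions β b
  let T := θ.domRestrict (eigenfunctions (α * β) (a * b))
  have hW := Submodule.finrank_sup_add_finrank_inf_eq (eigenfunctions α a) (eigenfunctions β b)
  have hT := T.finrank_range_add_finrank_ker
  have hker : Module.finrank ℝ (LinearMap.ker T) ≤
      Module.finrank ℝ (eigenfunctions α a ⊓ eigenfunctions β b : Submodule ℝ (X → ℝ)) := by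
    have hmem : ∀ h : LinearMap.ker T,
        (h.1.1 : X → ℝ) ∈ (eigenfunctions α a ⊓ eigenfunctions β b : Submodule ℝ (X → ℝ)) := by
      rintro ⟨⟨h, hh⟩, hk⟩
      have h1 : ∀ x, h (α x) = a * h x := by
        intro x
        have := congrFun (LinearMap.mem_ker.1 hk) x
        simp only [T, LinearMap.domRestrict_apply, hθ, Pi.zero_apply] at this
        linear_combination (-a) * this - h (α x) * ha
      refine ⟨h1, fun x => ?_⟩
      have h2 := hh x
      rw [Perm.mul_apply, h1] at h2
      linear_combination a * h2 - (h (β x) - b * h x) * ha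
    let ι : LinearMap.ker T →ₗ[ℝ]
        (eigenfunctions α a ⊓ eigenfunctions β b : Submodule ℝ (X → ℝ)) :=
      LinearMap.codRestrict _ ((Submodule.subtype _).comp (Submodule.subtype _)) hmem
    refine LinearMap.finrank_le_finrank_of_injective (f := ι) fun h h' e => ?_
    have := congrArg Subtype.val e
    exact Subtype.ext (Subtype.ext this)
  have horth : ∀ h ∈ eigenfunctions (α * β) (a * b), ∀ w ∈ W, ∑ x, w x * θ h x = 0 := by
    intro h hh w hw
    obtain ⟨f, hf, g, hg, rfl⟩ := Submodule.mem_sup.1 hw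
    have e1 : ∑ x, f x * θ h x = 0 := by
      simp only [hθ, mul_sub, Finset.sum_sub_distrib]
      rw [← Equiv.sum_comp α (fun x => f x * h x), sub_eq_zero]
      exact Finset.sum_congr rfl fun x _ => by rw [hf x]; ring
    have e2 : ∑ x, g x * θ h x = 0 := by
      simp only [hθ, mul_sub, Finset.sum_sub_distrib]
      rw [← Equiv.sum_comp β (fun x => g x * (a * h (α x))), sub_eq_zero]
      refine Finset.sum_congr rfl fun x _ => ?_
      have := hh x
      rw [Perm.mul_apply] at this
      rw [hg x, this]
      linear_combination -(g x * h x) * (b * b * ha + hb)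
    simp only [Pi.add_apply, add_mul, Finset.sum_add_distrib, e1, e2, add_zero]
  -- A function in both spaces is orthogonal to itself.
  have hdisj : LinearMap.range T ⊓ W = ⊥ := by
    rw [eq_bot_iff]
    rintro u ⟨⟨⟨h, hh⟩, rfl⟩, hw⟩
    have h0 := horth h hh _ hw
    simp only [T, LinearMap.domRestrict_apply] at h0 ⊢
    rw [Finset.sum_eq_zero_iff_of_nonneg fun x _ => mul_self_nonneg _] at h0
    rw [Submodule.mem_bot]
    funext x
    exact mul_self_eq_zero.1 (h0 x (Finset.mem_univ x))
  have hsum := Submodule.finrank_sup_add_finrank_inf_eq (LinearMap.range T) W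
  rw [hdisj, finrank_bot] at hsum
  have hle := Submodule.finrank_le (LinearMap.range T ⊔ W)
  rw [Module.finrank_fintype_fun_eq_card] at hle
  simp only [W] at hsum hle
  omega

/-- A nowhere vanishing eigenfunction can be rescaled independently on each cycle. -/
theorem card_cycles_le_finrank_eigenfunctions [Finite X] (π : Perm X) (a : ℝ) (s : X → ℝ)
    (s_ne : ∀ x, s x ≠ 0) (hs : ∀ x, s (π x) = a * s x) :
    Nat.card (Cycles π) ≤ Module.finrank ℝ (eigenfunctions π a) := by
  classical
  have := Fintype.ofFinite X
  have := Fintype.ofFinite (Cycles π)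
  have hmk : ∀ x, cycleMk π (π x) = cycleMk π x := fun x =>
    Quotient.sound (s := Perm.SameCycle.setoid π) ⟨-1, by simp⟩
  let ι : (Cycles π → ℝ) →ₗ[ℝ] eigenfunctions π a :=
    { toFun := fun c => ⟨fun x => s x * c (cycleMk π x), fun x => by
        change s (π x) * c (cycleMk π (π x)) = a * (s x * c (cycleMk π x))
        rw [hs, hmk]; ring⟩
      map_add' := fun c c' => by ext x; simp [mul_add]
      map_smul' := fun r c => by ext x; simp; ring }
  have hι : Function.Injective ι := by
    intro c c' h
    funext q
    obtain ⟨x, rfl⟩ := Quotient.exists_rep q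
    have := congrFun (congrArg Subtype.val h) x
    exact mul_left_cancel₀ (s_ne x) this
  have := LinearMap.finrank_le_finrank_of_injective hι
  rwa [Module.finrank_fintype_fun_eq_card, ← Nat.card_eq_fintype_card] at this

/-- The cycle counts of two permutations that generate a transitive group. -/
theorem card_cycles_add_le [Finite X] [Nonempty X] (α β : Perm X)
    (trans : ∀ s : Set X, s.Nonempty → (∀ x ∈ s, α x ∈ s) → (∀ x ∈ s, β x ∈ s) → s = Set.univ) :
    Nat.card (Cycles α) + Nat.card (Cycles β) + Nat.card (Cycles (α * β)) ≤ Nat.card X + 2 := by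
  have := Fintype.ofFinite X
  have h := finrank_eigenfunctions_add_le α β (one_mul 1) (one_mul 1)
  have h1 (π : Perm X) := card_cycles_le_finrank_eigenfunctions π 1 (fun _ => 1) (by simp) (by simp)
  have hα := h1 α
  have hβ := h1 β
  have hγ := h1 (α * β)
  -- By transitivity, a common invariant function that vanishes at one point is zero.
  have hinf : Module.finrank ℝ (eigenfunctions α 1 ⊓ eigenfunctions β 1 : Submodule ℝ (X → ℝ))
      ≤ 1 := by
    obtain ⟨x₀⟩ := ‹Nonempty X›
    let ι : (eigenfunctions α 1 ⊓ eigenfunctions β 1 : Submodule ℝ (X → ℝ)) →ₗ[ℝ] ℝ :=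
      (LinearMap.proj x₀).comp (Submodule.subtype _)
    have hι : Function.Injective ι := by
      rw [injective_iff_map_eq_zero]
      rintro ⟨f, hf, hg⟩ h0
      have := trans {x | f x = 0} ⟨x₀, h0⟩ (fun x hx => by
        have := hf x; simp_all) (fun x hx => by have := hg x; simp_all)
      ext x
      exact (this ▸ Set.mem_univ x : x ∈ {x | f x = 0})
    simpa using LinearMap.finrank_le_finrank_of_injective hι
  rw [one_mul] at h
  rw [Nat.card_eq_fintype_card (α := X)]
  omega

/-- The length of the cycle of `π` through `x`. -/
noncomputable def orbLen (π : Perm X) (x : X) : ℕ := Nat.card {y // π.SameCycle x y}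

theorem orbLen_pos [Finite X] (π : Perm X) (x : X) : 0 < orbLen π x :=
  have : Nonempty {y // π.SameCycle x y} := ⟨x, Perm.SameCycle.refl π x⟩
  Nat.card_pos

theorem cycleMk_eq_iff {π : Perm X} {x y : X} : cycleMk π x = cycleMk π y ↔ π.SameCycle x y :=
  Quotient.eq (r := Perm.SameCycle.setoid π)

theorem cycleLength_cycleMk (π : Perm X) (x : X) : cycleLength (cycleMk π x) = orbLen π x :=
  Nat.card_congr (Equiv.subtypeEquivRight fun y => by
    rw [cycleMk_eq_iff]; exact Perm.sameCycle_comm)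

theorem orbLen_congr {π : Perm X} {x y : X} (h : π.SameCycle x y) : orbLen π x = orbLen π y := by
  rw [← cycleLength_cycleMk, ← cycleLength_cycleMk, cycleMk_eq_iff.2 h]

/-- Each element carries the reciprocal of the length of its cycle, so every cycle has total weight
1. Cycle counts become sums over darts, which can be estimated term by term. -/
theorem sum_inv_orbLen [Fintype X] (π : Perm X) :
    ∑ x, ((orbLen π x : ℝ))⁻¹ = Nat.card (Cycles π) := by
  classical
  have := Fintype.ofFinite (Cycles π)
  rw [← Finset.sum_fiberwise (s := Finset.univ) (g := cycleMk π), Nat.card_eq_fintype_card]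
  trans ∑ _q : Cycles π, (1 : ℝ)
  · refine Finset.sum_congr rfl fun q _ => ?_
    obtain ⟨x, rfl⟩ := Quotient.exists_rep q
    change ∑ y ∈ Finset.univ.filter (fun y => cycleMk π y = cycleMk π x), _ = _
    rw [Finset.sum_congr rfl (g := fun _ => ((orbLen π x : ℝ))⁻¹)]
    · rw [Finset.sum_const, nsmul_eq_mul]
      have : (Finset.univ.filter (fun y => cycleMk π y = cycleMk π x)).card = orbLen π x := by
        rw [← cycleLength_cycleMk, cycleLength, Nat.card_eq_fintype_card, Fintype.card_subtype]
      rw [this]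
      exact mul_inv_cancel₀ (by exact_mod_cast (orbLen_pos π x).ne')
    · intro y hy
      rw [orbLen_congr (cycleMk_eq_iff.1 (Finset.mem_filter.1 hy).2)]
  · simp

theorem sum_inv_orbLen_cycle [Fintype X] [DecidableEq X] (π : Perm X) (x : X)
    [DecidablePred (π.SameCycle x)] :
    ∑ y ∈ Finset.univ.filter (π.SameCycle x), ((orbLen π y : ℝ))⁻¹ = 1 := by
  rw [Finset.sum_congr rfl (g := fun _ => ((orbLen π x : ℝ))⁻¹)]
  · rw [Finset.sum_const, nsmul_eq_mul]
    have : (Finset.univ.filter (π.SameCycle x)).card = orbLen π x := by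
      rw [orbLen, Nat.card_eq_fintype_card, Fintype.card_subtype]
    rw [this]
    exact mul_inv_cancel₀ (by exact_mod_cast (orbLen_pos π x).ne')
  · intro y hy
    rw [orbLen_congr (Finset.mem_filter.1 hy).2]

theorem sameCycle_iff_exists_iterate [Finite X] {π : Perm X} {x y : X} :
    π.SameCycle x y ↔ ∃ k : ℕ, (π ^ k) x = y := by
  constructor
  · intro h
    obtain ⟨k, _, hk⟩ := h.exists_pow_eq'
    exact ⟨k, hk⟩
  · rintro ⟨k, hk⟩
    exact ⟨k, by simpa using hk⟩

/-- A set closed under a permutation of a finite type contains the cycles of its elements. -/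
theorem mem_of_sameCycle [Finite X] {π : Perm X} {s : Set X} (hs : ∀ x ∈ s, π x ∈ s) {x y : X}
    (h : π.SameCycle x y) (hx : x ∈ s) : y ∈ s := by
  obtain ⟨k, rfl⟩ := sameCycle_iff_exists_iterate.1 h
  clear h
  induction k with
  | zero => exact hx
  | succ k ih => rw [pow_succ', Perm.mul_apply]; exact hs _ ih

theorem sameCycle_apply_self {π : Perm X} (x : X) : π.SameCycle x (π x) := ⟨1, by simp⟩

theorem inv_mem_of_closed [Finite X] {π : Perm X} {s : Set X} (hs : ∀ x ∈ s, π x ∈ s) {x : X}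
    (h : π x ∈ s) : x ∈ s :=
  mem_of_sameCycle hs (sameCycle_apply_self x).symm h

theorem orbLen_le_of_iterate [Finite X] {π : Perm X} {x : X} {k : ℕ} (hk : 0 < k)
    (h : (π ^ k) x = x) : orbLen π x ≤ k := by
  classical
  have hfin : ∀ y, π.SameCycle x y → y ∈ (Finset.range k).image (fun i => (π ^ i) x) := by
    intro y hy
    have : ∀ z ∈ ((Finset.range k).image (fun i => (π ^ i) x) : Set X),
        π z ∈ ((Finset.range k).image (fun i => (π ^ i) x) : Set X) := by
      intro z hz
      simp only [Finset.coe_image, Finset.coe_range, Set.mem_image, Set.mem_Iio] at hz ⊢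
      obtain ⟨i, hi, rfl⟩ := hz
      rcases Nat.lt_or_ge (i + 1) k with h1 | h1
      · exact ⟨i + 1, h1, by rw [pow_succ', Perm.mul_apply]⟩
      · have : i + 1 = k := by omega
        exact ⟨0, hk, by rw [← Perm.mul_apply, ← pow_succ', this, h]; simp⟩
    have := mem_of_sameCycle this hy (by
      simp only [Finset.coe_image, Finset.coe_range, Set.mem_image, Set.mem_Iio]
      exact ⟨0, hk, by simp⟩)
    exact_mod_cast this
  rw [orbLen]
  calc Nat.card {y // π.SameCycle x y}
      ≤ Nat.card ((Finset.range k).image (fun i => (π ^ i) x)) :=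
        Nat.card_le_card_of_injective
          (fun y => (⟨y.1, hfin y.1 y.2⟩ : ((Finset.range k).image (fun i => (π ^ i) x))))
          (fun y z e => Subtype.ext (congrArg (fun w => w.1) e))
    _ ≤ k := by
        rw [Nat.card_eq_fintype_card, Fintype.card_coe]
        exact Finset.card_image_le.trans (by simp)

theorem pow_orbLen_apply [Finite X] (π : Perm X) (x : X) : (π ^ orbLen π x) x = x := by
  classical
  have := Fintype.ofFinite X
  set m := Function.minimalPeriod π x
  have hm : (π ^ m) x = x := by
    have := Function.iterate_minimalPeriod (f := π) (x := x)
    rwa [← Perm.coe_pow] at this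
  have hpos : 0 < m := Function.minimalPeriod_pos_of_mem_periodicPts
    (Function.Injective.mem_periodicPts π.injective x)
  have h1 : orbLen π x ≤ m := orbLen_le_of_iterate hpos hm
  have h2 : m ≤ orbLen π x := by
    rw [orbLen]
    have : Function.Injective
        (fun i : Fin m => (⟨(π ^ (i : ℕ)) x, ⟨i, by simp⟩⟩ : {y // π.SameCycle x y})) := by
      intro i j e
      have e := congrArg Subtype.val e
      simp only [Perm.coe_pow] at e
      exact Fin.ext ((Function.iterate_injOn_Iio_minimalPeriod (f := π) (x := x))
        i.2 j.2 e)
    simpa using Nat.card_le_card_of_injective _ this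
  rw [le_antisymm h1 h2, hm]

end Ree

end CombMap

/-! ### Regions of the complement of an edge set, and the local Euler formula -/

namespace CombMap

section Taut

variable {D : Type*} (M : CombMap D)

/-- Walk along a dart and go straight on. -/
def str : Perm D := M.rot * M.rot * M.edge

theorem str_apply (d : D) : M.str d = M.rot (M.rot (M.edge d)) := rfl

theorem rot_inv_rot (d : D) : M.rot (M.rot⁻¹ d) = d := M.rot.apply_symm_apply d

theorem inv_rot_rot (d : D) : M.rot⁻¹ (M.rot d) = d := M.rot.symm_apply_apply d

theorem facePerm_apply (d : D) : M.facePerm d = M.rot⁻¹ (M.edge d) := rfl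

/-- A connected 4-valent map with faces of length at most 4 and without self-intersecting central
circuits. -/
structure IsTame : Prop where
  rot4 : ∀ d, M.rot (M.rot (M.rot (M.rot d))) = d
  rot2 : ∀ d, M.rot (M.rot d) ≠ d
  face_le : ∀ d, orbLen M.facePerm d ≤ 4
  conn : ∀ T : Set D, T.Nonempty → (∀ d ∈ T, M.rot d ∈ T) → (∀ d ∈ T, M.edge d ∈ T) → T = Set.univ
  pure : ∀ d, M.circuit (M.rot d) ≠ M.circuit d

/-- A tame map without rail-roads. -/
structure IsTaut : Prop extends M.IsTame where
  irr : ∀ d, ∃ k : ℕ, orbLen M.facePerm ((M.str ^ k) d) ≠ 4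

/-- A set of edges, as a set of darts. -/
def EdgeClosed (S : Set D) : Prop := ∀ d ∈ S, M.edge d ∈ S

variable {M} in
theorem EdgeClosed.mem_iff {S : Set D} (hS : M.EdgeClosed S) {d : D} : M.edge d ∈ S ↔ d ∈ S :=
  ⟨fun h => by simpa [M.edge_edge] using hS _ h, hS d⟩

variable {M} in
theorem EdgeClosed.compl {S : Set D} (hS : M.EdgeClosed S) : M.EdgeClosed Sᶜ :=
  fun _ h h' => h (hS.mem_iff.1 h')

open Classical in
/-- The permutation that reverses the darts of `S`. -/
noncomputable def edgeOn {S : Set D} (hS : M.EdgeClosed S) : Perm D :=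
  Function.Involutive.toPerm (fun d => if d ∈ S then M.edge d else d) fun d => by
    by_cases h : d ∈ S <;> simp [h, hS.mem_iff, M.edge_edge]

variable {M} in
theorem edgeOn_of_mem {S : Set D} (hS : M.EdgeClosed S) {d : D} (h : d ∈ S) :
    M.edgeOn hS d = M.edge d := if_pos h

variable {M} in
theorem edgeOn_of_notMem {S : Set D} (hS : M.EdgeClosed S) {d : D} (h : d ∉ S) :
    M.edgeOn hS d = d := if_neg h

/-- Walk along the boundary of a component of the complement of `S`, on its left: the cycles through
darts of `S` are the boundary walks, together with the darts that leave them into the component. -/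
noncomputable def walkPerm {S : Set D} (hS : M.EdgeClosed S) : Perm D := M.rot⁻¹ * M.edgeOn hS

section

variable {M} {S : Set D} (hS : M.EdgeClosed S)

theorem walkPerm_of_mem {d : D} (h : d ∈ S) : M.walkPerm hS d = M.rot⁻¹ (M.edge d) := by
  rw [walkPerm, Perm.mul_apply, edgeOn_of_mem hS h]

theorem walkPerm_of_notMem {d : D} (h : d ∉ S) : M.walkPerm hS d = M.rot⁻¹ d := by
  rw [walkPerm, Perm.mul_apply, edgeOn_of_notMem hS h]

/-- The genus inequality is applied to this factorization, restricted to one region: the first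
factor describes vertices and boundary walks, the second one the edges inside the region, the
product the faces. -/
theorem walkPerm_mul_edgeOn : M.walkPerm hS * M.edgeOn hS.compl = M.facePerm := by
  ext d
  by_cases h : d ∈ S
  · rw [Perm.mul_apply, edgeOn_of_notMem _ (by simpa using h), walkPerm_of_mem hS h, facePerm_apply]
  · rw [Perm.mul_apply, edgeOn_of_mem _ (by simpa using h),
      walkPerm_of_notMem hS (by rwa [hS.mem_iff]), facePerm_apply]

end

/-- The faces on the left of `d` and `d'` can be connected without crossing `S`. -/
def SameRegion (S : Set D) (d d' : D) : Prop :=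
  ∀ T : Set D, (∀ x ∈ T, M.facePerm x ∈ T) → (∀ x ∈ T, x ∉ S → M.edge x ∈ T) → d ∈ T → d' ∈ T

section

variable {M} {S : Set D}

theorem SameRegion.refl (d : D) : M.SameRegion S d d := fun _ _ _ h => h

theorem SameRegion.trans {d d' d'' : D} (h : M.SameRegion S d d') (h' : M.SameRegion S d' d'') :
    M.SameRegion S d d'' := fun T h1 h2 h3 => h' T h1 h2 (h T h1 h2 h3)

theorem SameRegion.face (d : D) : M.SameRegion S d (M.facePerm d) := fun _ h _ hd => h _ hd

theorem SameRegion.edge {d : D} (h : d ∉ S) : M.SameRegion S d (M.edge d) :=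
  fun _ _ h' hd => h' _ hd h

theorem SameRegion.symm [Finite D] (hS : M.EdgeClosed S) {d d' : D} (h : M.SameRegion S d d') :
    M.SameRegion S d' d := by
  intro T h1 h2 h3
  by_contra h4
  refine h Tᶜ (fun x hx hx' => hx (inv_mem_of_closed h1 hx')) (fun x hx hxS hx' => hx ?_) h4 h3
  have := h2 _ hx' (by rwa [hS.mem_iff])
  rwa [M.edge_edge] at this

/-- To turn from a dart outside `S` to the previous dart at its vertex is to cross its edge and then
to follow a face. -/
theorem SameRegion.walk (hS : M.EdgeClosed S) (d : D) : M.SameRegion S d (M.walkPerm hS d) := by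
  intro T h1 h2 h3
  by_cases h : d ∈ S
  · rw [walkPerm_of_mem hS h]; exact h1 _ h3
  · rw [walkPerm_of_notMem hS h]
    have := h1 _ (h2 _ h3 h)
    rwa [facePerm_apply, M.edge_edge] at this

theorem SameRegion.of_sameCycle [Finite D] (hS : M.EdgeClosed S) {d d' : D}
    (h : (M.walkPerm hS).SameCycle d d') : M.SameRegion S d d' :=
  mem_of_sameCycle (s := {x | M.SameRegion S d x}) (fun x hx => hx.trans (SameRegion.walk hS x)) h
    (SameRegion.refl d)

end

theorem IsTame.inv_rot {M : CombMap D} (hM : M.IsTame) (d : D) :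
    M.rot⁻¹ d = M.rot (M.rot (M.rot d)) := by
  rw [Perm.inv_eq_iff_eq, hM.rot4]

theorem IsTame.inv_inv_rot {M : CombMap D} (hM : M.IsTame) (d : D) :
    M.rot⁻¹ (M.rot⁻¹ d) = M.rot (M.rot d) := by
  rw [Perm.inv_eq_iff_eq, hM.inv_rot]

/-- Every vertex is disjoint from `S` or has at least two darts in `S`, and two opposite ones if it
has exactly two. -/
def NoBend (S : Set D) : Prop := ∀ d ∈ S, M.rot d ∈ S ∨ M.rot (M.rot d) ∈ S

theorem NoBend.inv {M : CombMap D} (hM : M.IsTame) {S : Set D} (h : M.NoBend S) {d : D}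
    (hd : d ∈ S) : M.rot⁻¹ d ∈ S ∨ M.rot⁻¹ (M.rot⁻¹ d) ∈ S := by
  rw [hM.inv_inv_rot, hM.inv_rot]
  rcases h d hd with h1 | h1
  · exact (h _ h1).symm
  · exact Or.inr h1

theorem orbLen_subtypePerm {X : Type*} {π : Perm X} {p : X → Prop} (h : ∀ x, p (π x) ↔ p x)
    (x : {x // p x}) (hmem : ∀ y, π.SameCycle x y → p y) :
    orbLen (π.subtypePerm h) x = orbLen π x :=
  Nat.card_congr
    { toFun := fun y => ⟨y.1.1, Perm.sameCycle_subtypePerm.1 y.2⟩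
      invFun := fun y => ⟨⟨y.1, hmem _ y.2⟩, Perm.sameCycle_subtypePerm.2 y.2⟩
      left_inv := fun _ => rfl
      right_inv := fun _ => rfl }

/-- The local form of Euler's formula: a component of the complement of `S` has at most two boundary
walks, and its corners and its curvature are bounded. -/
theorem IsTame.region_bound [Fintype D] {M : CombMap D} (hM : M.IsTame) {S : Set D}
    (hS : M.EdgeClosed S) (hb : M.NoBend S) (d : D) [Fintype {x // M.SameRegion S d x}]
    [DecidablePred fun x : {x // M.SameRegion S d x} => x.1 ∈ S ∧ M.rot x.1 ∈ S]
    (W : Finset {x // M.SameRegion S d x}) (hW : ∀ x ∈ W, x.1 ∈ S)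
    (hW' : ∀ x ∈ W, ∀ y ∈ W, (M.walkPerm hS).SameCycle x.1 y.1 → x = y) :
    4 * (W.card : ℝ) +
      ((Finset.univ.filter
        fun x : {x // M.SameRegion S d x} => x.1 ∈ S ∧ M.rot x.1 ∈ S).card : ℝ) +
      ∑ x : {x // M.SameRegion S d x}, (4 * ((orbLen M.facePerm x.1 : ℝ))⁻¹ - 1) ≤ 8 := by
  classical
  have hcl {π : Perm D} (h : ∀ x, M.SameRegion S d x → M.SameRegion S d (π x)) (x : D) :
      M.SameRegion S d (π x) ↔ M.SameRegion S d x :=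
    ⟨fun h' => inv_mem_of_closed (s := {x | M.SameRegion S d x}) h h', h x⟩
  have hA := hcl (π := M.walkPerm hS) fun x hx => hx.trans (SameRegion.walk hS x)
  have hB := hcl (π := M.edgeOn hS.compl) fun x hx => by
    by_cases h : x ∈ S
    · rwa [edgeOn_of_notMem _ (by simpa using h)]
    · rw [edgeOn_of_mem _ (by simpa using h)]; exact hx.trans (SameRegion.edge h)
  have hC := hcl (π := M.facePerm) fun x hx => hx.trans (SameRegion.face x)
  have hlen {π : Perm D} (h : ∀ x, M.SameRegion S d (π x) ↔ M.SameRegion S d x)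
      (x : {x // M.SameRegion S d x}) : orbLen (π.subtypePerm h) x = orbLen π x :=
    orbLen_subtypePerm h x fun y hy =>
      mem_of_sameCycle (s := {x | M.SameRegion S d x}) (fun x hx => (h x).2 hx) hy x.2
  have hABC : (M.walkPerm hS).subtypePerm hA * (M.edgeOn hS.compl).subtypePerm hB =
      M.facePerm.subtypePerm hC := by
    ext x
    simp only [Perm.mul_apply, Perm.subtypePerm_apply]
    rw [← Perm.mul_apply, walkPerm_mul_edgeOn]
  have : Nonempty {x // M.SameRegion S d x} := ⟨⟨d, SameRegion.refl d⟩⟩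
  -- By definition, a region is a single orbit of the group generated by the two factors.
  have key := card_cycles_add_le ((M.walkPerm hS).subtypePerm hA)
    ((M.edgeOn hS.compl).subtypePerm hB) (by
      rintro s ⟨x₀, hx₀⟩ h1 h2
      rw [Set.eq_univ_iff_forall]
      rintro ⟨x, hx⟩
      have := (x₀.2.symm hS).trans hx
      have := this {y | ∃ h : M.SameRegion S d y, (⟨y, h⟩ : {x // M.SameRegion S d x}) ∈ s}
        (by
          rintro y ⟨h, hy⟩
          refine ⟨(hC y).2 h, ?_⟩
          have := h1 _ (h2 _ hy)
          rw [← Perm.mul_apply, hABC] at this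
          exact this)
        (by
          rintro y ⟨h, hy⟩ hyS
          refine ⟨h.trans (SameRegion.edge hyS), ?_⟩
          have := h2 _ hy
          simp only [Perm.subtypePerm_apply, edgeOn_of_mem hS.compl (d := y) hyS] at this
          exact this)
        ⟨x₀.2, hx₀⟩
      exact this.2)
  rw [hABC] at key
  have key' : (Nat.card (Cycles ((M.walkPerm hS).subtypePerm hA)) : ℝ) +
      Nat.card (Cycles ((M.edgeOn hS.compl).subtypePerm hB)) +
      Nat.card (Cycles (M.facePerm.subtypePerm hC)) ≤
      Nat.card {x // M.SameRegion S d x} + 2 := by exact_mod_cast key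
  rw [← sum_inv_orbLen, ← sum_inv_orbLen, ← sum_inv_orbLen] at key'
  simp only [hlen] at key'
  have inv_ge {a b : ℕ} (h : 0 < a) (h' : a ≤ b) : ((b : ℝ))⁻¹ ≤ (a : ℝ)⁻¹ := by
    gcongr
  -- A lower bound for the number of cycles of the walk permutation: every vertex off `S` is a cycle
  -- of four darts, and every element of `W` stands for one boundary walk. By `NoBend`, two
  -- consecutive darts outside `S` mean that the vertex is off `S`.
  have hwalk : ∑ x : {x // M.SameRegion S d x},
      (if x.1 ∉ S ∧ M.rot⁻¹ x.1 ∉ S then (1 / 4 : ℝ) else 0) + W.card ≤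
      ∑ x : {x // M.SameRegion S d x}, ((orbLen (M.walkPerm hS) x.1 : ℝ))⁻¹ := by
    rw [← Finset.sum_filter_add_sum_filter_not Finset.univ
      (fun x : {x // M.SameRegion S d x} => x.1 ∉ S ∧ M.rot⁻¹ x.1 ∉ S)
      (fun x => ((orbLen (M.walkPerm hS) x.1 : ℝ))⁻¹), ← Finset.sum_filter]
    refine add_le_add (Finset.sum_le_sum fun x hx => ?_) ?_
    · obtain ⟨h1, h2⟩ := (Finset.mem_filter.1 hx).2
      have h3 : M.rot⁻¹ (M.rot⁻¹ x.1) ∉ S := by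
        rw [hM.inv_inv_rot]
        intro h
        rcases hb _ h with h' | h'
        · exact h2 (by rwa [hM.inv_rot])
        · exact h1 (by rwa [hM.rot4] at h')
      have h4 : M.rot⁻¹ (M.rot⁻¹ (M.rot⁻¹ x.1)) ∉ S := by
        rw [hM.inv_inv_rot, M.rot_inv_rot]
        intro h
        rcases hb _ h with h' | h'
        · exact h3 (by rwa [hM.inv_inv_rot])
        · exact h2 (by rwa [hM.inv_rot])
      have h5 : ((M.walkPerm hS) ^ 4) x.1 = x.1 := by
        simp only [pow_succ, pow_zero, one_mul, Perm.mul_apply]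
        rw [walkPerm_of_notMem hS h1, walkPerm_of_notMem hS h2, walkPerm_of_notMem hS h3,
          walkPerm_of_notMem hS h4, hM.inv_inv_rot, hM.inv_inv_rot, hM.rot4]
      have := inv_ge (orbLen_pos _ _) (orbLen_le_of_iterate (by norm_num) h5)
      norm_num at this ⊢
      exact this
    · have hsub : W.biUnion (fun w => Finset.univ.filter
          (((M.walkPerm hS).subtypePerm hA).SameCycle w)) ⊆ Finset.univ.filter
          (fun x : {x // M.SameRegion S d x} => ¬ (x.1 ∉ S ∧ M.rot⁻¹ x.1 ∉ S)) := by
        intro x hx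
        obtain ⟨w, hw, hx⟩ := Finset.mem_biUnion.1 hx
        have hx := Perm.sameCycle_subtypePerm.1 (Finset.mem_filter.1 hx).2
        refine Finset.mem_filter.2 ⟨Finset.mem_univ _, fun ⟨h1, h2⟩ => ?_⟩
        have := mem_of_sameCycle (s := {y | y ∈ S ∨ M.rot⁻¹ y ∈ S}) (fun y hy => by
          by_cases h : y ∈ S
          · rw [walkPerm_of_mem hS h]; exact hb.inv hM (hS _ h)
          · rw [walkPerm_of_notMem hS h]; exact Or.inl (hy.resolve_left h)) hx (Or.inl (hW w hw))
        exact this.elim h1 h2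
      refine le_trans ?_ (Finset.sum_le_sum_of_subset_of_nonneg hsub fun _ _ _ => by positivity)
      rw [Finset.sum_biUnion]
      · have : ∀ w ∈ W, ∑ x ∈ Finset.univ.filter (((M.walkPerm hS).subtypePerm hA).SameCycle w),
            ((orbLen (M.walkPerm hS) x.1 : ℝ))⁻¹ = 1 := fun w _ => by
          rw [← sum_inv_orbLen_cycle ((M.walkPerm hS).subtypePerm hA) w]
          simp only [hlen]
        rw [Finset.sum_congr rfl this]
        simp
      · intro x hx y hy hxy
        rw [Function.onFun, Finset.disjoint_left]
        intro z hz hz'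
        have hz := Perm.sameCycle_subtypePerm.1 (Finset.mem_filter.1 hz).2
        have hz' := Perm.sameCycle_subtypePerm.1 (Finset.mem_filter.1 hz').2
        exact hxy (hW' x hx y hy (hz.trans hz'.symm))
  have hedge : ∑ x : {x // M.SameRegion S d x}, (if x.1 ∈ S then (1 : ℝ) else 1 / 2) ≤
      ∑ x : {x // M.SameRegion S d x}, ((orbLen (M.edgeOn hS.compl) x.1 : ℝ))⁻¹ := by
    refine Finset.sum_le_sum fun x _ => ?_
    split_ifs with h
    · have : ((M.edgeOn hS.compl) ^ 1) x.1 = x.1 := by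
        rw [pow_one]; exact edgeOn_of_notMem _ (by simpa using h)
      simpa using inv_ge (orbLen_pos _ _) (orbLen_le_of_iterate one_pos this)
    · have : ((M.edgeOn hS.compl) ^ 2) x.1 = x.1 := by
        rw [pow_two, Perm.mul_apply, edgeOn_of_mem hS.compl (d := x.1) h,
          edgeOn_of_mem hS.compl (d := M.edge x.1) (hS.compl _ h), M.edge_edge]
      simpa using inv_ge (orbLen_pos _ _) (orbLen_le_of_iterate two_pos this)
  -- A dart that enters the region where its boundary runs straight is followed, in the boundary
  -- walk, by a dart of `S` that is not at a corner.
  have hcorner : (Finset.univ.filter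
        fun x : {x // M.SameRegion S d x} => x.1 ∉ S ∧ M.rot⁻¹ x.1 ∈ S).card ≤
      (Finset.univ.filter
        fun x : {x // M.SameRegion S d x} => x.1 ∈ S ∧ M.rot x.1 ∉ S).card := by
    refine Finset.card_le_card_of_injOn (fun x => (M.walkPerm hS).subtypePerm hA x) ?_
      (Equiv.injective _).injOn
    intro x hx
    obtain ⟨h1, h2⟩ := (Finset.mem_filter.1 hx).2
    refine Finset.mem_coe.2 (Finset.mem_filter.2 ⟨Finset.mem_univ _, ?_⟩)
    simp only [Perm.subtypePerm_apply]
    rw [walkPerm_of_notMem hS h1, M.rot_inv_rot]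
    exact ⟨h2, h1⟩
  have hcorner' : ∑ x : {x // M.SameRegion S d x},
        (if x.1 ∉ S ∧ M.rot⁻¹ x.1 ∈ S then (1 : ℝ) else 0) ≤
      ∑ x : {x // M.SameRegion S d x}, (if x.1 ∈ S ∧ M.rot x.1 ∉ S then (1 : ℝ) else 0) := by
    rw [← Finset.sum_filter, ← Finset.sum_filter]
    simpa using hcorner
  have hK : ((Finset.univ.filter
        fun x : {x // M.SameRegion S d x} => x.1 ∈ S ∧ M.rot x.1 ∈ S).card : ℝ) =
      ∑ x : {x // M.SameRegion S d x}, (if x.1 ∈ S ∧ M.rot x.1 ∈ S then (1 : ℝ) else 0) := by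
    rw [← Finset.sum_filter]; simp
  have hX : (Nat.card {x // M.SameRegion S d x} : ℝ) = ∑ _x : {x // M.SameRegion S d x}, (1 : ℝ) := by
    simp
  -- The identity holds for each dart: in `S` it reads `1 = 4 - 3`, outside `S` it reads `0 = 1 + 2
  -- - 3`.
  have hpt : ∑ x : {x // M.SameRegion S d x},
      ((if x.1 ∈ S ∧ M.rot x.1 ∈ S then (1 : ℝ) else 0) +
       (if x.1 ∈ S ∧ M.rot x.1 ∉ S then (1 : ℝ) else 0)) =
      ∑ x : {x // M.SameRegion S d x}, (if x.1 ∉ S ∧ M.rot⁻¹ x.1 ∈ S then (1 : ℝ) else 0) +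
      4 * (∑ x : {x // M.SameRegion S d x},
        (if x.1 ∉ S ∧ M.rot⁻¹ x.1 ∉ S then (1 / 4 : ℝ) else 0)) +
      4 * (∑ x : {x // M.SameRegion S d x}, (if x.1 ∈ S then (1 : ℝ) else 1 / 2)) -
      3 * (∑ _x : {x // M.SameRegion S d x}, (1 : ℝ)) := by
    rw [Finset.mul_sum, Finset.mul_sum, Finset.mul_sum, ← Finset.sum_add_distrib,
      ← Finset.sum_add_distrib, ← Finset.sum_sub_distrib]
    refine Finset.sum_congr rfl fun x _ => ?_
    by_cases h1 : x.1 ∈ S <;> by_cases h2 : M.rot x.1 ∈ S <;> by_cases h3 : M.rot⁻¹ x.1 ∈ S <;>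
      simp only [h1, h2, h3, not_true, not_false_eq_true, and_true, and_false, if_true, if_false] <;>
      norm_num
  rw [Finset.sum_add_distrib] at hpt
  rw [hK, Finset.sum_sub_distrib, ← Finset.mul_sum]
  rw [hX] at key'
  linarith

/-- A boundary walk has at most four corners. -/
theorem IsTame.card_corners_le [Finite D] {M : CombMap D} (hM : M.IsTame) {S : Set D}
    (hS : M.EdgeClosed S) (hb : M.NoBend S) {d : D} (hd : d ∈ S) (K : Finset D)
    (hK : ∀ x ∈ K, (M.walkPerm hS).SameCycle d x ∧ x ∈ S ∧ M.rot x ∈ S) : K.card ≤ 4 := by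
  classical
  have := Fintype.ofFinite D
  have h := hM.region_bound hS hb d {⟨d, SameRegion.refl d⟩} (by simpa using hd) (by simp)
  have h1 : K.card ≤ (Finset.univ.filter
      fun x : {x // M.SameRegion S d x} => x.1 ∈ S ∧ M.rot x.1 ∈ S).card := by
    refine Finset.card_le_card_of_injOn
      (fun x => if h : M.SameRegion S d x then ⟨x, h⟩ else ⟨d, SameRegion.refl d⟩) ?_ ?_
    · intro x hx
      have hx := hK x hx
      have hr := SameRegion.of_sameCycle hS hx.1
      refine Finset.mem_coe.2 (Finset.mem_filter.2 ⟨Finset.mem_univ _, ?_⟩)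
      simpa [hr] using hx.2
    · intro x hx y hy e
      have hx := SameRegion.of_sameCycle hS (hK x hx).1
      have hy := SameRegion.of_sameCycle hS (hK y hy).1
      simpa [hx, hy] using e
  have h2 : 0 ≤ ∑ x : {x // M.SameRegion S d x}, (4 * ((orbLen M.facePerm x.1 : ℝ))⁻¹ - 1) := by
    refine Finset.sum_nonneg fun x _ => ?_
    have h3 : (orbLen M.facePerm x.1 : ℝ) ≤ 4 := by exact_mod_cast hM.face_le x.1
    have h4 : (0 : ℝ) < orbLen M.facePerm x.1 := by exact_mod_cast orbLen_pos _ _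
    have : (4 : ℝ)⁻¹ ≤ (orbLen M.facePerm x.1 : ℝ)⁻¹ := by gcongr
    linarith
  have h3 : (K.card : ℝ) ≤ (Finset.univ.filter
      fun x : {x // M.SameRegion S d x} => x.1 ∈ S ∧ M.rot x.1 ∈ S).card := by exact_mod_cast h1
  simp only [Finset.card_singleton, Nat.cast_one] at h
  have : (K.card : ℝ) ≤ 4 := by linarith
  exact_mod_cast this

/-- A component of the complement of `S` has a single boundary walk. -/
theorem IsTaut.sameCycle_of_sameRegion_of_mem [Finite D] {M : CombMap D} (hM : M.IsTaut)
    {S : Set D} (hS : M.EdgeClosed S) (hb : M.NoBend S) {d d' : D} (hd : d ∈ S) (hd' : d' ∈ S)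
    (h : M.SameRegion S d d') : (M.walkPerm hS).SameCycle d d' := by
  classical
  have := Fintype.ofFinite D
  by_contra hc
  have hne : (⟨d, SameRegion.refl d⟩ : {x // M.SameRegion S d x}) ≠ ⟨d', h⟩ := by
    intro e
    have e := congrArg Subtype.val e
    exact hc (by rw [show d = d' from e])
  have hb8 := hM.region_bound hS hb d {⟨d, SameRegion.refl d⟩, ⟨d', h⟩}
    (by simpa using ⟨hd, hd'⟩) (by
      intro x hx y hy hxy
      simp only [Finset.mem_insert, Finset.mem_singleton] at hx hy
      rcases hx with rfl | rfl <;> rcases hy with rfl | rfl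
      · rfl
      · exact absurd hxy hc
      · exact absurd hxy.symm hc
      · rfl)
  rw [Finset.card_pair hne] at hb8
  have hnn : ∀ x : {x // M.SameRegion S d x},
      0 ≤ (4 * ((orbLen M.facePerm x.1 : ℝ))⁻¹ - 1) := by
    intro x
    have h3 : (orbLen M.facePerm x.1 : ℝ) ≤ 4 := by exact_mod_cast hM.face_le x.1
    have h4 : (0 : ℝ) < orbLen M.facePerm x.1 := by exact_mod_cast orbLen_pos _ _
    have : (4 : ℝ)⁻¹ ≤ (orbLen M.facePerm x.1 : ℝ)⁻¹ := by gcongr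
    linarith
  have hsum : 0 ≤ ∑ x : {x // M.SameRegion S d x}, (4 * ((orbLen M.facePerm x.1 : ℝ))⁻¹ - 1) :=
    Finset.sum_nonneg fun x _ => hnn x
  -- Two boundary walks already account for 8 in the bound, so there is no corner and no curvature.
  have hcard : ((Finset.univ.filter
      fun x : {x // M.SameRegion S d x} => x.1 ∈ S ∧ M.rot x.1 ∈ S).card : ℝ) = 0 := by
    have : (0 : ℝ) ≤ ((Finset.univ.filter
      fun x : {x // M.SameRegion S d x} => x.1 ∈ S ∧ M.rot x.1 ∈ S).card : ℝ) := by positivity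
    push_cast at hb8
    linarith
  have hsum0 : ∑ x : {x // M.SameRegion S d x}, (4 * ((orbLen M.facePerm x.1 : ℝ))⁻¹ - 1) = 0 := by
    push_cast at hb8
    linarith
  rw [Finset.sum_eq_zero_iff_of_nonneg fun x _ => hnn x] at hsum0
  have hlen : ∀ x, M.SameRegion S d x → orbLen M.facePerm x = 4 := by
    intro x hx
    have := hsum0 ⟨x, hx⟩ (Finset.mem_univ _)
    have h4 : (0 : ℝ) < orbLen M.facePerm x := by exact_mod_cast orbLen_pos _ _
    have h5 : (orbLen M.facePerm x : ℝ) = 4 := by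
      field_simp at this
      linarith
    exact_mod_cast h5
  have hno : ∀ x, M.SameRegion S d x → x ∈ S → M.rot x ∉ S := by
    intro x hx h1 h2
    have : (⟨x, hx⟩ : {x // M.SameRegion S d x}) ∈ (Finset.univ.filter
      fun x : {x // M.SameRegion S d x} => x.1 ∈ S ∧ M.rot x.1 ∈ S) :=
      Finset.mem_filter.2 ⟨Finset.mem_univ _, h1, h2⟩
    have hc0 : (Finset.univ.filter
      fun x : {x // M.SameRegion S d x} => x.1 ∈ S ∧ M.rot x.1 ∈ S).card = 0 := by
      exact_mod_cast hcard
    rw [Finset.card_eq_zero] at hc0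
    rw [hc0] at this
    simp at this
  -- Without corners the boundary walk never turns. The straight walk from `d` stays on the
  -- boundary, with 4-gons on its left, and this is a rail-road.
  have hstr : ∀ x, M.SameRegion S d x ∧ x ∈ S → M.SameRegion S d (M.str x) ∧ M.str x ∈ S := by
    rintro x ⟨hx, hxS⟩
    have h1 := hx.trans (SameRegion.walk hS x)
    have h2 := h1.trans (SameRegion.walk hS _)
    rw [walkPerm_of_mem hS hxS] at h1 h2
    have h3 : M.rot⁻¹ (M.edge x) ∉ S := by
      intro h
      refine hno _ h1 h ?_
      rw [M.rot_inv_rot]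
      exact hS _ hxS
    rw [walkPerm_of_notMem hS h3, hM.inv_inv_rot] at h2
    refine ⟨h2, ?_⟩
    have := (hb.inv hM.toIsTame (hS _ hxS)).resolve_left h3
    rwa [hM.inv_inv_rot] at this
  have hpow : ∀ k : ℕ, M.SameRegion S d ((M.str ^ k) d) ∧ (M.str ^ k) d ∈ S := by
    intro k
    induction k with
    | zero => exact ⟨SameRegion.refl d, hd⟩
    | succ k ih => rw [pow_succ', Perm.mul_apply]; exact hstr _ ih
  obtain ⟨k, hk⟩ := hM.irr d
  exact hk (hlen _ (hpow k).1)

/-- A boundary walk also passes through the darts that leave `S` into the region. This is the form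
needed for stubs, which are not in `S`. -/
theorem IsTaut.sameCycle_of_sameRegion [Finite D] {M : CombMap D} (hM : M.IsTaut)
    {S : Set D} (hS : M.EdgeClosed S) (hb : M.NoBend S) {d d' : D}
    (hd : d ∈ S ∨ M.rot⁻¹ d ∈ S) (hd' : d' ∈ S ∨ M.rot⁻¹ d' ∈ S)
    (h : M.SameRegion S d d') : (M.walkPerm hS).SameCycle d d' := by
  have aux : ∀ x, (x ∈ S ∨ M.rot⁻¹ x ∈ S) → ∃ y ∈ S, (M.walkPerm hS).SameCycle x y := by
    intro x hx
    by_cases h : x ∈ S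
    · exact ⟨x, h, Perm.SameCycle.refl _ _⟩
    · exact ⟨_, hx.resolve_left h, walkPerm_of_notMem hS h ▸ sameCycle_apply_self x⟩
  obtain ⟨y, hy, hxy⟩ := aux d hd
  obtain ⟨y', hy', hxy'⟩ := aux d' hd'
  refine hxy.trans (Perm.SameCycle.trans ?_ hxy'.symm)
  exact hM.sameCycle_of_sameRegion_of_mem hS hb hy hy'
    (((SameRegion.of_sameCycle hS hxy).symm hS).trans (h.trans (SameRegion.of_sameCycle hS hxy')))

end Taut

end CombMap

/-! ### Central circuits as straight walks -/

namespace CombMap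

section Straight

variable {D : Type*} {M : CombMap D}

theorem circuit_edge (d : D) : M.circuit (M.edge d) = M.circuit d :=
  Quotient.sound ((MulAction.orbitRel_apply ..).2
    ⟨⟨M.edge, Subgroup.subset_closure (by simp)⟩, rfl⟩)

theorem circuit_rot_rot (d : D) : M.circuit (M.rot (M.rot d)) = M.circuit d :=
  Quotient.sound ((MulAction.orbitRel_apply ..).2
    ⟨⟨M.rot ^ 2, Subgroup.subset_closure (by simp)⟩, rfl⟩)

theorem circuit_str (d : D) : M.circuit (M.str d) = M.circuit d := by
  rw [str_apply, circuit_rot_rot, circuit_edge]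

theorem circuit_str_pow (k : ℕ) (d : D) : M.circuit ((M.str ^ k) d) = M.circuit d := by
  induction k with
  | zero => rfl
  | succ k ih => rw [pow_succ', Perm.mul_apply, circuit_str, ih]

/-- A set closed under `rot ^ 2` and `edge` is a union of central circuits. -/
theorem mem_of_circuit_eq [Finite D] {T : Set D} (h1 : ∀ d ∈ T, M.rot (M.rot d) ∈ T)
    (h2 : ∀ d ∈ T, M.edge d ∈ T) {d d' : D} (h : M.circuit d' = M.circuit d) (hd : d ∈ T) :
    d' ∈ T := by
  obtain ⟨⟨g, hg⟩, rfl⟩ := (MulAction.orbitRel_apply ..).1 (Quotient.exact h)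
  change g d ∈ T
  clear h
  induction hg using Subgroup.closure_induction generalizing d with
  | mem x hx =>
    rcases hx with rfl | hx
    · exact h1 d hd
    · rw [Set.mem_singleton_iff.1 hx]; exact h2 d hd
  | one => exact hd
  | mul x y _ _ hx hy => exact hx (hy hd)
  | inv x _ hx =>
    refine inv_mem_of_closed (π := x) (fun z hz => hx hz) ?_
    rwa [Perm.inv_def, Equiv.apply_symm_apply]

theorem str_pow_succ (k : ℕ) (d : D) : (M.str ^ (k + 1)) d = M.str ((M.str ^ k) d) := by
  rw [pow_succ', Perm.mul_apply]

theorem str_pow_add (k l : ℕ) (d : D) : (M.str ^ (k + l)) d = (M.str ^ l) ((M.str ^ k) d) := by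
  rw [add_comm, pow_add, Perm.mul_apply]

theorem IsTame.rot_rot_str (hM : M.IsTame) (d : D) :
    M.rot (M.rot (M.str d)) = M.edge d := by rw [str_apply, hM.rot4]

theorem IsTame.rot_ne (hM : M.IsTame) (d : D) : M.rot d ≠ d := fun h => by
  have := hM.rot2 d
  rw [h, h] at this
  exact this rfl

/-- Walking back. -/
theorem IsTame.str_pow_edge (hM : M.IsTame) (d : D) (k l : ℕ) :
    (M.str ^ l) (M.edge ((M.str ^ (k + l)) d)) = M.edge ((M.str ^ k) d) := by
  induction l generalizing k with
  | zero => rfl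
  | succ l ih =>
    rw [pow_succ', Perm.mul_apply, show k + (l + 1) = (k + 1) + l by omega, ih, str_apply,
      M.edge_edge, str_pow_succ, hM.rot_rot_str]

/-- A straight walk does not come back in the opposite direction. -/
theorem IsTame.edge_str_pow_ne (hM : M.IsTame) (d : D) (k : ℕ) : M.edge ((M.str ^ k) d) ≠ d := by
  induction k using Nat.strong_induction_on generalizing d with
  | _ k ih =>
    intro h
    match k with
    | 0 => exact M.edge_ne d h
    | 1 =>
      have := congrArg M.edge h
      rw [M.edge_edge, pow_one, str_apply] at this
      exact hM.rot2 _ this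
    | k + 2 =>
      -- Without its first and its last edge, a walk that comes back in the opposite direction still
      -- does so.
      have := hM.str_pow_edge d (k + 1) 1
      rw [show k + 1 + 1 = k + 2 by omega, h, pow_one, show k + 1 = 1 + k by omega,
        str_pow_add, pow_one] at this
      exact ih k (by omega) (M.str d) this.symm

/-- A straight walk of `j + 1` edges from `a` to the opposite of `b`, which avoids `N` in between. -/
def Straight (M : CombMap D) (N : Set D) (a b : D) (j : ℕ) : Prop :=
  M.edge ((M.str ^ j) a) = b ∧ ∀ i, 1 ≤ i → i ≤ j → (M.str ^ i) a ∉ N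

/-- Seen from the other end, the same vertex is left by the opposite dart. -/
theorem Straight.str_pow (hM : M.IsTaut) {N : Set D} {a b : D} {j : ℕ} (h : M.Straight N a b j)
    {i : ℕ} (h1 : 1 ≤ i) (hi : i ≤ j + 1) :
    (M.str ^ (j + 1 - i)) b = M.rot (M.rot ((M.str ^ i) a)) := by
  obtain ⟨i, rfl⟩ : ∃ k, i = k + 1 := ⟨i - 1, by omega⟩
  rw [← h.1, str_pow_succ, hM.rot_rot_str, ← hM.str_pow_edge a i (j - i),
    show i + (j - i) = j by omega, show j + 1 - (i + 1) = j - i by omega]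

theorem Straight.symm (hM : M.IsTaut) {N : Set D} (hN : ∀ d, M.rot d ∈ N → d ∈ N) {a b : D}
    {j : ℕ} (h : M.Straight N a b j) : M.Straight N b a j := by
  refine ⟨?_, fun i h1 h2 hi => ?_⟩
  · rw [← h.1]
    have := hM.str_pow_edge a 0 j
    rw [zero_add, pow_zero] at this
    rw [this, Perm.one_apply, M.edge_edge]
  · have := h.str_pow hM (i := j + 1 - i) (by omega) (by omega)
    rw [show j + 1 - (j + 1 - i) = i by omega] at this
    rw [this] at hi
    exact h.2 _ (by omega) (by omega) (hN _ (hN _ hi))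

end Straight

/-! ### Codes of partial arrangements -/

/-- The next dart of the same vertex, where `4 * v + k` is the `k`-th dart of the vertex `v`. -/
def nx (x : ℕ) : ℕ := 4 * (x / 4) + (x + 1) % 4

/-- The previous dart of the same vertex. -/
def pv (x : ℕ) : ℕ := 4 * (x / 4) + (x + 3) % 4

theorem nx_lt {n x : ℕ} (h : x < 4 * n) : nx x < 4 * n := by unfold nx; omega
theorem pv_lt {n x : ℕ} (h : x < 4 * n) : pv x < 4 * n := by unfold pv; omega
theorem nx_pv (x : ℕ) : nx (pv x) = x := by unfold nx pv; omega
theorem nx_ne (x : ℕ) : nx x ≠ x := by unfold nx; omega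
theorem nx_nx_nx_nx (x : ℕ) : nx (nx (nx (nx x))) = x := by unfold nx; omega

variable {D : Type*} {M : CombMap D}

/-- The named darts. -/
def named (n : ℕ) (f : ℕ → D) : Set D := {d | ∃ x < 4 * n, f x = d}

/-- A part `S` of the edges of `M` is an arrangement with code `(n, p, lab)`: its crossings have been
numbered, `f` gives the darts at the numbered vertices, `p` tells how they are connected by straight
walks, with `p x = x` if the dart is not in `S`, and `lab` names the central circuits. -/
structure Realizes (M : CombMap D) (S : Set D) (n r : ℕ) (p lab : ℕ → ℕ) (f : ℕ → D)
    (κ : ℕ → M.CentralCircuit) : Prop where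
  f_nx : ∀ x < 4 * n, f (nx x) = M.rot (f x)
  f_inj : ∀ x < 4 * n, ∀ y < 4 * n, f x = f y → x = y
  p_lt : ∀ x < 4 * n, p x < 4 * n
  p_p : ∀ x < 4 * n, p (p x) = x
  mem_iff : ∀ x < 4 * n, f x ∈ S ↔ p x ≠ x
  p_nx : ∀ x < 4 * n, p x = x → p (nx x) ≠ nx x
  seg : ∀ x < 4 * n, p x ≠ x → ∃ j, M.Straight (named n f) (f x) (f (p x)) j
  edgeClosed : M.EdgeClosed S
  straight : ∀ d ∈ S, d ∉ named n f → M.rot (M.rot d) ∈ S ∧ M.rot d ∉ S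
  lab_lt : ∀ x < 4 * n, lab x < r
  circuit_f : ∀ x < 4 * n, M.circuit (f x) = κ (lab x)
  κ_inj : ∀ i < r, ∀ j < r, κ i = κ j → i = j

/-- Walk along the boundary of a component, on the level of codes. -/
def wk (p : ℕ → ℕ) (x : ℕ) : ℕ := pv (p x)

/-- Connect two darts. -/
def joinF (p : ℕ → ℕ) (t s : ℕ) : ℕ → ℕ := Function.update (Function.update p t s) s t

/-- Put a new vertex `n` on the segment from `x`. -/
def splitF (n : ℕ) (p : ℕ → ℕ) (x : ℕ) : ℕ → ℕ := fun y =>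
  if y < 4 * n then if y = x then 4 * n + 2 else if y = p x then 4 * n else p y
  else if y = 4 * n then p x else if y = 4 * n + 2 then x else y

/-- The labels at a new vertex. -/
def labF (n : ℕ) (lab : ℕ → ℕ) (x l : ℕ) : ℕ → ℕ := fun y =>
  if y < 4 * n then lab y else if y = 4 * n ∨ y = 4 * n + 2 then lab x else l

namespace Realizes

variable {S : Set D} {n r : ℕ} {p lab : ℕ → ℕ} {f : ℕ → D} {κ : ℕ → M.CentralCircuit}

theorem f_pv (h : Realizes M S n r p lab f κ) {x : ℕ} (hx : x < 4 * n) :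
    f (pv x) = M.rot⁻¹ (f x) := by
  rw [Perm.eq_inv_iff_eq, ← h.f_nx _ (pv_lt hx), nx_pv]

theorem rot_mem_named (h : Realizes M S n r p lab f κ) {d : D} :
    M.rot d ∈ named n f ↔ d ∈ named n f := by
  constructor
  · rintro ⟨x, hx, e⟩
    exact ⟨pv x, pv_lt hx, by rw [h.f_pv hx, e, inv_rot_rot]⟩
  · rintro ⟨x, hx, rfl⟩
    exact ⟨nx x, nx_lt hx, h.f_nx x hx⟩

theorem p_ne (h : Realizes M S n r p lab f κ) {x : ℕ} (hx : x < 4 * n) (hp : p x ≠ x) :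
    p (p x) ≠ p x := by rw [h.p_p x hx]; exact hp.symm

theorem noBend (h : Realizes M S n r p lab f κ) : M.NoBend S := by
  intro d hd
  by_cases hn : d ∈ named n f
  · obtain ⟨x, hx, rfl⟩ := hn
    by_cases h1 : p (nx x) = nx x
    · right
      have := h.p_nx _ (nx_lt hx) h1
      rwa [← h.f_nx x hx, ← h.f_nx _ (nx_lt hx), h.mem_iff _ (nx_lt (nx_lt hx))]
    · left
      rwa [← h.f_nx x hx, h.mem_iff _ (nx_lt hx)]
  · exact Or.inr (h.straight d hd hn).1

theorem named_mem (h : Realizes M S n r p lab f κ) {d : D} (hd : d ∈ named n f) :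
    d ∈ S ∨ M.rot d ∈ S := by
  obtain ⟨x, hx, rfl⟩ := hd
  by_cases h1 : p x = x
  · right; rw [← h.f_nx x hx, h.mem_iff _ (nx_lt hx)]; exact h.p_nx x hx h1
  · left; rwa [h.mem_iff x hx]

/-- At a vertex without a name `S` goes straight on, so membership propagates along the segment. -/
theorem interior_mem (h : Realizes M S n r p lab f κ) {x : ℕ} (hx : x < 4 * n) (hp : p x ≠ x)
    {j : ℕ} (hj : M.Straight (named n f) (f x) (f (p x)) j) {i : ℕ} (hi : i ≤ j) :
    (M.str ^ i) (f x) ∈ S := by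
  induction i with
  | zero => exact (h.mem_iff x hx).2 hp
  | succ i ih =>
    rw [str_pow_succ, str_apply]
    refine (h.straight _ (h.edgeClosed _ (ih (by omega))) fun hn => ?_).1
    refine hj.2 (i + 1) (by omega) hi ?_
    rwa [str_pow_succ, str_apply, h.rot_mem_named, h.rot_mem_named]

/-- Two segments do not meet at an interior vertex. -/
theorem interior_unique (h : Realizes M S n r p lab f κ) {x y : ℕ} (hx : x < 4 * n)
    (hy : y < 4 * n) {a b : D} {j k : ℕ} (hj : M.Straight (named n f) (f x) a j)
    (hk : M.Straight (named n f) (f y) b k) {i m : ℕ} (hi : i ≤ j) (hm : m ≤ k)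
    (e : (M.str ^ i) (f x) = (M.str ^ m) (f y)) : x = y ∧ i = m := by
  wlog him : i ≤ m generalizing x y a b i m j k
  · have := this hy hx hk hj hm hi e.symm (by omega)
    exact ⟨this.1.symm, this.2.symm⟩
  obtain ⟨l, rfl⟩ := Nat.exists_eq_add_of_le him
  rw [add_comm i l, str_pow_add] at e
  have e := (M.str ^ i).injective e
  rcases Nat.eq_zero_or_pos l with rfl | hl
  · exact ⟨h.f_inj x hx y hy (by simpa using e), rfl⟩
  · exact absurd ⟨x, hx, e⟩ (hk.2 l hl (by omega))

theorem mono_f (h : Realizes M S n r p lab f κ) {p' lab' : ℕ → ℕ} (hp : ∀ x < 4 * n, p' x = p x)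
    (hl : ∀ x < 4 * n, lab' x = lab x) : Realizes M S n r p' lab' f κ where
  f_nx := h.f_nx
  f_inj := h.f_inj
  p_lt x hx := by rw [hp x hx]; exact h.p_lt x hx
  p_p x hx := by rw [hp x hx, hp _ (h.p_lt x hx)]; exact h.p_p x hx
  mem_iff x hx := by rw [hp x hx]; exact h.mem_iff x hx
  p_nx x hx := by rw [hp x hx, hp _ (nx_lt hx)]; exact h.p_nx x hx
  seg x hx := by rw [hp x hx]; exact h.seg x hx
  edgeClosed := h.edgeClosed
  straight := h.straight
  lab_lt x hx := by rw [hl x hx]; exact h.lab_lt x hx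
  circuit_f x hx := by rw [hl x hx]; exact h.circuit_f x hx
  κ_inj := h.κ_inj

/-- Makes room for the label of a circuit that is about to be drawn. -/
theorem relabel (h : Realizes M S n r p lab f κ) {r' : ℕ} {κ' : ℕ → M.CentralCircuit}
    (hr : r ≤ r') (hκ : ∀ i < r, κ' i = κ i) (hinj : ∀ i < r', ∀ j < r', κ' i = κ' j → i = j) :
    Realizes M S n r' p lab f κ' where
  f_nx := h.f_nx
  f_inj := h.f_inj
  p_lt := h.p_lt
  p_p := h.p_p
  mem_iff := h.mem_iff
  p_nx := h.p_nx
  seg := h.seg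
  edgeClosed := h.edgeClosed
  straight := h.straight
  lab_lt x hx := (h.lab_lt x hx).trans_le hr
  circuit_f x hx := by rw [hκ _ (h.lab_lt x hx)]; exact h.circuit_f x hx
  κ_inj := hinj

/-- The map `f` after adding the vertex of `d` as the vertex `n`. -/
def addVertex (M : CombMap D) (n : ℕ) (f : ℕ → D) (d : D) : ℕ → D := fun y =>
  if y < 4 * n then f y else (M.rot ^ (y - 4 * n)) d

section addVertex

variable {d : D}

theorem addVertex_of_lt {y : ℕ} (hy : y < 4 * n) : addVertex M n f d y = f y := if_pos hy

theorem addVertex_add (k : ℕ) : addVertex M n f d (4 * n + k) = (M.rot ^ k) d := by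
  simp [addVertex]

theorem mem_named_addVertex {e : D} : e ∈ named (n + 1) (addVertex M n f d) ↔
    e ∈ named n f ∨ e = d ∨ e = M.rot d ∨ e = M.rot (M.rot d) ∨ e = M.rot (M.rot (M.rot d)) := by
  constructor
  · rintro ⟨x, hx, rfl⟩
    by_cases h : x < 4 * n
    · exact Or.inl ⟨x, h, (addVertex_of_lt h).symm⟩
    · obtain ⟨k, rfl⟩ := Nat.exists_eq_add_of_le (not_lt.1 h)
      right
      rw [addVertex_add]
      have : k < 4 := by omega
      interval_cases k <;> simp [pow_succ]
  · rintro (⟨x, hx, rfl⟩ | rfl | rfl | rfl | rfl)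
    · exact ⟨x, by omega, addVertex_of_lt hx⟩
    · exact ⟨4 * n + 0, by omega, by rw [addVertex_add]; rfl⟩
    · exact ⟨4 * n + 1, by omega, by rw [addVertex_add]; rfl⟩
    · exact ⟨4 * n + 2, by omega, by rw [addVertex_add]; rfl⟩
    · exact ⟨4 * n + 3, by omega, by rw [addVertex_add]; rfl⟩

end addVertex

/-- Name a vertex in the interior of a segment. -/
theorem subdivide (hM : M.IsTaut) (h : Realizes M S n r p lab f κ) {x : ℕ}
    (hx : x < 4 * n) (hp : p x ≠ x) {j : ℕ} (hj : M.Straight (named n f) (f x) (f (p x)) j) {i : ℕ}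
    (h1 : 1 ≤ i) (hi : i ≤ j) {l : ℕ} (hl : l < r)
    (hκ : M.circuit (M.rot ((M.str ^ i) (f x))) = κ l) :
    Realizes M S (n + 1) r (splitF n p x) (labF n lab x l)
      (addVertex M n f ((M.str ^ i) (f x))) κ := by
  set d := (M.str ^ i) (f x) with hd
  have hdn : d ∉ named n f := hj.2 i h1 hi
  have hdS : d ∈ S := h.interior_mem hx hp hj hi
  obtain ⟨hdS2, hdS1⟩ := h.straight d hdS hdn
  have hdS3 : M.rot (M.rot (M.rot d)) ∉ S := by
    refine (h.straight _ hdS2 ?_).2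
    rwa [h.rot_mem_named, h.rot_mem_named]
  have hpx := h.p_lt x hx
  have f0 : addVertex M n f d (4 * n) = d := addVertex_add 0
  have f1 : addVertex M n f d (4 * n + 1) = M.rot d := addVertex_add 1
  have f2 : addVertex M n f d (4 * n + 2) = M.rot (M.rot d) := addVertex_add 2
  have f3 : addVertex M n f d (4 * n + 3) = M.rot (M.rot (M.rot d)) := addVertex_add 3
  have cases4 {P : ℕ → Prop} (P0 : P (4 * n)) (P1 : P (4 * n + 1)) (P2 : P (4 * n + 2))
      (P3 : P (4 * n + 3)) (Pl : ∀ y < 4 * n, P y) : ∀ y < 4 * (n + 1), P y := by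
    intro y hy
    rcases Nat.lt_or_ge y (4 * n) with h | h
    · exact Pl y h
    · have : y = 4 * n ∨ y = 4 * n + 1 ∨ y = 4 * n + 2 ∨ y = 4 * n + 3 := by omega
      rcases this with rfl | rfl | rfl | rfl <;> assumption
  have p0 : splitF n p x (4 * n) = p x := by simp [splitF]
  have p1 : splitF n p x (4 * n + 1) = 4 * n + 1 := by simp [splitF]
  have p2 : splitF n p x (4 * n + 2) = x := by simp [splitF]
  have p3 : splitF n p x (4 * n + 3) = 4 * n + 3 := by simp [splitF]
  have px : splitF n p x x = 4 * n + 2 := by simp [splitF, hx]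
  have ppx : splitF n p x (p x) = 4 * n := by simp [splitF, hpx, hp]
  have po {y : ℕ} (hy : y < 4 * n) (hy1 : y ≠ x) (hy2 : y ≠ p x) : splitF n p x y = p y := by
    simp [splitF, hy, hy1, hy2]
  have hsym := hj.symm hM fun e => h.rot_mem_named.1
  have hrev : (M.str ^ (j + 1 - i)) (f (p x)) = M.rot (M.rot d) := hj.str_pow hM h1 (by omega)
  -- a dart of `S` on another segment is not at the new vertex
  have avoid {y : ℕ} (hy : y < 4 * n) {k : ℕ} (hpy : p y ≠ y)
      (hk : M.Straight (named n f) (f y) (f (p y)) k) {m : ℕ} (hm1 : 1 ≤ m) (hm : m ≤ k)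
      (hne : ¬ (y = x ∧ m = i)) (hne' : ¬ (y = p x ∧ m = j + 1 - i)) :
      (M.str ^ m) (f y) ∉ named (n + 1) (addVertex M n f d) := by
    have hS := h.interior_mem hy hpy hk hm
    rw [mem_named_addVertex]
    rintro (h' | h' | h' | h' | h')
    · exact hk.2 m hm1 hm h'
    · exact hne (h.interior_unique hy hx hk hj hm hi h')
    · exact hdS1 (h' ▸ hS)
    · exact hne' (h.interior_unique hy hpx hk hsym hm (by omega) (h'.trans hrev.symm))
    · exact hdS3 (h' ▸ hS)
  have hN : ∀ e, M.rot e ∈ named (n + 1) (addVertex M n f d) →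
      e ∈ named (n + 1) (addVertex M n f d) := by
    intro e
    rw [mem_named_addVertex, mem_named_addVertex, h.rot_mem_named]
    rintro (h' | h' | h' | h' | h')
    · exact Or.inl h'
    · rw [← hM.rot4 d] at h'
      simp [M.rot.injective h']
    · simp [M.rot.injective h']
    · simp [M.rot.injective h']
    · simp [M.rot.injective h']
  -- The old segment has `j + 1` edges. Its two parts have `i` and `j + 1 - i` edges, which gives
  -- the parameters `i - 1` and `j - i`.
  have seg1 : M.Straight (named (n + 1) (addVertex M n f d)) (f x) (M.rot (M.rot d)) (i - 1) := by
    refine ⟨?_, fun m h3 h4 => avoid hx hp hj h3 (by omega) (by omega) ?_⟩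
    · obtain ⟨i, rfl⟩ : ∃ k, i = k + 1 := ⟨i - 1, by omega⟩
      rw [hd, str_pow_succ, hM.rot_rot_str]; rfl
    · rintro ⟨h5, -⟩; exact hp h5.symm
  have seg2 : M.Straight (named (n + 1) (addVertex M n f d)) (f (p x)) d (j - i) := by
    refine ⟨?_, fun m h3 h4 => avoid hpx (h.p_ne hx hp) (by rwa [h.p_p x hx]) h3 (by omega) ?_
      (by omega)⟩
    · have := hrev
      rw [show j + 1 - i = (j - i) + 1 by omega, str_pow_succ, str_apply] at this
      exact M.rot.injective (M.rot.injective this)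
    · rintro ⟨h5, -⟩; exact hp h5
  constructor
  · refine cases4 ?_ ?_ ?_ ?_ fun y hy => ?_
    · rw [show nx (4 * n) = 4 * n + 1 by unfold nx; omega, f0, f1]
    · rw [show nx (4 * n + 1) = 4 * n + 2 by unfold nx; omega, f1, f2]
    · rw [show nx (4 * n + 2) = 4 * n + 3 by unfold nx; omega, f2, f3]
    · rw [show nx (4 * n + 3) = 4 * n by unfold nx; omega, f3, f0, hM.rot4]
    · rw [addVertex_of_lt hy, addVertex_of_lt (nx_lt hy), h.f_nx y hy]
  · have hlow {y : ℕ} (hy : y < 4 * n) {k : ℕ} (hk : k < 4) : addVertex M n f d y ≠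
        addVertex M n f d (4 * n + k) := by
      intro e
      rw [addVertex_of_lt hy] at e
      have : addVertex M n f d (4 * n + k) ∈ named n f := ⟨y, hy, e⟩
      interval_cases k
      · exact hdn (f0 ▸ this)
      · exact hdn (h.rot_mem_named.1 (f1 ▸ this))
      · exact hdn (h.rot_mem_named.1 (h.rot_mem_named.1 (f2 ▸ this)))
      · exact hdn (h.rot_mem_named.1 (h.rot_mem_named.1 (h.rot_mem_named.1 (f3 ▸ this))))
    have r1 := hM.rot_ne d
    have r2 := hM.rot2 d
    have r3 : M.rot (M.rot (M.rot d)) ≠ d := fun e => hM.rot_ne d (by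
      have := congrArg M.rot e; rw [hM.rot4] at this; exact this.symm)
    intro y hy z hz e
    rcases Nat.lt_or_ge y (4 * n) with hy' | hy' <;> rcases Nat.lt_or_ge z (4 * n) with hz' | hz'
    · rw [addVertex_of_lt hy', addVertex_of_lt hz'] at e
      exact h.f_inj y hy' z hz' e
    · obtain ⟨k, rfl⟩ := Nat.exists_eq_add_of_le hz'
      exact absurd e (hlow hy' (by omega))
    · obtain ⟨k, rfl⟩ := Nat.exists_eq_add_of_le hy'
      exact absurd e.symm (hlow hz' (by omega))
    · have hy'' : y = 4 * n ∨ y = 4 * n + 1 ∨ y = 4 * n + 2 ∨ y = 4 * n + 3 := by omega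
      have hz'' : z = 4 * n ∨ z = 4 * n + 1 ∨ z = 4 * n + 2 ∨ z = 4 * n + 3 := by omega
      rcases hy'' with rfl | rfl | rfl | rfl <;> rcases hz'' with rfl | rfl | rfl | rfl <;>
        simp only [f0, f1, f2, f3, EmbeddingLike.apply_eq_iff_eq] at e <;>
        first
        | rfl
        | exact absurd e r1
        | exact absurd e.symm r1
        | exact absurd e r2
        | exact absurd e.symm r2
        | exact absurd e r3
        | exact absurd e.symm r3
  · refine cases4 (by rw [p0]; omega) (by rw [p1]; omega) (by rw [p2]; omega) (by rw [p3]; omega)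
      fun y hy => ?_
    have := h.p_lt y hy
    unfold splitF
    split_ifs <;> omega
  · refine cases4 (by rw [p0, ppx]) (by rw [p1, p1]) (by rw [p2, px]) (by rw [p3, p3])
      fun y hy => ?_
    by_cases hy1 : y = x
    · rw [hy1, px, p2]
    · by_cases hy2 : y = p x
      · rw [hy2, ppx, p0]
      · rw [po hy hy1 hy2, po (h.p_lt y hy), h.p_p y hy]
        · intro e; apply hy2; rw [← e, h.p_p y hy]
        · intro e; apply hy1; rw [← h.p_p y hy, e, h.p_p x hx]
  · refine cases4 ?_ ?_ ?_ ?_ fun y hy => ?_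
    · rw [f0, p0]; exact iff_of_true hdS (by omega)
    · rw [f1, p1]; exact iff_of_false hdS1 (by simp)
    · rw [f2, p2]; exact iff_of_true hdS2 (by omega)
    · rw [f3, p3]; exact iff_of_false hdS3 (by simp)
    · rw [addVertex_of_lt hy, h.mem_iff y hy]
      by_cases hy1 : y = x
      · rw [hy1, px]; exact iff_of_true hp (by omega)
      · by_cases hy2 : y = p x
        · rw [hy2, ppx, h.p_p x hx]; exact iff_of_true hp.symm (by omega)
        · rw [po hy hy1 hy2]
  · refine cases4 ?_ ?_ ?_ ?_ fun y hy => ?_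
    · rw [p0]; omega
    · rw [show nx (4 * n + 1) = 4 * n + 2 by unfold nx; omega, p2]; omega
    · rw [p2]; omega
    · rw [show nx (4 * n + 3) = 4 * n by unfold nx; omega, p0]; omega
    · intro hy0
      have hy1 : y ≠ x := by rintro rfl; rw [px] at hy0; omega
      have hy2 : y ≠ p x := by rintro rfl; rw [ppx] at hy0; omega
      rw [po hy hy1 hy2] at hy0
      have := h.p_nx y hy hy0
      have hlt := nx_lt hy
      by_cases hy3 : nx y = x
      · rw [hy3, px]; omega
      · by_cases hy4 : nx y = p x
        · rw [hy4, ppx]; omega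
        · rwa [po hlt hy3 hy4]
  · refine cases4 ?_ ?_ ?_ ?_ fun y hy => ?_
    · intro _
      rw [p0, f0, addVertex_of_lt hpx]
      exact ⟨_, seg2.symm hM hN⟩
    · rw [p1]; exact fun h => absurd rfl h
    · intro _
      rw [p2, f2, addVertex_of_lt hx]
      exact ⟨_, seg1.symm hM hN⟩
    · rw [p3]; exact fun h => absurd rfl h
    · intro hy0
      rw [addVertex_of_lt hy]
      by_cases hy1 : y = x
      · rw [hy1, px, f2]; exact ⟨_, seg1⟩
      · by_cases hy2 : y = p x
        · rw [hy2, ppx, f0]; exact ⟨_, seg2⟩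
        · rw [po hy hy1 hy2] at hy0 ⊢
          obtain ⟨k, hk⟩ := h.seg y hy hy0
          rw [addVertex_of_lt (h.p_lt y hy)]
          exact ⟨k, hk.1, fun m h3 h4 => avoid hy hy0 hk h3 h4 (fun e => hy1 e.1)
            (fun e => hy2 e.1)⟩
  · exact h.edgeClosed
  · intro e he hn
    exact h.straight e he fun h' => hn (mem_named_addVertex.2 (Or.inl h'))
  · refine cases4 ?_ ?_ ?_ ?_ fun y hy => ?_
    · simpa [labF] using h.lab_lt x hx
    · simpa [labF] using hl
    · simpa [labF] using h.lab_lt x hx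
    · simpa [labF] using hl
    · simpa [labF, hy] using h.lab_lt y hy
  · have hc : M.circuit d = κ (lab x) := by rw [hd, circuit_str_pow, h.circuit_f x hx]
    refine cases4 ?_ ?_ ?_ ?_ fun y hy => ?_
    · rw [f0]; simpa [labF] using hc
    · rw [f1]; simpa [labF] using hκ
    · rw [f2, circuit_rot_rot]; simpa [labF] using hc
    · rw [f3, circuit_rot_rot]; simpa [labF] using hκ
    · rw [addVertex_of_lt hy]; simpa [labF, hy] using h.circuit_f y hy
  · exact h.κ_inj

/-- Add a straight walk that connects two numbered vertices and avoids `S` in between. -/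
theorem join (hM : M.IsTaut) (h : Realizes M S n r p lab f κ) {t s : ℕ} (ht : t < 4 * n)
    (hs : s < 4 * n) (hpt : p t = t) (hps : p s = s) (hts : t ≠ s) {j : ℕ}
    (hj : M.edge ((M.str ^ j) (f t)) = f s)
    (hS : ∀ i, 1 ≤ i → i ≤ j → (M.str ^ i) (f t) ∉ S ∧ M.rot ((M.str ^ i) (f t)) ∉ S) :
    ∃ S', S ⊆ S' ∧ (∀ d ∈ S', d ∈ S ∨ M.circuit d = M.circuit (f t)) ∧
      Realizes M S' n r (joinF p t s) lab f κ := by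
  have hnamed : ∀ i, 1 ≤ i → i ≤ j → (M.str ^ i) (f t) ∉ named n f := fun i h1 h2 h3 => by
    have := hS i h1 h2
    rcases h.named_mem h3 with h4 | h4
    · exact this.1 h4
    · exact this.2 h4
  have hseg : M.Straight (named n f) (f t) (f s) j := ⟨hj, hnamed⟩
  have hsym := hseg.symm hM fun e => h.rot_mem_named.1
  have hedge : ∀ i < j, M.edge ((M.str ^ i) (f t)) = M.rot (M.rot ((M.str ^ (i + 1)) (f t))) := by
    intro i _
    rw [str_pow_succ, hM.rot_rot_str]
  let A : Set D := {d | ∃ i ≤ j, d = (M.str ^ i) (f t) ∨ d = M.edge ((M.str ^ i) (f t))}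
  have hA : ∀ d ∈ A, d = f t ∨ d = f s ∨ ∃ i, 1 ≤ i ∧ i ≤ j ∧
      (d = (M.str ^ i) (f t) ∨ d = M.rot (M.rot ((M.str ^ i) (f t)))) := by
    rintro d ⟨i, hi, rfl | rfl⟩
    · rcases Nat.eq_zero_or_pos i with rfl | h1
      · exact Or.inl rfl
      · exact Or.inr (Or.inr ⟨i, h1, hi, Or.inl rfl⟩)
    · rcases Nat.lt_or_ge i j with h1 | h1
      · exact Or.inr (Or.inr ⟨i + 1, by omega, h1, Or.inr (hedge i h1)⟩)
      · obtain rfl : i = j := by omega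
        exact Or.inr (Or.inl hj)
  have hAc : ∀ d ∈ A, M.circuit d = M.circuit (f t) := by
    rintro d ⟨i, hi, rfl | rfl⟩
    · rw [circuit_str_pow]
    · rw [circuit_edge, circuit_str_pow]
  have htA : f t ∈ A := ⟨0, by omega, Or.inl rfl⟩
  have hsA : f s ∈ A := ⟨j, le_rfl, Or.inr hj.symm⟩
  have hAn : ∀ d ∈ A, d ∈ named n f → d = f t ∨ d = f s := by
    intro d hd hn
    rcases hA d hd with h1 | h1 | ⟨i, h1, h2, rfl | rfl⟩
    · exact Or.inl h1
    · exact Or.inr h1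
    · exact absurd hn (hnamed i h1 h2)
    · rw [h.rot_mem_named, h.rot_mem_named] at hn
      exact absurd hn (hnamed i h1 h2)
  have hAS : ∀ d ∈ A, d ∉ named n f →
      M.rot (M.rot d) ∈ A ∧ d ∉ S ∧ M.rot d ∉ S ∧ M.rot⁻¹ d ∉ S := by
    intro d hd hn
    -- By `NoBend`, two consecutive darts outside `S` show that the whole vertex is off `S`.
    have main : ∀ i, 1 ≤ i → i ≤ j → M.rot (M.rot (M.rot ((M.str ^ i) (f t)))) ∉ S ∧
        M.rot (M.rot ((M.str ^ i) (f t))) ∉ S := by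
      intro i h1 h2
      obtain ⟨h3, h4⟩ := hS i h1 h2
      have h5 : M.rot (M.rot (M.rot ((M.str ^ i) (f t)))) ∉ S := by
        intro h5
        have := h.noBend _ h5
        rw [hM.rot4] at this
        exact this.elim h3 h4
      refine ⟨h5, fun h6 => ?_⟩
      have := h.noBend _ h6
      rw [hM.rot4] at this
      exact this.elim h5 h3
    rcases hA d hd with h1 | h1 | ⟨i, h1, h2, rfl | rfl⟩
    · exact absurd ⟨t, ht, h1.symm⟩ hn
    · exact absurd ⟨s, hs, h1.symm⟩ hn
    · refine ⟨⟨i - 1, by omega, Or.inr ?_⟩, (hS i h1 h2).1, (hS i h1 h2).2, ?_⟩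
      · rw [hedge _ (by omega), show i - 1 + 1 = i by omega]
      · rw [hM.inv_rot]; exact (main i h1 h2).1
    · refine ⟨⟨i, h2, Or.inl (hM.rot4 _)⟩, (main i h1 h2).2, (main i h1 h2).1, ?_⟩
      rw [inv_rot_rot]; exact (hS i h1 h2).2
  have jt : joinF p t s t = s := by simp [joinF, hts]
  have js : joinF p t s s = t := by simp [joinF]
  have jo {y : ℕ} (h1 : y ≠ t) (h2 : y ≠ s) : joinF p t s y = p y := by simp [joinF, h1, h2]
  refine ⟨S ∪ A, Set.subset_union_left, fun d hd => hd.imp_right (hAc d), ?_⟩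
  constructor
  · exact h.f_nx
  · exact h.f_inj
  · intro x hx
    by_cases h1 : x = t
    · rw [h1, jt]; exact hs
    · by_cases h2 : x = s
      · rw [h2, js]; exact ht
      · rw [jo h1 h2]; exact h.p_lt x hx
  · intro x hx
    by_cases h1 : x = t
    · rw [h1, jt, js]
    · by_cases h2 : x = s
      · rw [h2, js, jt]
      · rw [jo h1 h2, jo, h.p_p x hx]
        · intro e; apply h1; rw [← h.p_p x hx, e, hpt]
        · intro e; apply h2; rw [← h.p_p x hx, e, hps]
  · intro x hx
    by_cases h1 : x = t
    · rw [h1, jt]; exact iff_of_true (Or.inr htA) hts.symm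
    · by_cases h2 : x = s
      · rw [h2, js]; exact iff_of_true (Or.inr hsA) hts
      · rw [jo h1 h2, ← h.mem_iff x hx]
        refine ⟨fun h3 => h3.resolve_right fun h4 => ?_, Or.inl⟩
        rcases hAn _ h4 ⟨x, hx, rfl⟩ with h5 | h5
        · exact h1 (h.f_inj x hx t ht h5)
        · exact h2 (h.f_inj x hx s hs h5)
  · intro x hx hpx
    have h1 : x ≠ t := by rintro rfl; rw [jt] at hpx; exact hts hpx.symm
    have h2 : x ≠ s := by rintro rfl; rw [js] at hpx; exact hts hpx
    rw [jo h1 h2] at hpx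
    by_cases h3 : nx x = t
    · rw [h3, jt]; exact hts.symm
    · by_cases h4 : nx x = s
      · rw [h4, js]; exact hts
      · rw [jo h3 h4]; exact h.p_nx x hx hpx
  · intro x hx
    by_cases h1 : x = t
    · rw [h1, jt]; exact fun _ => ⟨j, hseg⟩
    · by_cases h2 : x = s
      · rw [h2, js]; exact fun _ => ⟨j, hsym⟩
      · rw [jo h1 h2]; exact h.seg x hx
  · rintro d (hd | ⟨i, hi, rfl | rfl⟩)
    · exact Or.inl (h.edgeClosed d hd)
    · exact Or.inr ⟨i, hi, Or.inr rfl⟩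
    · exact Or.inr ⟨i, hi, Or.inl (M.edge_edge _)⟩
  · rintro d (hd | hd) hn
    · obtain ⟨h1, h2⟩ := h.straight d hd hn
      refine ⟨Or.inl h1, fun h3 => h3.elim h2 fun h4 => ?_⟩
      have := (hAS _ h4 (by rwa [h.rot_mem_named])).2.2.2
      rw [inv_rot_rot] at this
      exact this hd
    · obtain ⟨h1, h2, h3, -⟩ := hAS d hd hn
      refine ⟨Or.inr h1, fun h4 => h4.elim h3 fun h5 => ?_⟩
      -- Both darts lie on the circuit of the new walk, which does not cross itself.
      exact hM.pure d ((hAc _ h5).trans (hAc _ hd).symm)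
  · exact h.lab_lt
  · exact h.circuit_f
  · exact h.κ_inj

theorem wk_lt (h : Realizes M S n r p lab f κ) {x : ℕ} (hx : x < 4 * n) : wk p x < 4 * n :=
  pv_lt (h.p_lt x hx)

theorem wk_iterate_lt (h : Realizes M S n r p lab f κ) {x : ℕ} (hx : x < 4 * n) (k : ℕ) :
    (wk p)^[k] x < 4 * n := by
  induction k with
  | zero => exact hx
  | succ k ih => rw [Function.iterate_succ_apply']; exact h.wk_lt ih

/-- The darts of a boundary walk. -/
theorem walk_cases [Finite D] (hM : M.IsTaut) (h : Realizes M S n r p lab f κ) {t : ℕ}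
    (ht : t < 4 * n) {d : D} (hd : (M.walkPerm h.edgeClosed).SameCycle (f t) d) :
    ∃ k, d = f ((wk p)^[k] t) ∨ (p ((wk p)^[k] t) ≠ (wk p)^[k] t ∧
      ∃ j, M.Straight (named n f) (f ((wk p)^[k] t)) (f (p ((wk p)^[k] t))) j ∧
        ∃ i, 1 ≤ i ∧ i ≤ j ∧ (d = (M.str ^ i) (f ((wk p)^[k] t)) ∨
          d = M.rot ((M.str ^ i) (f ((wk p)^[k] t))))) := by
  refine mem_of_sameCycle (s := {d | ∃ k, d = f ((wk p)^[k] t) ∨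
    (p ((wk p)^[k] t) ≠ (wk p)^[k] t ∧
      ∃ j, M.Straight (named n f) (f ((wk p)^[k] t)) (f (p ((wk p)^[k] t))) j ∧
        ∃ i, 1 ≤ i ∧ i ≤ j ∧ (d = (M.str ^ i) (f ((wk p)^[k] t)) ∨
          d = M.rot ((M.str ^ i) (f ((wk p)^[k] t)))))}) ?_ hd ⟨0, Or.inl rfl⟩
  rintro _ ⟨k, hk⟩
  have hy := h.wk_iterate_lt ht k
  have hw : (wk p)^[k + 1] t = wk p ((wk p)^[k] t) := Function.iterate_succ_apply' ..
  generalize hyk : (wk p)^[k] t = y at hk hy hw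
  have hinv (e : D) : M.rot⁻¹ (M.edge e) = M.rot (M.str e) := by
    rw [hM.inv_rot, str_apply]
  rcases hk with rfl | ⟨hp, j, hj, i, h1, h2, rfl | rfl⟩
  · by_cases hp : p y = y
    · refine ⟨k + 1, Or.inl ?_⟩
      rw [walkPerm_of_notMem _ (by rw [h.mem_iff y hy]; exact not_not.2 hp), hw, wk, hp,
        h.f_pv hy]
    · obtain ⟨j, hj⟩ := h.seg y hy hp
      rw [walkPerm_of_mem _ ((h.mem_iff y hy).2 hp)]
      rcases Nat.eq_zero_or_pos j with rfl | h1
      · refine ⟨k + 1, Or.inl ?_⟩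
        rw [hw, wk, h.f_pv (h.p_lt y hy), ← hj.1]; rfl
      · refine ⟨k, Or.inr ?_⟩
        rw [hyk]
        exact ⟨hp, j, hj, 1, le_rfl, h1, Or.inr (by rw [hinv, pow_one])⟩
  · rw [walkPerm_of_mem _ (h.interior_mem hy hp hj h2)]
    rcases Nat.lt_or_ge i j with h3 | h3
    · refine ⟨k, Or.inr ?_⟩
      rw [hyk]
      exact ⟨hp, j, hj, i + 1, by omega, h3, Or.inr (by rw [hinv, str_pow_succ])⟩
    · obtain rfl : i = j := by omega
      refine ⟨k + 1, Or.inl ?_⟩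
      rw [hw, wk, h.f_pv (h.p_lt y hy), ← hj.1]
  · have := (h.straight _ (h.interior_mem hy hp hj h2) (hj.2 i h1 h2)).2
    rw [walkPerm_of_notMem _ this, inv_rot_rot]
    refine ⟨k, Or.inr ?_⟩
    rw [hyk]
    exact ⟨hp, j, hj, i, h1, h2, Or.inl rfl⟩

/-- At an interior vertex of a segment the boundary walk visits the dart on its left and then goes
straight on, so one step of `wk` covers a whole segment. -/
theorem sameCycle_wk [Finite D] (hM : M.IsTaut) (h : Realizes M S n r p lab f κ) {y : ℕ}
    (hy : y < 4 * n) : (M.walkPerm h.edgeClosed).SameCycle (f y) (f (wk p y)) := by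
  by_cases hp : p y = y
  · have := sameCycle_apply_self (π := M.walkPerm h.edgeClosed) (f y)
    rwa [walkPerm_of_notMem _ (by rw [h.mem_iff y hy]; exact not_not.2 hp), ← h.f_pv hy,
      show pv y = wk p y by rw [wk, hp]] at this
  · obtain ⟨j, hj⟩ := h.seg y hy hp
    have key : ∀ i ≤ j, (M.walkPerm h.edgeClosed).SameCycle (f y) ((M.str ^ i) (f y)) := by
      intro i hi
      induction i with
      | zero => exact Perm.SameCycle.refl _ _
      | succ i ih =>
        have h1 := sameCycle_apply_self (π := M.walkPerm h.edgeClosed) ((M.str ^ i) (f y))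
        rw [walkPerm_of_mem _ (h.interior_mem hy hp hj (by omega)), hM.inv_rot, ← str_apply,
          ← str_pow_succ] at h1
        have h2 := sameCycle_apply_self (π := M.walkPerm h.edgeClosed)
          (M.rot ((M.str ^ (i + 1)) (f y)))
        rw [walkPerm_of_notMem _ (h.straight _ (h.interior_mem hy hp hj hi)
          (hj.2 _ (by omega) hi)).2, inv_rot_rot] at h2
        exact (ih (by omega)).trans (h1.trans h2)
    have h1 := sameCycle_apply_self (π := M.walkPerm h.edgeClosed) ((M.str ^ j) (f y))
    rw [walkPerm_of_mem _ (h.interior_mem hy hp hj le_rfl), hj.1, ← h.f_pv (h.p_lt y hy)] at h1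
    exact (key j le_rfl).trans h1

theorem sameCycle_wk_iterate [Finite D] (hM : M.IsTaut) (h : Realizes M S n r p lab f κ) {y : ℕ}
    (hy : y < 4 * n) (k : ℕ) :
    (M.walkPerm h.edgeClosed).SameCycle (f y) (f ((wk p)^[k] y)) := by
  induction k with
  | zero => exact Perm.SameCycle.refl _ _
  | succ k ih =>
    rw [Function.iterate_succ_apply']
    exact ih.trans (h.sameCycle_wk hM (h.wk_iterate_lt hy k))

/-- Transfers the bound on corners from the regions of the map to lists of darts of the code. -/
theorem corners_le [Finite D] (hM : M.IsTaut) (h : Realizes M S n r p lab f κ) {t : ℕ}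
    (ht : t < 4 * n) (hpt : p t ≠ t) {l : List ℕ} (hl : l.Nodup)
    (hl' : ∀ x ∈ l, (∃ k, x = (wk p)^[k] t) ∧ p x ≠ x ∧ p (nx x) ≠ nx x) : l.length ≤ 4 := by
  classical
  have hlt : ∀ x ∈ l, x < 4 * n := by
    intro x hx
    obtain ⟨⟨k, rfl⟩, -⟩ := hl' x hx
    exact h.wk_iterate_lt ht k
  have := hM.card_corners_le h.edgeClosed h.noBend ((h.mem_iff t ht).2 hpt)
    (l.toFinset.image f) (by
      intro d hd
      obtain ⟨x, hx, rfl⟩ := Finset.mem_image.1 hd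
      have hx := List.mem_toFinset.1 hx
      have hxl := hlt x hx
      obtain ⟨⟨k, rfl⟩, h1, h2⟩ := hl' x hx
      refine ⟨h.sameCycle_wk_iterate hM ht k, (h.mem_iff _ hxl).2 h1, ?_⟩
      rw [← h.f_nx _ hxl]
      exact (h.mem_iff _ (nx_lt hxl)).2 h2)
  rwa [Finset.card_image_of_injOn, List.toFinset_card_of_nodup hl] at this
  intro x hx y hy e
  exact h.f_inj x (hlt x (List.mem_toFinset.1 hx)) y (hlt y (List.mem_toFinset.1 hy)) e

/-- The straight walk from a stub `t` ends at another stub, or at a new vertex on a segment of the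
boundary walk of the component which it enters. -/
theorem exists_step [Finite D] (hM : M.IsTaut) (h : Realizes M S n r p lab f κ) {t : ℕ}
    (ht : t < 4 * n) (hpt : p t = t) :
    ∃ k, (p ((wk p)^[k] t) = (wk p)^[k] t ∧ (wk p)^[k] t ≠ t ∧ lab ((wk p)^[k] t) = lab t ∧
      ∃ S', S ⊆ S' ∧ (∀ d ∈ S', d ∈ S ∨ M.circuit d = M.circuit (f t)) ∧
        Realizes M S' n r (joinF p t ((wk p)^[k] t)) lab f κ) ∨
      (p ((wk p)^[k] t) ≠ (wk p)^[k] t ∧ lab ((wk p)^[k] t) ≠ lab t ∧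
      ∃ S' f', S ⊆ S' ∧ (∀ d ∈ S', d ∈ S ∨ M.circuit d = M.circuit (f t)) ∧
        (∀ x < 4 * n, f' x = f x) ∧
        Realizes M S' (n + 1) r (joinF (splitF n p ((wk p)^[k] t)) t (4 * n + 1))
          (labF n lab ((wk p)^[k] t) (lab t)) f' κ) := by
  classical
  have htS : f t ∉ S := fun hS => (h.mem_iff t ht).1 hS hpt
  -- The walk meets `S` at the latest when it returns to the vertex of `t`. The first such meeting
  -- is the one to be analysed.
  have hex : ∃ i, 1 ≤ i ∧ ((M.str ^ i) (f t) ∈ S ∨ M.rot ((M.str ^ i) (f t)) ∈ S) := by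
    refine ⟨orbLen M.str (f t), orbLen_pos _ _, ?_⟩
    rw [pow_orbLen_apply]
    exact h.named_mem ⟨t, ht, rfl⟩
  obtain ⟨h1, hend⟩ := Nat.find_spec hex
  have hmin : ∀ i, 1 ≤ i → i < Nat.find hex →
      (M.str ^ i) (f t) ∉ S ∧ M.rot ((M.str ^ i) (f t)) ∉ S := by
    intro i h2 h3
    have := Nat.find_min hex h3
    exact ⟨fun h4 => this ⟨h2, Or.inl h4⟩, fun h4 => this ⟨h2, Or.inr h4⟩⟩
  obtain ⟨j, hj⟩ : ∃ j, Nat.find hex = j + 1 := ⟨Nat.find hex - 1, by omega⟩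
  rw [hj] at hend hmin
  have hmem : ∀ i ≤ j, (M.str ^ i) (f t) ∉ S := by
    intro i hi
    rcases Nat.eq_zero_or_pos i with rfl | h2
    · exact htS
    · exact (hmin i h2 (by omega)).1
  set η := M.edge ((M.str ^ j) (f t)) with hη
  have hηS : η ∉ S := by rw [h.edgeClosed.mem_iff]; exact hmem j le_rfl
  have hηstr : (M.str ^ (j + 1)) (f t) = M.rot (M.rot η) := by rw [str_pow_succ, str_apply]
  -- `η` points back along the walk from its end. Since it is not in `S` but its vertex touches `S`,
  -- `NoBend` puts its neighbour into `S`, which makes `η` part of a boundary walk.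
  have hηS' : M.rot⁻¹ η ∈ S := by
    rw [hηstr, ← hM.inv_rot] at hend
    rcases hend with h2 | h2
    · have := h.noBend _ h2
      rw [hM.rot4, ← hM.inv_rot] at this
      exact this.resolve_right hηS
    · exact h2
  have htS' : M.rot⁻¹ (f t) ∈ S := by
    rw [← h.f_pv ht, h.mem_iff _ (pv_lt ht)]
    intro e
    have := h.p_nx _ (pv_lt ht) e
    rw [nx_pv] at this
    exact this hpt
  have hreg : ∀ i ≤ j, M.SameRegion S (f t) ((M.str ^ i) (f t)) := by
    intro i hi
    induction i with
    | zero => exact SameRegion.refl _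
    | succ i ih =>
      have h2 := hmem i (by omega)
      have h3 := (ih (by omega)).trans ((SameRegion.edge h2).trans
        (SameRegion.walk h.edgeClosed _))
      rw [walkPerm_of_notMem _ (by rwa [h.edgeClosed.mem_iff])] at h3
      have h4 := h3.trans (SameRegion.walk h.edgeClosed _)
      rwa [walkPerm_of_notMem _, hM.inv_inv_rot, ← str_apply, ← str_pow_succ] at h4
      rw [hM.inv_rot, ← str_apply, ← str_pow_succ]
      exact (hmin (i + 1) (by omega) (by omega)).2
  -- The essential use of tautness: the region has only one boundary walk, so the walk ends on the
  -- one where it started.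
  have hcyc : (M.walkPerm h.edgeClosed).SameCycle (f t) η :=
    hM.sameCycle_of_sameRegion h.edgeClosed h.noBend (Or.inr htS') (Or.inr hηS')
      ((hreg j le_rfl).trans (SameRegion.edge (hmem j le_rfl)))
  have hηc : M.circuit η = M.circuit (f t) := by rw [hη, circuit_edge, circuit_str_pow]
  obtain ⟨k, hk⟩ := h.walk_cases hM ht hcyc
  have hy := h.wk_iterate_lt ht k
  refine ⟨k, ?_⟩
  generalize (wk p)^[k] t = y at hk hy
  rcases hk with e | ⟨hp, j', hj', i, h2, h3, e | e⟩
  · left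
    have hpy : p y = y := by
      by_contra hc
      exact hηS (e ▸ (h.mem_iff y hy).2 hc)
    have hne : y ≠ t := by
      rintro rfl
      exact hM.edge_str_pow_ne (f y) j e
    refine ⟨hpy, hne, ?_, ?_⟩
    · refine h.κ_inj _ (h.lab_lt y hy) _ (h.lab_lt t ht) ?_
      rw [← h.circuit_f y hy, ← h.circuit_f t ht, ← e, hηc]
    · exact h.join hM ht hy hpt hpy hne.symm e fun i h4 h5 => hmin i h4 (by omega)
  · exact absurd (e ▸ h.interior_mem hy hp hj' h3) hηS
  · right
    -- Equal labels would make the circuit cross itself.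
    have hlab : lab y ≠ lab t := by
      intro e'
      refine hM.pure ((M.str ^ i) (f y)) ?_
      rw [← e, hηc, circuit_str_pow, h.circuit_f y hy, h.circuit_f t ht, e']
    refine ⟨hp, hlab, ?_⟩
    have hsub := h.subdivide hM hy hp hj' h2 h3 (h.lab_lt t ht)
      (by rw [← e, hηc, h.circuit_f t ht])
    have hty : t ≠ y := by rintro rfl; exact hp hpt
    have htpy : t ≠ p y := by
      rintro rfl
      exact hp (by rw [← hpt, h.p_p y hy])
    obtain ⟨S', hS1, hS2, hS3⟩ := hsub.join hM (t := t) (s := 4 * n + 1) (by omega) (by omega)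
      (by simp [splitF, ht, hty, htpy, hpt]) (by simp [splitF]) (by omega) (j := j)
      (by
        have h5 : addVertex M n f ((M.str ^ i) (f y)) (4 * n + 1) = M.rot ((M.str ^ i) (f y)) :=
          addVertex_add 1
        rw [addVertex_of_lt ht, h5, ← e])
      (fun i h4 h5 => by rw [addVertex_of_lt ht]; exact hmin i h4 (by omega))
    rw [addVertex_of_lt ht] at hS2
    exact ⟨S', _, hS1, hS2, fun x hx => addVertex_of_lt hx, hS3⟩

end Realizes

end CombMap

namespace CombMap

/-! ### Codes stored as numbers, for evaluation in the kernel -/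

theorem natBeq_eq (a b : ℕ) : Nat.beq a b = decide (a = b) := by
  rw [Bool.eq_iff_iff, decide_eq_true_iff]
  exact ⟨Nat.eq_of_beq_eq_true, fun h => h ▸ Nat.beq_refl a⟩

theorem natBle_eq (a b : ℕ) : Nat.ble a b = decide (a ≤ b) := by
  rw [Bool.eq_iff_iff, decide_eq_true_iff, Nat.ble_eq]

/-- Evaluate a number before use. -/
noncomputable def force {α : Type*} (n : ℕ) (k : ℕ → α) : α := Nat.rec (k 0) (fun m _ => k (m + 1)) n

theorem force_eq {α : Type*} (n : ℕ) (k : ℕ → α) : force n k = k n := by cases n <;> rfl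

/-- The entries of an array of numbers below 1024 that is stored as a number. -/
def get (P x : ℕ) : ℕ := P / 1024 ^ x % 1024

/-- Change an entry. -/
def put (P x v : ℕ) : ℕ := P + v * 1024 ^ x - get P x * 1024 ^ x

theorem get_put (P x y : ℕ) {v : ℕ} (hv : v < 1024) :
    get (put P x v) y = if y = x then v else get P y := by
  have hpos (k : ℕ) : 0 < 1024 ^ k := by positivity
  -- The higher entries, the entry `x` itself, and the lower entries.
  obtain ⟨h, g, l, hP, hg, hl⟩ : ∃ h g l, P = (h * 1024 + g) * 1024 ^ x + l ∧ g < 1024 ∧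
      l < 1024 ^ x := by
    refine ⟨P / 1024 ^ x / 1024, P / 1024 ^ x % 1024, P % 1024 ^ x, ?_,
      Nat.mod_lt _ (by norm_num), Nat.mod_lt _ (hpos x)⟩
    rw [Nat.div_add_mod', Nat.div_add_mod']
  have hget (w : ℕ) (hw : w < 1024) : get ((h * 1024 + w) * 1024 ^ x + l) x = w := by
    rw [get, add_comm, Nat.add_mul_div_right _ _ (hpos x), Nat.div_eq_of_lt hl, zero_add,
      Nat.mul_comm h, Nat.mul_add_mod, Nat.mod_eq_of_lt hw]
  have hput : put P x v = (h * 1024 + v) * 1024 ^ x + l := by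
    rw [put, hP, hget g hg]
    have : (h * 1024 + g) * 1024 ^ x + l + v * 1024 ^ x =
      ((h * 1024 + v) * 1024 ^ x + l) + g * 1024 ^ x := by ring
    rw [this, Nat.add_sub_cancel]
  rw [hput]
  split_ifs with e
  · rw [e, hget v hv]
  · rw [hP]
    rcases Nat.lt_or_gt_of_ne e with hlt | hlt
    · obtain ⟨k, rfl⟩ : ∃ k, x = y + 1 + k := ⟨x - y - 1, by omega⟩
      have (w : ℕ) : get ((h * 1024 + w) * 1024 ^ (y + 1 + k) + l) y = get l y := by
        have : (h * 1024 + w) * 1024 ^ (y + 1 + k) + l =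
          l + ((h * 1024 + w) * 1024 ^ k * 1024) * 1024 ^ y := by ring
        rw [get, this, Nat.add_mul_div_right _ _ (hpos y), Nat.add_mul_mod_self_right]; rfl
      rw [this, this]
    · obtain ⟨k, rfl⟩ : ∃ k, y = x + 1 + k := ⟨y - x - 1, by omega⟩
      have (w : ℕ) (hw : w < 1024) : get ((h * 1024 + w) * 1024 ^ x + l) (x + 1 + k) = get h k := by
        rw [get, get, pow_add, pow_add, pow_one, ← Nat.div_div_eq_div_mul, ← Nat.div_div_eq_div_mul,
          add_comm _ l, Nat.add_mul_div_right _ _ (hpos x), Nat.div_eq_of_lt hl, zero_add]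
        congr 2
        omega
      rw [this v hv, this g hg]

/-- A code. -/
structure Code where
  n : ℕ
  p : ℕ
  lab : ℕ

/-- Evaluate a code before use. -/
noncomputable def forceCode (n p lab : ℕ) (k : Code → Bool) : Bool :=
  force n fun n => force p fun p => force lab fun lab => k ⟨n, p, lab⟩

theorem forceCode_eq (n p lab : ℕ) (k : Code → Bool) : forceCode n p lab k = k ⟨n, p, lab⟩ := by
  simp only [forceCode, force_eq]

/-- `joinF` on arrays. -/
def joinP (P t s : ℕ) : ℕ := put (put P t s) s t

theorem get_joinP {P t s : ℕ} (ht : t < 1024) (hs : s < 1024) :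
    get (joinP P t s) = joinF (get P) t s := by
  ext y
  rw [joinP, get_put _ _ _ ht, get_put _ _ _ hs, joinF]
  simp only [Function.update_apply]

/-- `splitF` on arrays. -/
def splitP (n P x : ℕ) : ℕ :=
  put (put (put (put (put (put P (4 * n) (get P x)) (4 * n + 1) (4 * n + 1)) (4 * n + 2) x)
    (4 * n + 3) (4 * n + 3)) (get P x) (4 * n)) x (4 * n + 2)

/-- The bound on `n` keeps all stored darts below the base 1024. -/
theorem get_splitP {n P x y : ℕ} (hn : 4 * (n + 1) ≤ 1024) (hx : x < 4 * n) (hp : get P x < 4 * n)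
    (hy : y < 4 * (n + 1)) :
    get (splitP n P x) y = splitF n (get P) x y := by
  rw [splitP, get_put _ _ _ (by omega), get_put _ _ _ (by omega), get_put _ _ _ (by omega),
    get_put _ _ _ (by omega), get_put _ _ _ (by omega), get_put _ _ _ (by omega), splitF]
  split_ifs <;> omega

/-- `labF` on arrays. -/
def labP (n L x l : ℕ) : ℕ :=
  put (put (put (put L (4 * n) (get L x)) (4 * n + 1) l) (4 * n + 2) (get L x)) (4 * n + 3) l

theorem get_lt (P x : ℕ) : get P x < 1024 := Nat.mod_lt _ (by norm_num)

theorem get_labP {n L x l y : ℕ} (hl : l < 1024) (hy : y < 4 * (n + 1)) :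
    get (labP n L x l) y = labF n (get L) x l y := by
  have := get_lt L x
  rw [labP, get_put _ _ _ (by omega), get_put _ _ _ (by omega), get_put _ _ _ (by omega),
    get_put _ _ _ (by omega), labF]
  split_ifs <;> omega

/-- A property of all numbers below `k`. -/
noncomputable def allLt (k : ℕ) (Q : ℕ → Bool) : Bool := Nat.rec true (fun x ih => Q x && ih) k

theorem allLt_iff {k : ℕ} {Q : ℕ → Bool} : allLt k Q = true ↔ ∀ x < k, Q x = true := by
  induction k with
  | zero => simp [allLt]
  | succ k ih =>
    rw [show allLt (k + 1) Q = (Q k && allLt k Q) from rfl, Bool.and_eq_true, ih,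
      Nat.forall_lt_succ_right, and_comm]

/-- A property of some number below `k`. -/
noncomputable def anyLt (k : ℕ) (Q : ℕ → Bool) : Bool := Nat.rec false (fun x ih => Q x || ih) k

theorem anyLt_iff {k : ℕ} {Q : ℕ → Bool} : anyLt k Q = true ↔ ∃ x < k, Q x = true := by
  induction k with
  | zero => simp [anyLt]
  | succ k ih =>
    rw [show anyLt (k + 1) Q = (Q k || anyLt k Q) from rfl, Bool.or_eq_true, ih,
      Nat.exists_lt_succ_right, or_comm]

/-- The boundary walk from `x` until it reaches `t`. -/
noncomputable def walkTo (P t : ℕ) (k : ℕ) : ℕ → (List ℕ → Bool) → Bool :=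
  Nat.rec (fun _ _ => false) (fun _ ih x Q => force (pv (get P x)) fun y =>
    bif Nat.beq y t then Q [x] else ih y fun l => Q (x :: l)) k

/-- `walkTo` returns `false` when its fuel is used up, so the value `true` guarantees that `t` is
reached and that `Q` was tested on the complete list. -/
theorem exists_of_walkTo {P t k x : ℕ} {Q : List ℕ → Bool} (h : walkTo P t k x Q = true) :
    ∃ m, Q ((List.range (m + 1)).map fun i => (wk (get P))^[i] x) = true ∧
      (wk (get P))^[m + 1] x = t ∧ ∀ i, 1 ≤ i → i ≤ m → (wk (get P))^[i] x ≠ t := by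
  induction k generalizing x Q with
  | zero => exact absurd h (by simp [walkTo])
  | succ k ih =>
    have e : walkTo P t (k + 1) x Q = force (pv (get P x)) fun y =>
      bif Nat.beq y t then Q [x] else walkTo P t k y fun l => Q (x :: l) := rfl
    rw [e, force_eq] at h
    by_cases hy : pv (get P x) = t
    · refine ⟨0, ?_, hy, fun i h1 h2 => by omega⟩
      simpa [hy, natBeq_eq] using h
    · rw [show Nat.beq (pv (get P x)) t = false by simpa [natBeq_eq] using hy] at h
      obtain ⟨m, h1, h2, h3⟩ := ih h
      refine ⟨m + 1, ?_, h2, fun i h4 h5 => ?_⟩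
      · rw [List.range_succ_eq_map, List.map_cons, List.map_map]
        exact h1
      · obtain ⟨i, rfl⟩ : ∃ j, i = j + 1 := ⟨i - 1, by omega⟩
        rcases Nat.eq_zero_or_pos i with rfl | h6
        · exact hy
        · exact h3 i h6 (by omega)

/-- A corner of the code. -/
noncomputable def isCorner (P x : ℕ) : Bool :=
  !(Nat.beq (get P x) x) && !(Nat.beq (get P (nx x)) (nx x))

theorem isCorner_iff {P x : ℕ} :
    isCorner P x = true ↔ get P x ≠ x ∧ get P (nx x) ≠ nx x := by
  simp [isCorner, natBeq_eq]

/-- The number of corners in a list. -/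
noncomputable def cornersIn (P : ℕ) (l : List ℕ) : ℕ :=
  List.rec 0 (fun x _ ih => bif isCorner P x then ih + 1 else ih) l

theorem cornersIn_eq (P : ℕ) (l : List ℕ) : cornersIn P l = (l.filter (isCorner P)).length := by
  induction l with
  | nil => rfl
  | cons x l ih =>
    rw [show cornersIn P (x :: l) = bif isCorner P x then cornersIn P l + 1 else cornersIn P l from
      rfl, ih]
    cases h : isCorner P x <;> simp [h]

theorem cornersIn_append (P : ℕ) (l l' : List ℕ) :
    cornersIn P (l ++ l') = cornersIn P l + cornersIn P l' := by
  simp [cornersIn_eq]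

/-- Membership. -/
noncomputable def elem (x : ℕ) (l : List ℕ) : Bool :=
  List.rec false (fun y _ ih => Nat.beq x y || ih) l

theorem elem_iff {x : ℕ} {l : List ℕ} : elem x l = true ↔ x ∈ l := by
  induction l with
  | nil => simp [elem]
  | cons y l ih =>
    rw [show elem x (y :: l) = (Nat.beq x y || elem x l) from rfl, Bool.or_eq_true, ih]
    simp [natBeq_eq]

/-- All ways to continue from the stub `t`: by connecting it to a stub of the boundary walk `L`, or
by a new crossing on a segment of `L`. The first ones are passed to `Q₀` and the other ones to
`Q₁`, unless a component with more than four corners arises; `T` is the number of corners of `L`. -/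
noncomputable def Code.outcomes (c : Code) (t : ℕ) (Q₀ Q₁ : Code → Bool) (L : List ℕ) (T : ℕ)
    (l : List ℕ) : ℕ → Bool :=
  List.rec (fun _ => true) (fun y _ ih b =>
    bif Nat.beq (get c.p y) y then
      (!(Nat.beq (get c.lab y) (get c.lab t)) || !(Nat.ble b 2 && Nat.ble T (b + 2)) ||
        forceCode c.n (joinP c.p t y) c.lab Q₀) && ih b
    else
      force (bif Nat.beq (get c.p (nx y)) (nx y) then b else b + 1) fun b' =>
      (Nat.beq (get c.lab y) (get c.lab t) ||
        (!(Nat.ble b' 2 && Nat.ble T (b' + 2)) && !(elem (get c.p y) L)) ||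
      forceCode (c.n + 1) (joinP (splitP c.n c.p y) t (4 * c.n + 1))
        (labP c.n c.lab y (get c.lab t)) Q₁) && ih b') l

/-- The counter `b` holds the corners already passed, and `T` minus the counter is the number of
those to come. A cut adds two corners on each side, so each side may have at most two old ones. For
a new crossing the test is waived if the boundary walk also runs along the other side of the
segment, because the cut then does not simply divide the list into two parts. -/
theorem of_outcomes {c : Code} {t : ℕ} {Q₀ Q₁ : Code → Bool} {L : List ℕ} {T b y : ℕ}
    {pre post : List ℕ} (h : c.outcomes t Q₀ Q₁ L T (pre ++ y :: post) b = true) :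
    (get c.p y = y → get c.lab y = get c.lab t → b + cornersIn c.p pre ≤ 2 →
      T ≤ b + cornersIn c.p pre + 2 → Q₀ ⟨c.n, joinP c.p t y, c.lab⟩ = true) ∧
    (get c.p y ≠ y → get c.lab y ≠ get c.lab t →
      (get c.p y ∉ L → b + cornersIn c.p (pre ++ [y]) ≤ 2 ∧
        T ≤ b + cornersIn c.p (pre ++ [y]) + 2) →
      Q₁ ⟨c.n + 1, joinP (splitP c.n c.p y) t (4 * c.n + 1),
        labP c.n c.lab y (get c.lab t)⟩ = true) := by
  have e (y : ℕ) (l : List ℕ) (b : ℕ) : c.outcomes t Q₀ Q₁ L T (y :: l) b =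
    bif Nat.beq (get c.p y) y then
      (!(Nat.beq (get c.lab y) (get c.lab t)) || !(Nat.ble b 2 && Nat.ble T (b + 2)) ||
        forceCode c.n (joinP c.p t y) c.lab Q₀) && c.outcomes t Q₀ Q₁ L T l b
    else
      force (bif Nat.beq (get c.p (nx y)) (nx y) then b else b + 1) fun b' =>
      (Nat.beq (get c.lab y) (get c.lab t) ||
        (!(Nat.ble b' 2 && Nat.ble T (b' + 2)) && !(elem (get c.p y) L)) ||
      forceCode (c.n + 1) (joinP (splitP c.n c.p y) t (4 * c.n + 1))
        (labP c.n c.lab y (get c.lab t)) Q₁) && c.outcomes t Q₀ Q₁ L T l b' := rfl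
  induction pre generalizing b with
  | nil =>
    rw [List.nil_append, e] at h
    rw [List.nil_append]
    by_cases hy : get c.p y = y
    · rw [show Nat.beq (get c.p y) y = true by simpa [natBeq_eq] using hy, cond_true, forceCode_eq] at h
      refine ⟨fun _ h1 h2 h3 => ?_, fun h1 => absurd hy h1⟩
      simp only [show cornersIn c.p [] = 0 from rfl, add_zero] at h2 h3
      simpa [h1, h2, h3, natBeq_eq, natBle_eq] using (Bool.and_eq_true_iff.1 h).1
    · rw [show Nat.beq (get c.p y) y = false by simpa [natBeq_eq] using hy, cond_false, force_eq,
        forceCode_eq] at h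
      refine ⟨fun h1 => absurd h1 hy, fun _ h1 h2 => ?_⟩
      have h3 := (Bool.and_eq_true_iff.1 h).1
      have h4 : (bif Nat.beq (get c.p (nx y)) (nx y) then b else b + 1) =
          b + cornersIn c.p [y] := by
        by_cases h5 : get c.p (nx y) = nx y <;> simp [cornersIn_eq, isCorner, hy, h5, natBeq_eq]
      rw [h4] at h3
      by_cases h5 : get c.p y ∈ L
      · simpa [elem_iff.2 h5, h1, natBeq_eq, natBle_eq] using h3
      · simpa [(h2 h5).1, (h2 h5).2, h1, natBeq_eq, natBle_eq] using h3
  | cons z pre ih =>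
    rw [List.cons_append, e] at h
    have key : ∃ b', b' = b + cornersIn c.p [z] ∧
        c.outcomes t Q₀ Q₁ L T (pre ++ y :: post) b' = true := by
      by_cases hz : get c.p z = z
      · rw [show Nat.beq (get c.p z) z = true by simpa [natBeq_eq] using hz, cond_true] at h
        exact ⟨b, by simp [cornersIn_eq, isCorner, hz, natBeq_eq], (Bool.and_eq_true_iff.1 h).2⟩
      · rw [show Nat.beq (get c.p z) z = false by simpa [natBeq_eq] using hz, cond_false, force_eq] at h
        refine ⟨_, ?_, (Bool.and_eq_true_iff.1 h).2⟩
        by_cases h5 : get c.p (nx z) = nx z <;> simp [cornersIn_eq, isCorner, hz, h5, natBeq_eq]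
    obtain ⟨b', hb, h'⟩ := key
    have h6 (l : List ℕ) : b' + cornersIn c.p l = b + cornersIn c.p (z :: l) := by
      rw [show z :: l = [z] ++ l from rfl, hb, cornersIn_append, add_assoc]
    have := ih h'
    rwa [h6, h6] at this

/-- All ways to continue from the stub `t`. -/
noncomputable def Code.stepsAll (c : Code) (t : ℕ) (Q₀ Q₁ : Code → Bool) : Bool :=
  force (pv t) fun u => walkTo c.p t (4 * c.n) u fun L => force (cornersIn c.p L) fun T =>
    c.outcomes t Q₀ Q₁ L T L 0

end CombMap

/-! ### Pruning by corners, and the ways to continue from a stub -/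

namespace CombMap

variable {D : Type*} {M : CombMap D}

theorem joinF_comm {p : ℕ → ℕ} {t s : ℕ} (hts : t ≠ s) : joinF p t s = joinF p s t :=
  Function.update_comm hts _ _ _

namespace Realizes

variable {S : Set D} {n r : ℕ} {p lab : ℕ → ℕ} {f : ℕ → D} {κ : ℕ → M.CentralCircuit}

/-- If the stubs `t` and `s` are connected, there were at most two corners between them. -/
theorem corners_between [Finite D] (hM : M.IsTaut) {t s : ℕ}
    (h : Realizes M S n r (joinF p t s) lab f κ) (hs : s < 4 * n)
    (hts : t ≠ s) (hpt : p t = t) (hps : p s = s) (h1 : p (nx s) ≠ nx s) (h2 : p (pv t) ≠ pv t)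
    (m : ℕ) (hm : ∀ i, 1 ≤ i → i ≤ m → (wk p)^[i] t ≠ t ∧ (wk p)^[i] t ≠ s) {l : List ℕ}
    (hl : l.Nodup) (hl' : ∀ x ∈ l, (∃ i, 1 ≤ i ∧ i ≤ m ∧ x = (wk p)^[i] t) ∧ p x ≠ x ∧
      p (nx x) ≠ nx x) : l.length ≤ 2 := by
  have qt : joinF p t s t = s := by simp [joinF, hts]
  have qs : joinF p t s s = t := by simp [joinF]
  have qo {y : ℕ} (h1 : y ≠ t) (h2 : y ≠ s) : joinF p t s y = p y := by simp [joinF, h1, h2]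
  have key : ∀ i, 1 ≤ i → i ≤ m → (wk (joinF p t s))^[i] s = (wk p)^[i] t := by
    intro i hi him
    induction i with
    | zero => omega
    | succ i ih =>
      rcases Nat.eq_zero_or_pos i with rfl | hi'
      · simp [wk, qs, hpt]
      · have := hm i hi' (by omega)
        rw [Function.iterate_succ_apply', Function.iterate_succ_apply', ih hi' (by omega), wk, wk,
          qo this.1 this.2]
  have hne1 : pv t ≠ s := fun e => h2 (by rw [e, hps])
  have hne2 : nx s ≠ t := fun e => h1 (by rw [e, hpt])
  have hne3 : pv t ≠ t := fun e => nx_ne t (by rw [← e, nx_pv, e])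
  have hdis : ∀ x ∈ l, x ≠ t ∧ x ≠ s ∧ nx x ≠ t ∧ nx x ≠ s := by
    intro x hx
    obtain ⟨⟨i, hi, him, rfl⟩, h3, h4⟩ := hl' x hx
    exact ⟨(hm i hi him).1, (hm i hi him).2, fun e => h4 (by rw [e, hpt]),
      fun e => h4 (by rw [e, hps])⟩
  -- The boundary walk that now starts at `s` has two new corners, at `s` and at `pv t`, in addition
  -- to those in `l`.
  have := h.corners_le hM hs (by rw [qs]; exact hts) (l := s :: pv t :: l) (by
    refine List.nodup_cons.2 ⟨?_, List.nodup_cons.2 ⟨?_, hl⟩⟩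
    · rw [List.mem_cons, not_or]
      exact ⟨hne1.symm, fun hx => (hdis s hx).2.1 rfl⟩
    · intro hx
      exact (hdis _ hx).2.2.1 (nx_pv t)) (by
    intro x hx
    rw [List.mem_cons, List.mem_cons] at hx
    rcases hx with rfl | rfl | hx
    · exact ⟨⟨0, rfl⟩, by rw [qs]; exact hts, by rw [qo hne2 (nx_ne x)]; exact h1⟩
    · refine ⟨⟨1, by simp [wk, qs]⟩, by rw [qo hne3 hne1]; exact h2, ?_⟩
      rw [nx_pv, qt]; exact hts.symm
    · obtain ⟨⟨i, hi, him, e⟩, h3, h4⟩ := hl' x hx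
      obtain ⟨d1, d2, d3, d4⟩ := hdis x hx
      exact ⟨⟨i, by rw [key i hi him, e]⟩, by rwa [qo d1 d2], by rwa [qo d3 d4]⟩)
  simp only [List.length_cons] at this
  omega

/-- The same for a new crossing on the segment from `y`. -/
theorem corners_before_split [Finite D] (hM : M.IsTaut) {t y : ℕ}
    (h : Realizes M S (n + 1) r (joinF (splitF n p y) t (4 * n + 1)) lab f κ) (ht : t < 4 * n) (hyn : y < 4 * n)
    (hplt : ∀ x < 4 * n, p x < 4 * n) (hpt : p t = t) (hpp : p (p y) = y) (hy : p y ≠ y)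
    (h2 : p (pv t) ≠ pv t)
    (m : ℕ) (hm : ∀ i, 1 ≤ i → i ≤ m → (wk p)^[i] t ≠ t)
    (hm' : ∀ i, i < m → (wk p)^[i] t ≠ y ∧ (wk p)^[i] t ≠ p y) {l : List ℕ}
    (hl : l.Nodup) (hl' : ∀ x ∈ l, (∃ i, 1 ≤ i ∧ i ≤ m ∧ x = (wk p)^[i] t) ∧ p x ≠ x ∧
      p (nx x) ≠ nx x) : l.length ≤ 2 := by
  have hlt : ∀ i, (wk p)^[i] t < 4 * n := by
    intro i
    induction i with
    | zero => exact ht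
    | succ i ih => rw [Function.iterate_succ_apply']; exact pv_lt (hplt _ ih)
  have hfix : ∀ x < 4 * n, p x ≠ x → splitF n p y x ≠ x := by
    intro x hx hpx
    simp only [splitF, if_pos hx]
    split_ifs <;> omega
  have hty : t ≠ y := by rintro rfl; exact hy hpt
  have htpy : t ≠ p y := by rintro rfl; exact hy (by rw [← hpt, hpp])
  have key : ∀ i ≤ m, (wk (splitF n p y))^[i] t = (wk p)^[i] t := by
    intro i hi
    induction i with
    | zero => rfl
    | succ i ih =>
      rw [Function.iterate_succ_apply', Function.iterate_succ_apply', ih (by omega), wk, wk]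
      have := hm' i (by omega)
      simp [splitF, hlt i, this]
  refine h.corners_between hM (s := 4 * n + 1) (by omega) (by omega)
    (by simp [splitF, ht, hty, htpy, hpt]) (by simp [splitF]) ?_ (hfix _ (pv_lt ht) h2) m ?_ hl ?_
  · rw [show nx (4 * n + 1) = 4 * n + 2 by unfold nx; omega]
    simp only [splitF]
    simp; omega
  · intro i h3 h4
    rw [key i h4]
    exact ⟨hm i h3 h4, by have := hlt i; omega⟩
  · intro x hx
    obtain ⟨⟨i, h3, h4, rfl⟩, h5, h6⟩ := hl' x hx
    exact ⟨⟨i, h3, h4, (key i h4).symm⟩, hfix _ (hlt i) h5, hfix _ (nx_lt (hlt i)) h6⟩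

/-- The other side of the cut: its boundary walk leaves the new vertex along the second part of the
segment from `y` and then continues as before. -/
theorem corners_after_split [Finite D] (hM : M.IsTaut) {t y : ℕ}
    (h : Realizes M S (n + 1) r (joinF (splitF n p y) t (4 * n + 1)) lab f κ) (ht : t < 4 * n)
    (hyn : y < 4 * n) (hplt : ∀ x < 4 * n, p x < 4 * n) (hpt : p t = t) (hpp : p (p y) = y)
    (hy : p y ≠ y) (h2 : p (nx t) ≠ nx t)
    (m : ℕ) (hm : ∀ i, 1 ≤ i → i ≤ m → (wk p)^[i] y ≠ t ∧ (wk p)^[i] y ≠ y ∧ (wk p)^[i] y ≠ p y)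
    {l : List ℕ} (hl : l.Nodup) (hl' : ∀ x ∈ l, (∃ i, 1 ≤ i ∧ i ≤ m ∧ x = (wk p)^[i] y) ∧ p x ≠ x ∧
      p (nx x) ≠ nx x) : l.length ≤ 2 := by
  have hlt : ∀ i, (wk p)^[i] y < 4 * n := by
    intro i
    induction i with
    | zero => exact hyn
    | succ i ih => rw [Function.iterate_succ_apply']; exact pv_lt (hplt _ ih)
  have hfix : ∀ x < 4 * n, p x ≠ x → splitF n p y x ≠ x := by
    intro x hx hpx
    simp only [splitF, if_pos hx]
    split_ifs <;> omega
  have hty : t ≠ y := by rintro rfl; exact hy hpt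
  have htpy : t ≠ p y := by rintro rfl; exact hy (by rw [← hpt, hpp])
  have hpv : pv (4 * n + 1) = 4 * n := by unfold pv; omega
  have key1 : (wk (splitF n p y))^[1] (4 * n + 1) = 4 * n := by
    simp [wk, splitF, hpv]
  have key : ∀ i, 1 ≤ i → i ≤ m → (wk (splitF n p y))^[i + 1] (4 * n + 1) = (wk p)^[i] y := by
    intro i h1 hi
    induction i with
    | zero => omega
    | succ i ih =>
      rw [Function.iterate_succ_apply', Function.iterate_succ_apply' (wk p)]
      rcases Nat.eq_zero_or_pos i with rfl | h3
      · rw [zero_add, key1]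
        simp [wk, splitF]
      · have := hm i h3 (by omega)
        rw [ih h3 (by omega), wk, wk]
        simp [splitF, hlt i, this]
  rw [joinF_comm (by omega)] at h
  refine h.corners_between hM (t := 4 * n + 1) (s := t) (by omega) (by omega) (by simp [splitF])
    (by simp [splitF, ht, hty, htpy, hpt]) (hfix _ (nx_lt ht) h2) ?_ (m + 1) ?_ hl ?_
  · rw [hpv]
    simp only [splitF]
    have := hplt y hyn
    simp; omega
  · intro i h3 h4
    obtain ⟨i, rfl⟩ : ∃ j, i = j + 1 := ⟨i - 1, by omega⟩
    rcases Nat.eq_zero_or_pos i with rfl | h5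
    · rw [zero_add, key1]; omega
    · rw [key i h5 (by omega)]
      have := hlt i
      exact ⟨by omega, (hm i h5 (by omega)).1⟩
  · intro x hx
    obtain ⟨⟨i, h3, h4, rfl⟩, h5, h6⟩ := hl' x hx
    exact ⟨⟨i + 1, by omega, by omega, (key i h3 h4).symm⟩, hfix _ (hlt i) h5,
      hfix _ (nx_lt (hlt i)) h6⟩

end Realizes

/-- The darts of a cycle before and after a given one. -/
theorem exists_split_of_iterate {w : ℕ → ℕ} {t m k : ℕ} (hend : w^[m + 2] t = t)
    (hk : w^[k] t ≠ t) :
    ∃ a b, w^[a + 1] t = w^[k] t ∧ a + b = m ∧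
      ((List.range (m + 1)).map fun i => w^[i] (w t)) =
        ((List.range a).map fun i => w^[i + 1] t) ++ w^[k] t ::
          (List.range b).map fun i => w^[i + 1] (w^[k] t) := by
  have hmod : w^[k % (m + 2)] t = w^[k] t := Function.IsPeriodicPt.iterate_mod_apply hend k
  have h0 : k % (m + 2) ≠ 0 := fun e => hk (by rw [← hmod, e]; rfl)
  have hlt : k % (m + 2) < m + 2 := Nat.mod_lt _ (by omega)
  obtain ⟨a, ha⟩ := Nat.exists_eq_succ_of_ne_zero h0
  rw [ha] at hmod hlt
  refine ⟨a, m - a, hmod, by omega, ?_⟩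
  rw [show m + 1 = a + (1 + (m - a)) by omega, List.range_add, List.map_append, List.range_add]
  simp only [List.range_one, List.map_map, List.map_cons, Function.comp_def,
    List.singleton_append]
  congr 1
  rw [← hmod]
  congr 1
  refine List.map_congr_left fun i _ => ?_
  rw [← Function.iterate_succ_apply, ← Function.iterate_add_apply]
  congr 1
  omega

theorem iterate_inj_of_cycle {w : ℕ → ℕ} {t m : ℕ} (hend : w^[m + 2] t = t)
    (hne : ∀ i, 1 ≤ i → i ≤ m + 1 → w^[i] t ≠ t) {i j : ℕ} (hi : i ≤ m + 1) (hj : j ≤ m + 1)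
    (e : w^[i] t = w^[j] t) : i = j := by
  wlog hij : i ≤ j generalizing i j
  · exact (this hj hi e.symm (by omega)).symm
  by_contra hc
  refine hne (i + (m + 2 - j)) (by omega) (by omega) ?_
  rw [add_comm, Function.iterate_add_apply, e, ← Function.iterate_add_apply,
    show m + 2 - j + j = m + 2 by omega, hend]

/-- The ways to continue from a stub, on the level of arrays. -/
theorem Realizes.stepsAll [Finite D] (hM : M.IsTaut) {S : Set D} {r : ℕ} {c : Code} {f : ℕ → D}
    {κ : ℕ → M.CentralCircuit} (h : Realizes M S c.n r (get c.p) (get c.lab) f κ)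
    (hn : 4 * (c.n + 1) ≤ 1024) {t : ℕ} (ht : t < 4 * c.n) (hpt : get c.p t = t)
    {Q₀ Q₁ : Code → Bool} (hQ : c.stepsAll t Q₀ Q₁ = true) :
    ∃ S', S ⊆ S' ∧ (∀ d ∈ S', d ∈ S ∨ M.circuit d = M.circuit (f t)) ∧
      ((∃ s, Q₀ ⟨c.n, joinP c.p t s, c.lab⟩ = true ∧
        Realizes M S' c.n r (get (joinP c.p t s)) (get c.lab) f κ) ∨
      ∃ p' lab' f', Q₁ ⟨c.n + 1, p', lab'⟩ = true ∧ (∀ x < 4 * c.n, f' x = f x) ∧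
        Realizes M S' (c.n + 1) r (get p') (get lab') f' κ) := by
  set p := get c.p with hp
  simp only [Code.stepsAll, force_eq] at hQ
  obtain ⟨m, hQ, hend, hne⟩ := exists_of_walkTo hQ
  rw [← hp] at hQ hend hne
  have hw : pv t = wk p t := by rw [wk, hpt]
  rw [hw] at hQ hend hne
  have hend : (wk p)^[m + 2] t = t := hend
  have hne : ∀ i, 1 ≤ i → i ≤ m + 1 → (wk p)^[i] t ≠ t := by
    intro i h1 h2
    obtain ⟨i, rfl⟩ : ∃ j, i = j + 1 := ⟨i - 1, by omega⟩
    rcases Nat.eq_zero_or_pos i with rfl | h3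
    · rw [zero_add, Function.iterate_one, ← hw]
      intro e
      exact nx_ne t (by rw [← e, nx_pv, e])
    · rw [Function.iterate_succ_apply]; exact hne i h3 (by omega)
  have hinj {i j : ℕ} := @iterate_inj_of_cycle (wk p) t m hend hne i j
  have hpt1 : p (nx t) ≠ nx t := h.p_nx t ht hpt
  have hpt2 : p (pv t) ≠ pv t := by
    intro e
    have := h.p_nx _ (pv_lt ht) e
    rw [nx_pv] at this
    exact this hpt
  obtain ⟨k, hk⟩ := h.exists_step hM ht hpt
  have hyt : (wk p)^[k] t ≠ t := by
    rcases hk with hk | hk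
    · exact hk.2.1
    · intro e; rw [e] at hk; exact hk.1 hpt
  obtain ⟨a, b, ha, hab, hL⟩ := exists_split_of_iterate hend hyt
  have hyn := h.wk_iterate_lt ht k
  generalize hy : (wk p)^[k] t = y at hk hyt ha hL hyn
  rw [hL] at hQ
  have hout := of_outcomes hQ
  rw [← hL, zero_add, zero_add, ← hp] at hout
  have hpost (i : ℕ) : (wk p)^[i + 1] y = (wk p)^[a + 1 + (i + 1)] t := by
    rw [← ha, ← Function.iterate_add_apply, add_comm]
  have hndpre : ((List.range a).map fun i => (wk p)^[i + 1] t).Nodup := by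
    refine List.Nodup.map_on ?_ List.nodup_range
    intro i hi j hj e
    rw [List.mem_range] at hi hj
    have := hinj (by omega) (by omega) e
    omega
  have hndpre' : ((List.range (a + 1)).map fun i => (wk p)^[i + 1] t).Nodup := by
    refine List.Nodup.map_on ?_ List.nodup_range
    intro i hi j hj e
    rw [List.mem_range] at hi hj
    have := hinj (by omega) (by omega) e
    omega
  have hndpost : ((List.range b).map fun i => (wk p)^[i + 1] y).Nodup := by
    refine List.Nodup.map_on ?_ List.nodup_range
    intro i hi j hj e
    rw [List.mem_range] at hi hj
    rw [hpost, hpost] at e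
    have := hinj (by omega) (by omega) e
    omega
  have hpre' : ((List.range a).map fun i => (wk p)^[i + 1] t) ++ [y] =
      (List.range (a + 1)).map fun i => (wk p)^[i + 1] t := by
    rw [List.range_succ, List.map_append, List.map_singleton, ha]
  have hfil {g : ℕ → ℕ} {N x : ℕ} (hx : x ∈ ((List.range N).map g).filter (isCorner c.p)) :
      (∃ i < N, x = g i) ∧ p x ≠ x ∧ p (nx x) ≠ nx x := by
    obtain ⟨h1, h2⟩ := List.mem_filter.1 hx
    obtain ⟨i, h3, rfl⟩ := List.mem_map.1 h1
    exact ⟨⟨i, List.mem_range.1 h3, rfl⟩, isCorner_iff.1 h2⟩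
  have hT : cornersIn c.p ((List.range (m + 1)).map fun i => (wk p)^[i] (wk p t)) =
      cornersIn c.p (((List.range a).map fun i => (wk p)^[i + 1] t) ++ [y]) +
        cornersIn c.p ((List.range b).map fun i => (wk p)^[i + 1] y) := by
    rw [hL, ← cornersIn_append, List.append_assoc, List.singleton_append]
  rcases hk with ⟨h1, h2, h3, S', hS1, hS2, hS3⟩ | ⟨h1, h2, S', f', hS1, hS2, hf, hS3⟩
  · refine ⟨S', hS1, hS2, Or.inl ⟨y, ?_, ?_⟩⟩
    · have hpre : cornersIn c.p ((List.range a).map fun i => (wk p)^[i + 1] t) ≤ 2 := by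
        rw [cornersIn_eq]
        refine hS3.corners_between hM hyn hyt.symm hpt h1 (h.p_nx y hyn h1) hpt2 a ?_
          (hndpre.filter _) ?_
        · intro i h4 h5
          refine ⟨hne i h4 (by omega), fun e => ?_⟩
          have := hinj (by omega) (by omega) (e.trans ha.symm)
          omega
        · intro x hx
          obtain ⟨⟨i, h4, rfl⟩, h5⟩ := hfil hx
          exact ⟨⟨i + 1, by omega, by omega, rfl⟩, h5⟩
      have hpo : cornersIn c.p ((List.range b).map fun i => (wk p)^[i + 1] y) ≤ 2 := by
        rw [cornersIn_eq]
        rw [joinF_comm hyt.symm] at hS3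
        refine hS3.corners_between hM ht hyt h1 hpt hpt1 ?_ b ?_ (hndpost.filter _) ?_
        · intro e
          have := h.p_nx _ (pv_lt hyn) e
          rw [nx_pv] at this
          exact this h1
        · intro i h4 h5
          obtain ⟨i, rfl⟩ : ∃ j, i = j + 1 := ⟨i - 1, by omega⟩
          rw [hpost]
          refine ⟨fun e => ?_, hne _ (by omega) (by omega)⟩
          have := hinj (by omega) (by omega) (e.trans ha.symm)
          omega
        · intro x hx
          obtain ⟨⟨i, h4, rfl⟩, h5⟩ := hfil hx
          exact ⟨⟨i + 1, by omega, by omega, rfl⟩, h5⟩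
      refine hout.1 h1 h3 hpre ?_
      have : cornersIn c.p [y] = 0 := by
        have : isCorner c.p y = false := by
          rw [← Bool.not_eq_true, isCorner_iff]
          exact fun h4 => h4.1 h1
        simp [cornersIn_eq, this]
      rw [hT, cornersIn_append]
      omega
    · rwa [get_joinP (by omega) (by omega)]
  · refine ⟨S', hS1, hS2, Or.inr ⟨_, _, f', hout.2 h1 h2 ?_, hf, ?_⟩⟩
    -- Since `p y` is not on the boundary walk, inserting the new vertex affects this walk only on
    -- the segment from `y`, and the corner bounds hold for both parts.
    · intro hL'
      have hnot {i : ℕ} (h4 : 1 ≤ i) (h5 : i ≤ m + 1) : (wk p)^[i] t ≠ p y := by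
        intro e
        refine hL' (List.mem_map.2 ⟨i - 1, List.mem_range.2 (by omega), ?_⟩)
        rw [← e, ← Function.iterate_succ_apply]
        congr 1
        omega
      have hpre : cornersIn c.p (((List.range a).map fun i => (wk p)^[i + 1] t) ++ [y]) ≤ 2 := by
        rw [cornersIn_eq, hpre']
        refine hS3.corners_before_split hM ht hyn h.p_lt hpt (h.p_p y hyn) h1 hpt2 (a + 1)
          (fun i h4 h5 => hne i h4 (by omega)) ?_ (hndpre'.filter _) ?_
        · intro i h4
          constructor
          · intro e
            have := hinj (by omega) (by omega) (e.trans ha.symm)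
            omega
          · rcases Nat.eq_zero_or_pos i with rfl | h5
            · rintro rfl
              exact hyt ((h.p_p y hyn).symm.trans hpt)
            · exact hnot h5 (by omega)
        · intro x hx
          obtain ⟨⟨i, h4, rfl⟩, h5⟩ := hfil hx
          exact ⟨⟨i + 1, by omega, by omega, rfl⟩, h5⟩
      have hpo : cornersIn c.p ((List.range b).map fun i => (wk p)^[i + 1] y) ≤ 2 := by
        rw [cornersIn_eq]
        refine hS3.corners_after_split hM ht hyn h.p_lt hpt (h.p_p y hyn) h1 hpt1 b ?_
          (hndpost.filter _) ?_
        · intro i h4 h5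
          obtain ⟨i, rfl⟩ : ∃ j, i = j + 1 := ⟨i - 1, by omega⟩
          rw [hpost]
          refine ⟨hne _ (by omega) (by omega), fun e => ?_, hnot (by omega) (by omega)⟩
          have := hinj (by omega) (by omega) (e.trans ha.symm)
          omega
        · intro x hx
          obtain ⟨⟨i, h4, rfl⟩, h5⟩ := hfil hx
          exact ⟨⟨i + 1, by omega, by omega, rfl⟩, h5⟩
      rw [hT]
      omega
    · refine hS3.mono_f ?_ ?_
      · intro x hx
        rw [get_joinP (by omega) (by omega)]
        simp only [joinF, Function.update_apply]
        rw [get_splitP hn hyn (h.p_lt y hyn) hx]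
      · intro x hx
        rw [get_labP (get_lt _ _) hx]

end CombMap

/-! ### Crossings of circuits, and the arrangement of a single circuit -/

namespace CombMap

section

variable {D : Type*} {M : CombMap D}

theorem str_pow_orbLen_add [Finite D] (k : ℕ) (d : D) :
    (M.str ^ (orbLen M.str d + k)) d = (M.str ^ k) d := by
  rw [str_pow_add, pow_orbLen_apply]

/-- A central circuit consists of the two straight walks in opposite directions. -/
theorem IsTame.circuit_eq_iff [Finite D] (hM : M.IsTame) {a d : D} :
    M.circuit d = M.circuit a ↔
      ∃ k : ℕ, d = (M.str ^ k) a ∨ d = M.rot (M.rot ((M.str ^ k) a)) := by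
  constructor
  · intro h
    refine mem_of_circuit_eq
      (T := {d | ∃ k : ℕ, d = (M.str ^ k) a ∨ d = M.rot (M.rot ((M.str ^ k) a))}) ?_ ?_ h
      ⟨0, Or.inl rfl⟩
    · rintro _ ⟨k, rfl | rfl⟩
      · exact ⟨k, Or.inr rfl⟩
      · exact ⟨k, Or.inl (hM.rot4 _)⟩
    · rintro _ ⟨k, rfl | rfl⟩
      · exact ⟨k + 1, Or.inr (by rw [str_pow_succ, hM.rot_rot_str])⟩
      · have := orbLen_pos M.str a
        refine ⟨orbLen M.str a + k - 1, Or.inl ?_⟩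
        rw [← str_pow_orbLen_add k a,
          show orbLen M.str a + k = orbLen M.str a + k - 1 + 1 by omega, str_pow_succ,
          hM.rot_rot_str, M.edge_edge]
        rfl
  · rintro ⟨k, rfl | rfl⟩
    · exact circuit_str_pow k a
    · rw [circuit_rot_rot, circuit_str_pow]

theorem IsTame.circuit_inv_rot (hM : M.IsTame) (d : D) :
    M.circuit (M.rot⁻¹ d) = M.circuit (M.rot d) := by
  rw [hM.inv_rot, circuit_rot_rot]

/-- Any two central circuits cross. -/
theorem IsTaut.exists_crossing [Finite D] (hM : M.IsTaut) {A B : M.CentralCircuit} (hAB : A ≠ B) :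
    ∃ d, M.circuit d = A ∧ M.circuit (M.rot d) = B := by
  by_contra! hno
  let S : Set D := {d | M.circuit d = A ∨ M.circuit d = B}
  have hS : M.EdgeClosed S := fun d hd => by
    change M.circuit (M.edge d) = A ∨ M.circuit (M.edge d) = B
    rwa [circuit_edge]
  have hb : M.NoBend S := fun d hd => Or.inr (by
    change M.circuit (M.rot (M.rot d)) = A ∨ M.circuit (M.rot (M.rot d)) = B
    rwa [circuit_rot_rot])
  -- The regions that touch `A`. If `A` and `B` do not cross, a boundary walk that starts on `A`
  -- stays on `A`; being the only one, it keeps `B` away from these regions. Then `T` is closed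
  -- under crossing any edge, which contradicts connectedness.
  let T : Set D := {x | ∃ a, M.circuit a = A ∧ M.SameRegion S a x}
  have hTB : ∀ x ∈ T, M.circuit x ≠ B := by
    rintro x ⟨a, ha, hax⟩ hx
    have h1 := hM.sameCycle_of_sameRegion_of_mem hS hb (Or.inl ha) (Or.inr hx) hax
    have h2 := mem_of_sameCycle
      (s := {y | M.circuit y = A ∨ (M.circuit (M.rot y) = A ∧ y ∉ S)}) ?_ h1 (Or.inl ha)
    · rcases h2 with h2 | ⟨-, h2⟩
      · exact hAB (h2.symm.trans hx)
      · exact h2 (Or.inr hx)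
    · rintro y (hy | ⟨hy, hyS⟩)
      · right
        rw [walkPerm_of_mem hS (Or.inl hy), M.rot_inv_rot, circuit_edge]
        refine ⟨hy, ?_⟩
        rintro (h3 | h3)
        · refine hM.pure (M.rot⁻¹ (M.edge y)) ?_
          rw [M.rot_inv_rot, circuit_edge, hy, h3]
        · refine hno (M.edge y) (by rw [circuit_edge, hy]) ?_
          rw [← hM.circuit_inv_rot, h3]
      · left
        rw [walkPerm_of_notMem hS hyS, hM.circuit_inv_rot, hy]
  have hTf : ∀ x ∈ T, M.facePerm x ∈ T :=
    fun x ⟨a, ha, hax⟩ => ⟨a, ha, hax.trans (SameRegion.face x)⟩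
  have hTe : ∀ x ∈ T, M.edge x ∈ T := by
    intro x hx
    by_cases hxS : x ∈ S
    · exact ⟨M.edge x, by rw [circuit_edge]; exact hxS.resolve_right (hTB x hx),
        SameRegion.refl _⟩
    · obtain ⟨a, ha, hax⟩ := hx
      exact ⟨a, ha, hax.trans (SameRegion.edge hxS)⟩
  obtain ⟨a, ha⟩ := Quotient.exists_rep A
  obtain ⟨b, hb'⟩ := Quotient.exists_rep B
  have hT := hM.conn T ⟨a, a, ha, SameRegion.refl _⟩ (by
    intro x hx
    have : M.edge (M.rot x) ∈ T := by
      refine inv_mem_of_closed (π := M.facePerm) hTf ?_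
      rwa [facePerm_apply, M.edge_edge, M.inv_rot_rot]
    simpa [M.edge_edge] using hTe _ this) hTe
  exact hTB b (hT ▸ Set.mem_univ b) hb'

namespace Realizes

variable {S : Set D} {n r : ℕ} {p lab : ℕ → ℕ} {f : ℕ → D} {κ : ℕ → M.CentralCircuit}

theorem lab_nx_nx (h : Realizes M S n r p lab f κ) {x : ℕ} (hx : x < 4 * n) :
    lab (nx (nx x)) = lab x := by
  refine h.κ_inj _ (h.lab_lt _ (nx_lt (nx_lt hx))) _ (h.lab_lt _ hx) ?_
  rw [← h.circuit_f _ (nx_lt (nx_lt hx)), ← h.circuit_f _ hx, h.f_nx _ (nx_lt hx), h.f_nx _ hx,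
    circuit_rot_rot]

theorem lab_p (h : Realizes M S n r p lab f κ) {x : ℕ} (hx : x < 4 * n) :
    lab (p x) = lab x := by
  by_cases hp : p x = x
  · rw [hp]
  · obtain ⟨j, hj⟩ := h.seg x hx hp
    refine h.κ_inj _ (h.lab_lt _ (h.p_lt x hx)) _ (h.lab_lt _ hx) ?_
    rw [← h.circuit_f _ (h.p_lt x hx), ← h.circuit_f _ hx, ← hj.1, circuit_edge, circuit_str_pow]

/-- A straight walk follows the segments. -/
theorem exists_segment (h : Realizes M S n r p lab f κ) {X : Set ℕ}
    (hX : ∀ x ∈ X, x < 4 * n ∧ p x ≠ x ∧ nx (nx (p x)) ∈ X) {x₀ : ℕ} (hx₀ : x₀ ∈ X) (k : ℕ) :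
    ∃ x ∈ X, ∃ j i, M.Straight (named n f) (f x) (f (p x)) j ∧ i ≤ j ∧
      (M.str ^ k) (f x₀) = (M.str ^ i) (f x) := by
  induction k with
  | zero =>
    obtain ⟨h1, h2, -⟩ := hX _ hx₀
    obtain ⟨j, hj⟩ := h.seg _ h1 h2
    exact ⟨x₀, hx₀, j, 0, hj, Nat.zero_le _, rfl⟩
  | succ k ih =>
    obtain ⟨x, hx, j, i, hj, hi, e⟩ := ih
    obtain ⟨h1, h2, h3⟩ := hX x hx
    rcases Nat.lt_or_ge i j with h4 | h4
    · exact ⟨x, hx, j, i + 1, hj, h4, by rw [str_pow_succ, e, str_pow_succ]⟩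
    · obtain rfl : i = j := by omega
      obtain ⟨h5, h6, -⟩ := hX _ h3
      obtain ⟨j', hj'⟩ := h.seg _ h5 h6
      refine ⟨_, h3, j', 0, hj', Nat.zero_le _, ?_⟩
      rw [str_pow_succ, e, str_apply, hj.1, ← h.f_nx _ (h.p_lt x h1),
        ← h.f_nx _ (nx_lt (h.p_lt x h1))]
      rfl

/-- A code without stubs describes a union of central circuits. -/
theorem mem_of_circuit [Finite D] (h : Realizes M S n r p lab f κ) (hp : ∀ x < 4 * n, p x ≠ x) {d d' : D}
    (hd : d ∈ S) (e : M.circuit d' = M.circuit d) : d' ∈ S := by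
  refine mem_of_circuit_eq (fun a ha => ?_) h.edgeClosed e hd
  by_cases hn : a ∈ named n f
  · obtain ⟨x, hx, rfl⟩ := hn
    rw [← h.f_nx _ hx, ← h.f_nx _ (nx_lt hx), h.mem_iff _ (nx_lt (nx_lt hx))]
    exact hp _ (nx_lt (nx_lt hx))
  · exact (h.straight a ha hn).1

/-- In a code without stubs, the crossings are named. -/
theorem mem_named_of_rot_mem (h : Realizes M S n r p lab f κ) {d : D} (hd : d ∈ S)
    (hd' : M.rot d ∈ S) : d ∈ named n f := by
  by_contra hn
  exact (h.straight d hd hn).2 hd'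

end Realizes

/-- A single central circuit, with one of its crossings. -/
theorem IsTaut.realizes_single [Finite D] (hM : M.IsTaut) {d : D} {κ : ℕ → M.CentralCircuit}
    (h0 : M.circuit d = κ 0) (h1 : M.circuit (M.rot d) = κ 1) (h01 : κ 0 ≠ κ 1) {p lab : ℕ → ℕ}
    (p0 : p 0 = 2) (p1 : p 1 = 1) (p2 : p 2 = 0) (p3 : p 3 = 3)
    (l0 : lab 0 = 0) (l1 : lab 1 = 1) (l2 : lab 2 = 0) (l3 : lab 3 = 1) :
    Realizes M {a | M.circuit a = κ 0} 1 2 p lab (fun x => (M.rot ^ x) d) κ := by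
  have cases4 {P : ℕ → Prop} (P0 : P 0) (P1 : P 1) (P2 : P 2) (P3 : P 3) :
      ∀ y < 4 * 1, P y := by
    intro y hy
    have : y = 0 ∨ y = 1 ∨ y = 2 ∨ y = 3 := by omega
    rcases this with rfl | rfl | rfl | rfl <;> assumption
  have f0 : (M.rot ^ 0) d = d := rfl
  have f1 : (M.rot ^ 1) d = M.rot d := rfl
  have f2 : (M.rot ^ 2) d = M.rot (M.rot d) := by simp [pow_succ]
  have f3 : (M.rot ^ 3) d = M.rot (M.rot (M.rot d)) := by simp [pow_succ]
  have c2 : M.circuit (M.rot (M.rot d)) = κ 0 := by rw [circuit_rot_rot, h0]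
  have c3 : M.circuit (M.rot (M.rot (M.rot d))) = κ 1 := by rw [circuit_rot_rot, h1]
  have hnamed : ∀ e, e ∈ named 1 (fun x => (M.rot ^ x) d) → M.circuit e = κ 0 →
      e = d ∨ e = M.rot (M.rot d) := by
    rintro e ⟨x, hx, rfl⟩
    revert x
    refine cases4 ?_ ?_ ?_ ?_ <;> simp only [f0, f1, f2, f3]
    · simp
    · intro e; exact absurd (e.symm.trans h1) h01
    · simp
    · intro e; exact absurd (e.symm.trans c3) h01
  have hpos := orbLen_pos M.str d
  -- The segment is the whole circuit. The walk cannot return to the vertex of `d` before its period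
  -- is over: not through `d` itself, by minimality, and not in the opposite direction.
  have hseg : M.Straight (named 1 (fun x => (M.rot ^ x) d)) d (M.rot (M.rot d))
      (orbLen M.str d - 1) := by
    constructor
    · have := pow_orbLen_apply M.str d
      rw [show orbLen M.str d = orbLen M.str d - 1 + 1 by omega, str_pow_succ] at this
      rw [← hM.rot_rot_str, this]
    · intro i hi1 hi2 hmem
      rcases hnamed _ hmem (by rw [circuit_str_pow, h0]) with e | e
      · have := orbLen_le_of_iterate hi1 e
        omega
      · refine hM.edge_str_pow_ne d (i - 1) ?_
        rw [← hM.rot_rot_str, ← str_pow_succ, show i - 1 + 1 = i by omega, e, hM.rot4]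
  have hrot : ∀ e, M.rot e ∈ named 1 (fun x => (M.rot ^ x) d) →
      e ∈ named 1 (fun x => (M.rot ^ x) d) := by
    rintro e ⟨x, hx, e'⟩
    have key (y : ℕ) (hy : y < 4) (e'' : (M.rot ^ (y + 1)) d = M.rot e) :
        e ∈ named 1 (fun x => (M.rot ^ x) d) :=
      ⟨y, by omega, M.rot.injective (by rw [← e'', pow_succ', Perm.mul_apply])⟩
    rcases Nat.eq_zero_or_pos x with rfl | hx0
    · refine key 3 (by norm_num) ?_
      rw [← e']
      simp [pow_succ, hM.rot4]
    · exact key (x - 1) (by omega) (by rw [show x - 1 + 1 = x by omega]; exact e')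
  have hsym := hseg.symm hM hrot
  constructor
  · refine cases4 ?_ ?_ ?_ ?_ <;> simp [nx, pow_succ, hM.rot4]
  · have hd (e : D) : M.rot e ≠ e := hM.rot_ne e
    have hd' (e : D) : e ≠ M.rot e := (hM.rot_ne e).symm
    have hd2 (e : D) : M.rot (M.rot e) ≠ e := hM.rot2 e
    have hd2' (e : D) : e ≠ M.rot (M.rot e) := (hM.rot2 e).symm
    have hd3 : d ≠ M.rot (M.rot (M.rot d)) := fun e => h01 (h0.symm.trans ((congrArg _ e).trans c3))
    refine cases4 ?_ ?_ ?_ ?_ <;> refine cases4 ?_ ?_ ?_ ?_ <;>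
      simp only [f0, f1, f2, f3, hd, hd', hd2, hd2', hd3, hd3.symm, false_imp_iff, imp_true_iff]
  · refine cases4 ?_ ?_ ?_ ?_ <;> simp [*]
  · refine cases4 ?_ ?_ ?_ ?_ <;> simp [*]
  · refine cases4 ?_ ?_ ?_ ?_ <;>
      simp only [f0, f1, f2, f3, p0, p1, p2, p3, Set.mem_ofPred_eq, h0, h1, c2, c3] <;>
      simp [h01.symm]
  · refine cases4 ?_ ?_ ?_ ?_ <;> simp [nx, *]
  · refine cases4 ?_ ?_ ?_ ?_ <;> simp only [f0, f1, f2, f3, p0, p1, p2, p3]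
    · exact fun _ => ⟨_, hseg⟩
    · simp
    · exact fun _ => ⟨_, hsym⟩
    · simp
  · intro a ha
    change M.circuit (M.edge a) = κ 0
    rw [circuit_edge]; exact ha
  · intro a ha _
    constructor
    · change M.circuit (M.rot (M.rot a)) = κ 0
      rw [circuit_rot_rot]; exact ha
    · intro h'
      exact hM.pure a (Eq.trans h' (Eq.symm ha))
  · refine cases4 ?_ ?_ ?_ ?_ <;> simp [*]
  · refine cases4 ?_ ?_ ?_ ?_ <;> simp only [f0, f1, f2, f3, l0, l1, l2, l3, h0, h1, c2, c3]
  · intro i hi j hj e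
    have hi' : i = 0 ∨ i = 1 := by omega
    have hj' : j = 0 ∨ j = 1 := by omega
    rcases hi' with rfl | rfl <;> rcases hj' with rfl | rfl
    · rfl
    · exact absurd e h01
    · exact absurd e.symm h01
    · rfl

end

end CombMap

/-! ### Bounded search for a further circuit -/

namespace CombMap

/-- At most `m` vertices from `n` on are crossings of the circuits `i` and `j`. -/
noncomputable def Code.crossLE (c : Code) (i j n m : ℕ) : Bool :=
  Nat.rec (motive := fun _ => ℕ → Bool) (fun _ => true) (fun k ih m => force (4 * (n + k)) fun x =>
    bif Nat.beq (get c.lab x) i && Nat.beq (get c.lab (x + 1)) j then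
      Nat.rec (motive := fun _ => Bool) false (fun m' _ => ih m') m else ih m) (c.n - n) m

theorem Code.exists_of_crossLE {c : Code} {i j n m : ℕ} (h : c.crossLE i j n m = false) :
    ∃ V : Finset ℕ, m < V.card ∧ ∀ v ∈ V, v < c.n ∧ get c.lab (4 * v) = i ∧
      get c.lab (4 * v + 1) = j := by
  suffices key : ∀ k m, Nat.rec (motive := fun _ => ℕ → Bool) (fun _ => true)
      (fun k ih m => force (4 * (n + k)) fun x =>
      bif Nat.beq (get c.lab x) i && Nat.beq (get c.lab (x + 1)) j then
        Nat.rec (motive := fun _ => Bool) false (fun m' _ => ih m') m else ih m) k m = false →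
      ∃ V : Finset ℕ, m < V.card ∧ ∀ v ∈ V, v < n + k ∧ get c.lab (4 * v) = i ∧
      get c.lab (4 * v + 1) = j by
    obtain ⟨V, h1, h2⟩ := key _ _ h
    rcases Nat.lt_or_ge n c.n with h3 | h3
    · exact ⟨V, h1, fun v hv => ⟨by have := (h2 v hv).1; omega, (h2 v hv).2⟩⟩
    · rw [Code.crossLE, show c.n - n = 0 by omega] at h
      exact absurd h (by simp)
  intro k
  induction k with
  | zero => intro m h; exact absurd h (by simp)
  | succ k ih =>
    intro m h
    have h : (force (4 * (n + k)) fun x =>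
      bif Nat.beq (get c.lab x) i && Nat.beq (get c.lab (x + 1)) j then
        Nat.rec (motive := fun _ => Bool) false (fun m' _ => Nat.rec (motive := fun _ => ℕ → Bool)
          (fun _ => true) (fun k ih m => force (4 * (n + k)) fun x =>
      bif Nat.beq (get c.lab x) i && Nat.beq (get c.lab (x + 1)) j then
        Nat.rec (motive := fun _ => Bool) false (fun m' _ => ih m') m else ih m) k m') m
        else Nat.rec (motive := fun _ => ℕ → Bool)
          (fun _ => true) (fun k ih m => force (4 * (n + k)) fun x =>
      bif Nat.beq (get c.lab x) i && Nat.beq (get c.lab (x + 1)) j then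
        Nat.rec (motive := fun _ => Bool) false (fun m' _ => ih m') m else ih m) k m) = false := h
    rw [force_eq] at h
    by_cases hc : get c.lab (4 * (n + k)) = i ∧ get c.lab (4 * (n + k) + 1) = j
    · rw [show (Nat.beq (get c.lab (4 * (n + k))) i &&
        Nat.beq (get c.lab (4 * (n + k) + 1)) j) = true by simpa [natBeq_eq] using hc] at h
      match m with
      | 0 => exact ⟨{n + k}, by simp, fun v hv => by
        rw [Finset.mem_singleton.1 hv]; exact ⟨by omega, hc⟩⟩
      | m + 1 =>
        obtain ⟨V, h1, h2⟩ := ih m h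
        refine ⟨insert (n + k) V, ?_, ?_⟩
        · rw [Finset.card_insert_of_notMem fun hv => by have := (h2 _ hv).1; omega]
          omega
        · intro v hv
          rcases Finset.mem_insert.1 hv with rfl | hv
          · exact ⟨by omega, hc⟩
          · exact ⟨by have := (h2 v hv).1; omega, (h2 v hv).2⟩
    · rw [show (Nat.beq (get c.lab (4 * (n + k))) i &&
        Nat.beq (get c.lab (4 * (n + k) + 1)) j) = false by
          rw [← Bool.not_eq_true]; simpa [natBeq_eq] using hc] at h
      obtain ⟨V, h1, h2⟩ := ih m h
      exact ⟨V, h1, fun v hv => ⟨by have := (h2 v hv).1; omega, (h2 v hv).2⟩⟩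

/-- All ways to complete the circuit with label `l` from the stub `t`, with at most four crossings
with each other circuit; `n` is the number of the vertices which were there before. -/
noncomputable def search (n l : ℕ) (goal : Code → Bool) (k : ℕ) : Code → ℕ → Bool :=
  Nat.rec (fun _ _ => false) (fun _ ih c t =>
    Nat.beq (get c.p t) t && Nat.beq (get c.lab t) l && c.stepsAll t goal fun c' =>
      force (4 * c.n) fun x => !(c'.crossLE (get c'.lab x) l n 4) || ih c' (x + 3)) k

/-- Any two central circuits have at most four common vertices. -/
def FewCrossings {D : Type*} (M : CombMap D) : Prop :=
  ∀ (A B : M.CentralCircuit) (K : Finset D),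
    (∀ d ∈ K, M.circuit d = A ∧ M.circuit (M.rot d) = B) → K.card ≤ 8

variable {D : Type*} {M : CombMap D}

theorem Realizes.crossLE {S : Set D} {r : ℕ} {c : Code} {f : ℕ → D}
    {κ : ℕ → M.CentralCircuit} (hX : M.FewCrossings)
    (h : Realizes M S c.n r (get c.p) (get c.lab) f κ) (i j n : ℕ) : c.crossLE i j n 4 = true := by
  classical
  by_contra hc
  obtain ⟨V, hV, hV'⟩ := Code.exists_of_crossLE (Bool.eq_false_iff.2 hc)
  -- Each common vertex yields two darts of the circuit `j`, which is why four vertices correspond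
  -- to the bound 8 in `FewCrossings`.
  let W : Finset ℕ := V.image (fun v => 4 * v + 1) ∪ V.image (fun v => 4 * v + 3)
  have hW : W.card = V.card + V.card := by
    rw [Finset.card_union_of_disjoint, Finset.card_image_of_injective, Finset.card_image_of_injective]
    · intro a b; simp
    · intro a b; simp
    · rw [Finset.disjoint_left]
      intro x hx hx'
      obtain ⟨v, -, rfl⟩ := Finset.mem_image.1 hx
      obtain ⟨w, -, e⟩ := Finset.mem_image.1 hx'
      omega
  have hlt : ∀ x ∈ W, x < 4 * c.n ∧ M.circuit (f x) = κ j ∧ M.circuit (M.rot (f x)) = κ i := by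
    intro x hx
    have key (v : ℕ) (hv : v ∈ V) : M.circuit (f (4 * v + 1)) = κ j ∧
        M.circuit (M.rot (f (4 * v + 1))) = κ i := by
      obtain ⟨h1, h2, h3⟩ := hV' v hv
      refine ⟨by rw [h.circuit_f _ (by omega), h3], ?_⟩
      have h4 : nx (4 * v) = 4 * v + 1 := by unfold nx; omega
      rw [← h4, h.f_nx _ (by omega), circuit_rot_rot, h.circuit_f _ (by omega), h2]
    rcases Finset.mem_union.1 hx with hx | hx
    · obtain ⟨v, hv, rfl⟩ := Finset.mem_image.1 hx
      exact ⟨by have := (hV' v hv).1; omega, key v hv⟩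
    · obtain ⟨v, hv, rfl⟩ := Finset.mem_image.1 hx
      have h1 := (hV' v hv).1
      have h4 : 4 * v + 3 = nx (nx (4 * v + 1)) := by unfold nx; omega
      refine ⟨by omega, ?_⟩
      rw [h4, h.f_nx _ (nx_lt (by omega)), h.f_nx _ (by omega), circuit_rot_rot, circuit_rot_rot]
      exact key v hv
  have := hX (κ j) (κ i) (W.image f) (by
    intro d hd
    obtain ⟨x, hx, rfl⟩ := Finset.mem_image.1 hd
    exact (hlt x hx).2)
  rw [Finset.card_image_of_injOn, hW] at this
  · omega
  · intro x hx y hy e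
    exact h.f_inj _ (hlt x hx).1 _ (hlt y hy).1 e

/-- At each step the given map realizes one of the outcomes, and this outcome has passed the test.
As exhausted fuel counts as failure, a successful search must end with a code that satisfies `goal`.
-/
theorem Realizes.search [Finite D] (hM : M.IsTaut) (hX : M.FewCrossings) {r n l : ℕ}
    {κ : ℕ → M.CentralCircuit} {goal : Code → Bool} {k : ℕ} {c : Code} {t : ℕ} {S : Set D}
    {f : ℕ → D} (h : Realizes M S c.n r (get c.p) (get c.lab) f κ)
    (hn : 4 * (c.n + k + 1) ≤ 1024) (ht : t < 4 * c.n) (hs : search n l goal k c t = true) :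
    ∃ c' S' f', goal c' = true ∧ S ⊆ S' ∧ (∀ d ∈ S', d ∈ S ∨ M.circuit d = κ l) ∧
      Realizes M S' c'.n r (get c'.p) (get c'.lab) f' κ ∧ c.n ≤ c'.n ∧
      ∀ x < 4 * c.n, f' x = f x := by
  induction k generalizing c t S f with
  | zero => exact absurd hs (by simp [CombMap.search])
  | succ k ih =>
    have hs : (Nat.beq (get c.p t) t && Nat.beq (get c.lab t) l && c.stepsAll t goal fun c' =>
      force (4 * c.n) fun x => !(c'.crossLE (get c'.lab x) l n 4) ||
        CombMap.search n l goal k c' (x + 3)) = true := hs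
    rw [Bool.and_eq_true, Bool.and_eq_true, natBeq_eq, natBeq_eq, decide_eq_true_iff,
      decide_eq_true_iff] at hs
    obtain ⟨⟨hpt, hlt⟩, hs⟩ := hs
    have hc : M.circuit (f t) = κ l := by rw [h.circuit_f t ht, hlt]
    obtain ⟨S', hS1, hS2, hout⟩ := h.stepsAll hM (by omega) ht hpt hs
    rw [hc] at hS2
    rcases hout with ⟨s, hg, hR⟩ | ⟨p', lab', f', hQ, hf, hR⟩
    · exact ⟨_, S', f, hg, hS1, hS2, hR, le_rfl, fun _ _ => rfl⟩
    · rw [force_eq, hR.crossLE (c := ⟨c.n + 1, p', lab'⟩) hX] at hQ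
      obtain ⟨c', S'', f'', hg, hS3, hS4, hR', hle, hf'⟩ :=
        ih (c := ⟨c.n + 1, p', lab'⟩) hR (by dsimp only; omega) (by dsimp only; omega) hQ
      dsimp only at hle hf'
      refine ⟨c', S'', f'', hg, hS1.trans hS3, fun d hd => ?_, hR', by omega, fun x hx => ?_⟩
      · exact (hS4 d hd).elim (hS2 d) Or.inr
      · rw [hf' x (by omega), hf x hx]

/-! ### Isomorphisms of codes -/

/-- The dart that comes `k` darts after `b`. -/
def turn (b k : ℕ) : ℕ := 4 * (b / 4) + (b + k) % 4

/-- The image of `x`, given the images of the darts `4 * v`. -/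
def image (A x : ℕ) : ℕ := turn (get A (x / 4)) (x % 4)

theorem image_nx (A x : ℕ) : image A (nx x) = nx (image A x) := by
  have h1 : nx x / 4 = x / 4 := by unfold nx; omega
  have h2 : nx x % 4 = (x % 4 + 1) % 4 := by unfold nx; omega
  rw [image, image, h1, h2]
  unfold turn nx
  omega

theorem image_div (A x : ℕ) : image A x / 4 = get A (x / 4) / 4 := by
  unfold image turn; omega

theorem eq_of_image_eq {A x y : ℕ} (h : x / 4 = y / 4) (e : image A x = image A y) : x = y := by
  rw [image, image, h] at e
  unfold turn at e
  omega

/-- The images of all vertices of `H`, given the image `b` of the dart 0. -/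
noncomputable def Code.buildArr (H c : Code) (b : ℕ) : ℕ :=
  Nat.rec (motive := fun _ => ℕ → ℕ → ℕ) (fun A _ => A) (fun _ ih A v =>
    let next (k : ℕ) (e : ℕ) : ℕ :=
      force (get H.p (4 * v + k)) fun a => bif Nat.ble (4 * v) a then e else
        force (put A v (turn (get c.p (image A a)) (4 - k))) fun A => ih A (v + 1)
    next 0 (next 1 (next 2 (next 3 A)))) (H.n - 1) b 1

/-- The images of the labels. -/
noncomputable def Code.buildLab (H c : Code) (A : ℕ) : ℕ :=
  Nat.rec (motive := fun _ => ℕ → ℕ) (fun s => s)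
    (fun x ih s => force (put s (get H.lab x) (get c.lab (image A x))) ih) (4 * H.n) 0

/-- Check an isomorphism from `H` to `c`. -/
noncomputable def Code.isoBy (H c : Code) (r A : ℕ) : Bool :=
  allLt (4 * H.n) (fun x => Nat.beq (get c.p (image A x)) (image A (get H.p x))) &&
  allLt H.n (fun v => Nat.ble (get A v + 1) (4 * c.n) && allLt v fun w =>
    !(Nat.beq (get A v / 4) (get A w / 4))) &&
  force (H.buildLab c A) fun s =>
    allLt (4 * H.n) (fun x => Nat.beq (get c.lab (image A x)) (get s (get H.lab x))) &&
    allLt r fun i => Nat.ble (get s i + 1) r && allLt i fun j => !(Nat.beq (get s i) (get s j))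

/-- Whether the face on the left of `x` is a triangle. -/
noncomputable def isTri (P x : ℕ) : Bool :=
  force (pv (get P x)) fun y => force (pv (get P y)) fun y => Nat.beq (pv (get P y)) x

/-- Search for an isomorphism from `H` to `c`. -/
noncomputable def Code.iso (H c : Code) (r : ℕ) : Bool :=
  Nat.beq H.n c.n && anyLt (4 * c.n) fun b =>
    allLt 4 (fun k => bif isTri H.p k then isTri c.p (turn b k) else !(isTri c.p (turn b k))) &&
    force (H.buildArr c b) (H.isoBy c r)

/-- A code of `r` circuits without stubs. -/
noncomputable def Code.valid (c : Code) (r : ℕ) : Bool :=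
  Nat.ble 1 c.n && Nat.beq (get c.lab 0) 0 && Nat.ble (c.n + 4 * r + 3) 256 &&
  allLt (4 * c.n) fun x => Nat.ble (get c.p x + 1) (4 * c.n) && !(Nat.beq (get c.p x) x) &&
    Nat.ble (get c.lab x + 1) r

theorem Code.valid_iff {c : Code} {r : ℕ} : c.valid r = true ↔
    ((1 ≤ c.n ∧ get c.lab 0 = 0) ∧ c.n + 4 * r + 3 ≤ 256) ∧
    ∀ x < 4 * c.n, (get c.p x < 4 * c.n ∧ get c.p x ≠ x) ∧ get c.lab x < r := by
  simp only [Code.valid, allLt_iff, natBeq_eq, natBle_eq, Bool.and_eq_true, decide_eq_true_iff,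
    Bool.not_eq_true', decide_eq_false_iff_not]
  rfl

theorem Realizes.of_iso {H c : Code} {r : ℕ} (hH : H.valid r = true) (hi : H.iso c r = true)
    {S : Set D} {f : ℕ → D} {κ : ℕ → M.CentralCircuit}
    (h : Realizes M S c.n r (get c.p) (get c.lab) f κ) :
    ∃ f' κ', Realizes M S H.n r (get H.p) (get H.lab) f' κ' ∧
      ∀ i < r, ∃ j < r, κ' i = κ j := by
  rw [Code.valid_iff] at hH
  obtain ⟨-, hH⟩ := hH
  rw [Code.iso, Bool.and_eq_true, natBeq_eq, decide_eq_true_iff, anyLt_iff] at hi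
  obtain ⟨hn, b, -, hi⟩ := hi
  rw [Bool.and_eq_true, force_eq] at hi
  have hi := hi.2
  -- How the candidate was found is irrelevant; only the test `isoBy` is used. The same holds below
  -- for the map `s` of the labels.
  generalize H.buildArr c b = A at hi
  rw [Code.isoBy, Bool.and_eq_true, Bool.and_eq_true] at hi
  obtain ⟨⟨h1, h2⟩, hi⟩ := hi
  rw [force_eq] at hi
  generalize H.buildLab c A = s at hi
  simp only [allLt_iff, Bool.and_eq_true, natBeq_eq, natBle_eq, decide_eq_true_iff,
    Bool.not_eq_true', decide_eq_false_iff_not] at h1 h2 hi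
  obtain ⟨h3, h4⟩ := hi
  have hlt : ∀ x < 4 * H.n, image A x < 4 * c.n := by
    intro x hx
    have := (h2 (x / 4) (by omega)).1
    have := image_div A x
    omega
  have hinj : ∀ x < 4 * H.n, ∀ y < 4 * H.n, image A x = image A y → x = y := by
    intro x hx y hy e
    refine eq_of_image_eq ?_ e
    have e' : get A (x / 4) / 4 = get A (y / 4) / 4 := by rw [← image_div, ← image_div, e]
    rcases Nat.lt_trichotomy (x / 4) (y / 4) with h5 | h5 | h5
    · exact absurd e'.symm ((h2 (y / 4) (by omega)).2 _ h5)
    · exact h5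
    · exact absurd e' ((h2 (x / 4) (by omega)).2 _ h5)
  have hsurj : ∀ y < 4 * c.n, ∃ x < 4 * H.n, image A x = y := by
    have : (Finset.range (4 * H.n)).image (image A) = Finset.range (4 * c.n) := by
      refine Finset.eq_of_subset_of_card_le ?_ ?_
      · intro y hy
        obtain ⟨x, hx, rfl⟩ := Finset.mem_image.1 hy
        exact Finset.mem_range.2 (hlt x (Finset.mem_range.1 hx))
      · rw [Finset.card_image_of_injOn, Finset.card_range, Finset.card_range, hn]
        intro x hx y hy e
        exact hinj x (Finset.mem_range.1 hx) y (Finset.mem_range.1 hy) e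
    intro y hy
    have hy := this ▸ Finset.mem_range.2 hy
    obtain ⟨x, hx, e⟩ := Finset.mem_image.1 hy
    exact ⟨x, Finset.mem_range.1 hx, e⟩
  have hnamed : named H.n (fun x => f (image A x)) = named c.n f := by
    ext d
    constructor
    · rintro ⟨x, hx, rfl⟩
      exact ⟨_, hlt x hx, rfl⟩
    · rintro ⟨y, hy, rfl⟩
      obtain ⟨x, hx, rfl⟩ := hsurj y hy
      exact ⟨x, hx, rfl⟩
  refine ⟨fun x => f (image A x), fun i => κ (get s i), ?_, fun i hi => ⟨_, (h4 i hi).1, rfl⟩⟩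
  constructor
  · intro x hx
    rw [image_nx, h.f_nx _ (hlt x hx)]
  · intro x hx y hy e
    exact hinj x hx y hy (h.f_inj _ (hlt x hx) _ (hlt y hy) e)
  · exact fun x hx => (hH x hx).1.1
  · intro x hx
    refine hinj _ (hH _ (hH x hx).1.1).1.1 _ hx ?_
    rw [← h1 _ (hH x hx).1.1, ← h1 _ hx, h.p_p _ (hlt x hx)]
  · intro x hx
    refine iff_of_true ?_ (hH x hx).1.2
    rw [h.mem_iff _ (hlt x hx), h1 x hx]
    exact fun e => (hH x hx).1.2 (hinj _ (hH x hx).1.1 _ hx e)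
  · exact fun x hx e => absurd e (hH x hx).1.2
  · intro x hx _
    rw [hnamed, ← h1 x hx]
    refine h.seg _ (hlt x hx) ?_
    rw [h1 x hx]
    exact fun e => (hH x hx).1.2 (hinj _ (hH x hx).1.1 _ hx e)
  · exact h.edgeClosed
  · rw [hnamed]; exact h.straight
  · exact fun x hx => (hH x hx).2
  · intro x hx
    rw [h.circuit_f _ (hlt x hx), h3 x hx]
  · intro i hi j hj e
    have e := h.κ_inj _ (h4 i hi).1 _ (h4 j hj).1 e
    rcases Nat.lt_trichotomy i j with h5 | h5 | h5
    · exact absurd e.symm ((h4 j hj).2 i h5)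
    · exact h5
    · exact absurd e ((h4 i hi).2 j h5)

/-- Some element of a list. -/
noncomputable def anyOf (Q : Code → Bool) (l : List Code) : Bool :=
  List.rec false (fun H _ ih => Q H || ih) l

theorem anyOf_iff {Q : Code → Bool} {l : List Code} : anyOf Q l = true ↔ ∃ H ∈ l, Q H = true := by
  induction l with
  | nil => simp [anyOf]
  | cons H l ih =>
    rw [show anyOf Q (H :: l) = (Q H || anyOf Q l) from rfl, Bool.or_eq_true, ih]
    simp

/-- `c` has no stub, and is one of `l` if every circuit crosses the circuit `r`. -/
noncomputable def Code.complete (r : ℕ) (l : List Code) (c : Code) : Bool :=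
  allLt (4 * c.n) (fun x => !(Nat.beq (get c.p x) x)) &&
  (!(allLt r fun i => anyLt c.n fun v =>
    (Nat.beq (get c.lab (4 * v)) i && Nat.beq (get c.lab (4 * v + 1)) r) ||
    (Nat.beq (get c.lab (4 * v)) r && Nat.beq (get c.lab (4 * v + 1)) i)) ||
  anyOf (fun H => H.iso c (r + 1)) l)

/-- Without stubs, the code contains the new circuit entirely. Any two circuits cross, so the
alternative in `Code.complete` that some circuit misses the circuit `r` does not occur, and the
comparison with the list must have succeeded. -/
theorem Realizes.complete [Finite D] (hM : M.IsTaut) {c : Code} {r : ℕ} {l : List Code}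
    (hc : c.complete r l = true) {S S₀ : Set D} {f : ℕ → D} {κ : ℕ → M.CentralCircuit}
    (h : Realizes M S c.n (r + 1) (get c.p) (get c.lab) f κ) (hS : S₀ ⊆ S)
    (hS₀ : ∀ i < r, ∀ d, M.circuit d = κ i → d ∈ S₀) {d₀ : D} (hd₀ : d₀ ∈ S)
    (hd₀' : M.circuit d₀ = κ r) :
    (∀ i < r + 1, ∀ d, M.circuit d = κ i → d ∈ S) ∧ ∃ H ∈ l, H.iso c (r + 1) = true := by
  rw [Code.complete, Bool.and_eq_true, allLt_iff] at hc
  obtain ⟨h1, h2⟩ := hc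
  have hp : ∀ x < 4 * c.n, get c.p x ≠ x := by
    intro x hx
    have := h1 x hx
    simpa [natBeq_eq] using this
  have hr : ∀ d, M.circuit d = κ r → d ∈ S := fun d hd =>
    h.mem_of_circuit hp hd₀ (hd.trans hd₀'.symm)
  have hi : ∀ i < r, ∀ d, M.circuit d = κ i → d ∈ S := fun i hi d hd => hS (hS₀ i hi d hd)
  refine ⟨fun i hi' d hd => ?_, ?_⟩
  · rcases Nat.lt_succ_iff_lt_or_eq.1 hi' with h3 | rfl
    · exact hi i h3 d hd
    · exact hr d hd
  · rw [Bool.or_eq_true, anyOf_iff] at h2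
    refine h2.resolve_left ?_
    rw [Bool.not_eq_true', Bool.eq_false_iff, not_not, allLt_iff]
    intro i hir
    rw [anyLt_iff]
    obtain ⟨d, hd, hd'⟩ := hM.exists_crossing (A := κ i) (B := κ r) (fun e => by
      have := h.κ_inj i (by omega) r (by omega) e
      omega)
    obtain ⟨x, hx, rfl⟩ := h.mem_named_of_rot_mem (hi i hir d hd) (hr _ hd')
    rw [← h.f_nx x hx] at hd'
    have e1 := h.κ_inj _ (h.lab_lt x hx) i (by omega) ((h.circuit_f x hx).symm.trans hd)
    have e2 := h.κ_inj _ (h.lab_lt _ (nx_lt hx)) r (by omega)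
      ((h.circuit_f _ (nx_lt hx)).symm.trans hd')
    have e3 := h.lab_nx_nx hx
    have e4 := h.lab_nx_nx (nx_lt hx)
    rw [e1] at e3
    rw [e2] at e4
    refine ⟨x / 4, by omega, ?_⟩
    simp only [Bool.or_eq_true, Bool.and_eq_true, natBeq_eq, decide_eq_true_iff]
    -- Opposite darts have equal labels, so the labels at `4 * v` and `4 * v + 1` follow from those
    -- at `x` and `nx x`, in the order given by the parity of `k`.
    obtain ⟨v, k, hk, rfl⟩ : ∃ v k, k < 4 ∧ x = 4 * v + k :=
      ⟨x / 4, x % 4, Nat.mod_lt _ (by norm_num), by omega⟩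
    rw [show (4 * v + k) / 4 = v by omega]
    unfold nx at e2 e3 e4
    have hk' : k = 0 ∨ k = 1 ∨ k = 2 ∨ k = 3 := by omega
    rcases hk' with rfl | rfl | rfl | rfl
    · left; exact ⟨e1, by convert e2 using 2; omega⟩
    · right; exact ⟨by convert e4 using 2; omega, e1⟩
    · left; exact ⟨by convert e3 using 2; omega, by convert e4 using 2; omega⟩
    · right; exact ⟨by convert e2 using 2; omega, by convert e3 using 2; omega⟩

/-- All arrangements that arise from `c` by adding a circuit are in `l`. -/
noncomputable def Code.extend (c : Code) (r : ℕ) (l : List Code) : Bool :=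
  allLt (4 * c.n) fun x =>
    !(Nat.beq (get c.lab x) 0) || Nat.ble (get c.p x) x ||
    forceCode (c.n + 1) (splitP c.n c.p x) (labP c.n c.lab x r) fun c' =>
      search c.n r (Code.complete r l) (4 * r + 1) c' (4 * c.n + 1)

theorem Realizes.extend [Finite D] (hM : M.IsTaut) (hX : M.FewCrossings) {c : Code} {r : ℕ}
    {l : List Code} (hv : c.valid r = true) (hl : ∀ H ∈ l, H.valid (r + 1) = true)
    (hc : c.extend r l = true) {S : Set D} {f : ℕ → D} {κ : ℕ → M.CentralCircuit}
    (h : Realizes M S c.n r (get c.p) (get c.lab) f κ)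
    (hS : ∀ i < r, ∀ d, M.circuit d = κ i → d ∈ S) {C : M.CentralCircuit}
    (hC : ∀ i < r, κ i ≠ C) :
    ∃ H ∈ l, ∃ S' f' κ', Realizes M S' H.n (r + 1) (get H.p) (get H.lab) f' κ' ∧
      ∀ i < r + 1, ∀ d, M.circuit d = κ' i → d ∈ S' := by
  rw [Code.valid_iff] at hv
  obtain ⟨⟨⟨hn1, hl0⟩, hn2⟩, hv⟩ := hv
  have hr : 0 < r := hl0 ▸ (hv 0 (by omega)).2
  let κ' : ℕ → M.CentralCircuit := fun i => if i < r then κ i else C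
  have hκ : ∀ i < r, κ' i = κ i := fun i hi => if_pos hi
  have hκr : κ' r = C := if_neg (lt_irrefl r)
  have h' := h.relabel (κ' := κ') (r' := r + 1) (by omega) hκ (by
    intro i hi j hj e
    rcases Nat.lt_succ_iff_lt_or_eq.1 hi with h1 | rfl <;>
      rcases Nat.lt_succ_iff_lt_or_eq.1 hj with h2 | rfl
    · rw [hκ i h1, hκ j h2] at e
      exact h.κ_inj i h1 j h2 e
    · rw [hκ i h1, hκr] at e
      exact absurd e (hC i h1)
    · rw [hκ j h2, hκr] at e
      exact absurd e.symm (hC j h2)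
    · rfl)
  have hnot : ∀ d ∈ named c.n f, M.circuit (M.rot d) ≠ C := by
    rintro _ ⟨x, hx, rfl⟩ e
    rw [← h.f_nx x hx, h.circuit_f _ (nx_lt hx)] at e
    exact hC _ (h.lab_lt _ (nx_lt hx)) e
  -- a crossing on the walk from the dart 0
  obtain ⟨k, hk⟩ : ∃ k, M.circuit (M.rot ((M.str ^ k) (f 0))) = C := by
    obtain ⟨d, hd, hd'⟩ := hM.exists_crossing (hC 0 hr)
    have : M.circuit d = M.circuit (f 0) := by rw [hd, h.circuit_f 0 (by omega), hl0]
    obtain ⟨k, rfl | rfl⟩ := hM.circuit_eq_iff.1 this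
    · exact ⟨k, hd'⟩
    · exact ⟨k, by rwa [circuit_rot_rot] at hd'⟩
  obtain ⟨x, hx, j, i, hj, hij, e⟩ := h.exists_segment (X := {x | x < 4 * c.n ∧ get c.lab x = 0})
    (by
      rintro x ⟨hx, hx'⟩
      refine ⟨hx, (hv x hx).1.2, nx_lt (nx_lt (h.p_lt x hx)), ?_⟩
      rw [h.lab_nx_nx (h.p_lt x hx), h.lab_p hx, hx']) (x₀ := 0) ⟨by omega, hl0⟩ k
  rw [e] at hk
  obtain ⟨hx, hx0⟩ := hx
  -- choose the direction of the segment
  obtain ⟨x, hx, hx0, hxp, j, i, hj, hij, hk⟩ : ∃ x, x < 4 * c.n ∧ get c.lab x = 0 ∧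
      x < get c.p x ∧ ∃ j i, M.Straight (named c.n f) (f x) (f (get c.p x)) j ∧ i ≤ j ∧
      M.circuit (M.rot ((M.str ^ i) (f x))) = C := by
    rcases Nat.lt_or_ge x (get c.p x) with h1 | h1
    · exact ⟨x, hx, hx0, h1, j, i, hj, hij, hk⟩
    · have h2 : get c.p x < x := lt_of_le_of_ne h1 (hv x hx).1.2
      have hi : 1 ≤ i := by
        rcases Nat.eq_zero_or_pos i with rfl | h3
        · exact absurd hk (hnot _ ⟨x, hx, rfl⟩)
        · exact h3
      have hsym := hj.symm hM fun _ => h.rot_mem_named.1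
      refine ⟨get c.p x, h.p_lt x hx, by rw [h.lab_p hx, hx0], by rwa [h.p_p x hx], j, j + 1 - i,
        by rwa [h.p_p x hx], by omega, ?_⟩
      rw [hj.str_pow hM hi (by omega), circuit_rot_rot, hk]
  have hi : 1 ≤ i := by
    rcases Nat.eq_zero_or_pos i with rfl | h3
    · exact absurd hk (hnot _ ⟨x, hx, rfl⟩)
    · exact h3
  have hsub := h'.subdivide hM hx (hv x hx).1.2 hj hi hij (l := r) (by omega) (by rw [hk, hκr])
  have hsub' := hsub.mono_f (p' := get (splitP c.n c.p x)) (lab' := get (labP c.n c.lab x r))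
    (fun y hy => get_splitP (by omega) hx (h.p_lt x hx) hy)
    (fun y hy => get_labP (by omega) hy)
  rw [Code.extend, allLt_iff] at hc
  have hc := hc x hx
  rw [natBeq_eq, natBle_eq, forceCode_eq, hx0, decide_eq_true rfl, Bool.not_true, Bool.false_or,
    decide_eq_false (by omega), Bool.false_or] at hc
  -- The fuel is `4 * r + 1` because each of the `r` old circuits is crossed at most four times. The
  -- bound 256 in `valid` keeps all darts of the search below 1024.
  obtain ⟨c', S', f', hg, hS1, hS2, hR, hle, hf⟩ := Realizes.search hM hX
    (c := ⟨c.n + 1, splitP c.n c.p x, labP c.n c.lab x r⟩) hsub' (by dsimp only; omega)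
    (by dsimp only; omega) hc
  dsimp only at hle hf
  have hp : ∀ x < 4 * c'.n, get c'.p x ≠ x := by
    rw [Code.complete, Bool.and_eq_true, allLt_iff] at hg
    intro x hx
    simpa [natBeq_eq] using hg.1 x hx
  obtain ⟨hS', H, hH, hiso⟩ := hR.complete hM hg hS1
    (fun i hi d hd => hS i hi d (hd.trans (hκ i hi)))
    ((hR.mem_iff (4 * c.n + 1) (by omega)).2 (hp _ (by omega))) (by
      rw [hf _ (by omega), addVertex_add, hκr, ← hk]
      simp)
  obtain ⟨f'', κ'', h1, h2⟩ := Realizes.of_iso (hl H hH) hiso hR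
  refine ⟨H, hH, S', f'', κ'', h1, fun i hi d hd => ?_⟩
  obtain ⟨j, hj, e⟩ := h2 i hi
  exact hS' j hj d (hd.trans e)

end CombMap

namespace CombMap

/-! ### The codes of the hedrites, and the enumeration -/

/-- One circuit with one of its crossings. -/
def codeSingle : Code := ⟨1, 3221226498, 1073742848⟩

/-- The 4-hedrite with 2 vertices. -/
def code4_2 : Code :=
  ⟨2,
    3541775990258684400646,
    1180592746618391888896⟩

/-- The pure 4-hedrite with two central circuits and 4 vertices. -/
def code4_4 : Code :=
  ⟨4,
    4281758061192730710120514860918769074682467342,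
    1427249053836725640264714749733184380828910592⟩

/-- The code of the 5-hedrite 6-2. -/
def code5_6_2 : Code :=
  ⟨6,
    32810279781347606659919157449961322069717195977559612272288317839512582,
    3452561462681171581733473120721682666094091110786753901662353867408384⟩

/-- The code of the 6-hedrite 8-5. -/
def code6_8_5 : Code :=
  ⟨8,
    56368889382408914497056933609568871992300760927213211951028877194819839197528619430276910565382,
    4173890696041718292756740791971401457044981585779538959177789784731478447609145489286554977280⟩

/-- The code of the 6-hedrite 14-20. -/
def code6_14_20 : Code :=
  ⟨14,
    188133914595180431834675469100948278789293954314661335643083208459643743269954209722394564578515686979095993448033727404626275128201584706334477784157043500259345459206,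
    11063739354744694577679745160773372024584427276599323171521903612089224916755637740283591826162010159088178582475465514046596980223458445953985752594084174033984685056⟩

/-- The code of the 8-hedrite 6-1. -/
def code8_6_1 : Code :=
  ⟨6,
    12096615757614174572870726994124417356068103505091865668576948829308934,
    3452561462681171581733473120721682664796015658214188301896072204125184⟩

/-- The code of the 8-hedrite 12-4. -/
def code8_12_4 : Code :=
  ⟨12,
    33638721261658552652840000096319550886137320349745167997743913898309897550334591622320317474010090596303272976261650742379746774252696461404166,
    9151710696584755615255971086285619381903416060976071498084533305750978881966545664773663594331530118238067262258178119189099300696782889026560⟩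

/-- The code of the 8-hedrite 12-5. -/
def code8_12_5 : Code :=
  ⟨12,
    94610372634973413206905887952964075668372455166142952856277085693547956980615459303449386109040068596857272602742912719497723614944925723944966,
    9151710696584755615255971086285619381903416060976071498084533305750978881966545664773663594331532972736174930517156838321252811520711837352960⟩

/-- The code of the 8-hedrite 14-7. -/
def code8_14_7 : Code :=
  ⟨14,
    40666718672005092536004030076038886304021106136827045403877762150008407324966783851443111416275823284284223445750902987522295668609477593741572749519053850045604456454,
    11063739354744694577679745160773372024584427276599323171521901318588421675959343117540221161247265598598489383076859482733227819891358604665061388109138091975515309056⟩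

/-- The code of the 8-hedrite 20-1. -/
def code8_20_1 : Code :=
  ⟨20,
    280431013945252143881141342404256709766915477618517531240195627174852084611826595028571752870823542843534316921823275614411319390070094019003076541323051246235990699038799339092727277424772587212945847014250020977917821349927650790884804614,
    26066033579261876994448000843669535743516224970162693025170657360147335586782894260164405574217198788114691305206669738369317347406172374313649479148797050823442428398590997325569719448788907566722443073618780670780850067745259570642027520⟩

/-- The code of the 8-hedrite 22-1. -/
def code8_22_1 : Code :=
  ⟨22,
    118444884378683001119230150880466850811333745017414896625748543419982883228014490758379242949259368550164252422637171696071938684310500042835444545773770132416490356316275556251781671208306203646310205148469501987828139887996643930605173072651403544182338149713926,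
    31511901008911610767675506194861017233523025142305959654798728761514752588540498632360164748587796658797728025449532463254279223365952457733089530528264393832276815339533487162040483174221758352679937791024817435223802350908125918008192431498137797602444513903616⟩

/-- The code of the 8-hedrite 30-1. -/
def code8_30_1 : Code :=
  ⟨30,
    926251065635841340065687286395545474603370465837245044456747053584340937419315140182717486229039501828937322225027306596465519212878667605077938285035089667804159647014996615976432134462767987085678470129904322748563202369782352370942672444480868099084565150067377241585873690727649280549430164884148256625865788655143524558969638226180495107483390396111824902,
    84140370249644122897243633789028836106748694332808585056471511429994617169394993603704551811296195683812185280930308782945069293569222302651694014944316435472775718761347934962881026174564102347326927056968076804640186633417043568938786542595133494206215312539346912381814720739663793410129792707539195448941740510061482672029918405467017229463976505860162560⟩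

/-- The code of the 8-hedrite 32-1. -/
def code8_32_1 : Code :=
  ⟨32,
    672988369794126359138376185813967773421919771316445378648262219231828629313547082588363472374975413091807391680256127502720722502030076617792524178463126661229368442879953904626289718568711480356814624032020079128871655812507499102483638671062264252146940169111587055471672653876472733272554491294199342642072525609331353695579167184863088909616009031611806042905298443465846761236486,
    101719466066729382058097747157700408478526364455758882246128494133272318690667390552261053396898989295222324492315028851409881168285791838044304159260231902378352340882802698969952953564929434755539155999157715195092602297768937027955040663020301933810680569636767637776746778301365918560985521789482721314690347225143390658221754447769428845943784826705144776734373036720906378937344⟩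

/-- The code of the mirror image of the 8-hedrite 30-1. -/
def code8_30_1_mirror : Code :=
  ⟨30,
    1834223046457932211505706711940546035294846310615375579747050381045750788965150066565286309238895259577431730976265328020023919431748613087958670967507685920749416779739853849308787748701591712806914858536911775244946309217203398560240520528829187011976224579379757751302673538843138354950705972527376279244449851115200558946887683378557905899686062206184656902,
    84140370249644122897243633789028836106748694332808585056471511429994617169394993603704551811296195683812185280930308782945069293569222302651694014944316435472775718761347934962881026174564102347326927056968076804640186633417043568938786542595133494206215312539346912381814720739663793410129792707539195448941740510061482672029918405467017229463976505860162560⟩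

/-- The codes of `r` circuits. -/
def codes : ℕ → List Code
  | 2 => [code4_2, code4_4]
  | 3 => [code5_6_2, code6_8_5, code8_6_1]
  | 4 => [code6_14_20, code8_12_4, code8_12_5, code8_14_7]
  | 5 => [code8_20_1, code8_22_1]
  | 6 => [code8_30_1, code8_32_1, code8_30_1_mirror]
  | _ => []

set_option maxRecDepth 10000

/-- The second circuit closes up after two or four crossings with the first one, in one way each up
to isomorphism. -/
theorem search_codeSingle :
    search 0 1 (Code.complete 1 (codes 2)) 16 codeSingle 1 = true := by
  decide +kernel

theorem code4_2_valid : code4_2.valid 2 = true := by decide +kernel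

theorem code4_4_valid : code4_4.valid 2 = true := by decide +kernel

theorem code5_6_2_valid : code5_6_2.valid 3 = true := by decide +kernel

theorem code6_8_5_valid : code6_8_5.valid 3 = true := by decide +kernel

theorem code8_6_1_valid : code8_6_1.valid 3 = true := by decide +kernel

theorem code6_14_20_valid : code6_14_20.valid 4 = true := by decide +kernel

theorem code8_12_4_valid : code8_12_4.valid 4 = true := by decide +kernel

theorem code8_12_5_valid : code8_12_5.valid 4 = true := by decide +kernel

theorem code8_14_7_valid : code8_14_7.valid 4 = true := by decide +kernel

theorem code8_20_1_valid : code8_20_1.valid 5 = true := by decide +kernel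

theorem code8_22_1_valid : code8_22_1.valid 5 = true := by decide +kernel

theorem code8_30_1_valid : code8_30_1.valid 6 = true := by decide +kernel

theorem code8_32_1_valid : code8_32_1.valid 6 = true := by decide +kernel

theorem code8_30_1_mirror_valid : code8_30_1_mirror.valid 6 = true := by decide +kernel

/-- Here and below, one more circuit is added to a listed arrangement in all possible ways, and the
results are recognized up to orientation-preserving isomorphism. -/
theorem code4_2_extend : code4_2.extend 2 (codes 3) = true := by decide +kernel

theorem code4_4_extend : code4_4.extend 2 (codes 3) = true := by decide +kernel

theorem code5_6_2_extend : code5_6_2.extend 3 (codes 4) = true := by decide +kernel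

theorem code6_8_5_extend : code6_8_5.extend 3 (codes 4) = true := by decide +kernel

theorem code8_6_1_extend : code8_6_1.extend 3 (codes 4) = true := by decide +kernel

theorem code6_14_20_extend : code6_14_20.extend 4 (codes 5) = true := by decide +kernel

theorem code8_12_4_extend : code8_12_4.extend 4 (codes 5) = true := by decide +kernel

theorem code8_12_5_extend : code8_12_5.extend 4 (codes 5) = true := by decide +kernel

theorem code8_14_7_extend : code8_14_7.extend 4 (codes 5) = true := by decide +kernel

theorem code8_20_1_extend : code8_20_1.extend 5 (codes 6) = true := by decide +kernel

theorem code8_22_1_extend : code8_22_1.extend 5 (codes 6) = true := by decide +kernel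

/-- Since `codes 7` is empty, this evaluation and the next two show that no circuit can be added to
six. -/
theorem code8_30_1_extend : code8_30_1.extend 6 (codes 7) = true := by decide +kernel

theorem code8_32_1_extend : code8_32_1.extend 6 (codes 7) = true := by decide +kernel

theorem code8_30_1_mirror_extend : code8_30_1_mirror.extend 6 (codes 7) = true := by decide +kernel

theorem valid_of_mem_codes {r : ℕ} {H : Code} (hH : H ∈ codes r) : H.valid r = true := by
  match r with
  | 2 =>
    simp only [codes, List.mem_cons, List.not_mem_nil, or_false] at hH
    rcases hH with rfl | rfl
    · exact code4_2_valid
    · exact code4_4_valid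
  | 3 =>
    simp only [codes, List.mem_cons, List.not_mem_nil, or_false] at hH
    rcases hH with rfl | rfl | rfl
    · exact code5_6_2_valid
    · exact code6_8_5_valid
    · exact code8_6_1_valid
  | 4 =>
    simp only [codes, List.mem_cons, List.not_mem_nil, or_false] at hH
    rcases hH with rfl | rfl | rfl | rfl
    · exact code6_14_20_valid
    · exact code8_12_4_valid
    · exact code8_12_5_valid
    · exact code8_14_7_valid
  | 5 =>
    simp only [codes, List.mem_cons, List.not_mem_nil, or_false] at hH
    rcases hH with rfl | rfl
    · exact code8_20_1_valid
    · exact code8_22_1_valid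
  | 6 =>
    simp only [codes, List.mem_cons, List.not_mem_nil, or_false] at hH
    rcases hH with rfl | rfl | rfl
    · exact code8_30_1_valid
    · exact code8_32_1_valid
    · exact code8_30_1_mirror_valid
  | 0 | 1 | (n + 7) => exact absurd hH (by simp [codes])

theorem extend_of_mem_codes {r : ℕ} {H : Code} (hH : H ∈ codes r) :
    H.extend r (codes (r + 1)) = true := by
  match r with
  | 2 =>
    simp only [codes, List.mem_cons, List.not_mem_nil, or_false] at hH
    rcases hH with rfl | rfl
    · exact code4_2_extend
    · exact code4_4_extend
  | 3 =>
    simp only [codes, List.mem_cons, List.not_mem_nil, or_false] at hH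
    rcases hH with rfl | rfl | rfl
    · exact code5_6_2_extend
    · exact code6_8_5_extend
    · exact code8_6_1_extend
  | 4 =>
    simp only [codes, List.mem_cons, List.not_mem_nil, or_false] at hH
    rcases hH with rfl | rfl | rfl | rfl
    · exact code6_14_20_extend
    · exact code8_12_4_extend
    · exact code8_12_5_extend
    · exact code8_14_7_extend
  | 5 =>
    simp only [codes, List.mem_cons, List.not_mem_nil, or_false] at hH
    rcases hH with rfl | rfl
    · exact code8_20_1_extend
    · exact code8_22_1_extend
  | 6 =>
    simp only [codes, List.mem_cons, List.not_mem_nil, or_false] at hH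
    rcases hH with rfl | rfl | rfl
    · exact code8_30_1_extend
    · exact code8_32_1_extend
    · exact code8_30_1_mirror_extend
  | 0 | 1 | (n + 7) => exact absurd hH (by simp [codes])

end CombMap

/-! ### From the enumeration to isomorphisms of maps -/

namespace CombMap

variable {D : Type*} {M : CombMap D}

theorem get_codeSingle_p : get codeSingle.p 0 = 2 ∧ get codeSingle.p 1 = 1 ∧
    get codeSingle.p 2 = 0 ∧ get codeSingle.p 3 = 3 := by decide +kernel

theorem get_codeSingle_lab : get codeSingle.lab 0 = 0 ∧ get codeSingle.lab 1 = 1 ∧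
    get codeSingle.lab 2 = 0 ∧ get codeSingle.lab 3 = 1 := by decide +kernel

/-- `r` of the central circuits form one of the listed arrangements. -/
def HasCode (M : CombMap D) (r : ℕ) : Prop :=
  ∃ H ∈ codes r, ∃ (S : Set D) (f : ℕ → D) (κ : ℕ → M.CentralCircuit),
    Realizes M S H.n r (get H.p) (get H.lab) f κ ∧
    ∀ i < r, ∀ d, M.circuit d = κ i → d ∈ S

/-- The first circuit is drawn with a single one of its crossings, and the search then draws the
second circuit from the stub at this crossing. -/
theorem IsTaut.hasCode_two [Finite D] (hM : M.IsTaut) (hX : M.FewCrossings)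
    {A B : M.CentralCircuit} (hAB : A ≠ B) : M.HasCode 2 := by
  obtain ⟨d, hd, hd'⟩ := hM.exists_crossing hAB
  let κ : ℕ → M.CentralCircuit := fun i => if i = 0 then A else B
  obtain ⟨p0, p1, p2, p3⟩ := get_codeSingle_p
  obtain ⟨l0, l1, l2, l3⟩ := get_codeSingle_lab
  have h := hM.realizes_single (κ := κ) hd hd' hAB p0 p1 p2 p3 l0 l1 l2 l3
  obtain ⟨c', S', f', hg, hS1, -, hR, hle, hf⟩ := Realizes.search hM hX (c := codeSingle) h
    (by norm_num [codeSingle]) (by norm_num [codeSingle]) search_codeSingle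
  have hp : ∀ x < 4 * c'.n, get c'.p x ≠ x := by
    rw [Code.complete, Bool.and_eq_true, allLt_iff] at hg
    intro x hx
    simpa [natBeq_eq] using hg.1 x hx
  have hn : codeSingle.n = 1 := rfl
  rw [hn] at hle hf
  obtain ⟨hS', H, hH, hiso⟩ := hR.complete hM hg hS1
    (fun i hi d hd => by rwa [Nat.lt_one_iff.1 hi] at hd)
    ((hR.mem_iff 1 (by omega)).2 (hp _ (by omega))) (by rw [hf _ (by omega), pow_one]; exact hd')
  obtain ⟨f'', κ'', h1, h2⟩ := Realizes.of_iso (valid_of_mem_codes hH) hiso hR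
  refine ⟨H, hH, S', f'', κ'', h1, fun i hi d hd => ?_⟩
  obtain ⟨j, hj, e⟩ := h2 i hi
  exact hS' j hj d (hd.trans e)

/-- All central circuits together form one of the listed arrangements. -/
theorem IsTaut.exists_code_of_hasCode [Finite D] (hM : M.IsTaut) (hX : M.FewCrossings) {r : ℕ}
    (h : M.HasCode r) : ∃ r' ≥ r, ∃ H ∈ codes r', ∃ (f : ℕ → D) (κ : ℕ → M.CentralCircuit),
      Realizes M Set.univ H.n r' (get H.p) (get H.lab) f κ ∧ ∀ C, ∃ i < r', κ i = C := by
  -- As long as some circuit is missing it can be added, and `codes r` is empty from `r = 7` on.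
  induction hm : 7 - r generalizing r with
  | zero =>
    obtain ⟨H, hH, -⟩ := h
    match r with
    | 0 | 1 | 2 | 3 | 4 | 5 | 6 => omega
    | n + 7 => exact absurd hH (by simp [codes])
  | succ m ih =>
    obtain ⟨H, hH, S, f, κ, hR, hS⟩ := h
    by_cases hall : ∀ C, ∃ i < r, κ i = C
    · have : S = Set.univ := Set.eq_univ_iff_forall.2 fun d => by
        obtain ⟨i, hi, e⟩ := hall (M.circuit d)
        exact hS i hi d e.symm
      exact ⟨r, le_rfl, H, hH, f, κ, this ▸ hR, hall⟩
    · push Not at hall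
      obtain ⟨C, hC⟩ := hall
      obtain ⟨r', hr', h'⟩ := ih (r := r + 1) (hR.extend hM hX (valid_of_mem_codes hH)
        (fun _ => valid_of_mem_codes) (extend_of_mem_codes hH) hS hC) (by omega)
      exact ⟨r', by omega, h'⟩

/-- The dart `x` of a code, as a dart of a listed map. -/
def Code.dart {n : ℕ} (x : Fin n × Fin 4) : ℕ := 4 * x.1 + x.2

theorem Code.dart_lt {n : ℕ} (x : Fin n × Fin 4) : Code.dart x < 4 * n := by
  unfold Code.dart; omega

/-- At an interior vertex of a segment `S` would go straight on without its other two darts. If `S`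
contains all darts, there is no such vertex and each segment is a single edge. -/
theorem Realizes.edge_f {n r : ℕ} {p lab : ℕ → ℕ} {f : ℕ → D}
    {κ : ℕ → M.CentralCircuit} (h : Realizes M Set.univ n r p lab f κ) {x : ℕ} (hx : x < 4 * n) :
    M.edge (f x) = f (p x) := by
  obtain ⟨j, hj⟩ := h.seg x hx ((h.mem_iff x hx).1 (Set.mem_univ _))
  rcases Nat.eq_zero_or_pos j with rfl | hj0
  · exact hj.1
  · refine absurd (h.mem_named_of_rot_mem (Set.mem_univ _) (Set.mem_univ _)) (hj.2 1 le_rfl hj0)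

/-- A map that is completely described by a code. -/
theorem Realizes.exists_equiv {n r : ℕ} {p lab : ℕ → ℕ} {f : ℕ → D}
    {κ : ℕ → M.CentralCircuit} (h : Realizes M Set.univ n r p lab f κ) :
    ∃ e : (Fin n × Fin 4) ≃ D, ∀ x, e x = f (Code.dart x) := by
  refine ⟨Equiv.ofBijective (fun x => f (Code.dart x)) ⟨?_, ?_⟩, fun _ => rfl⟩
  · intro x y e
    have := h.f_inj _ (Code.dart_lt x) _ (Code.dart_lt y) e
    unfold Code.dart at this
    ext <;> omega
  · intro d
    obtain ⟨x, hx, rfl⟩ := h.mem_named_of_rot_mem (Set.mem_univ d) (Set.mem_univ _)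
    refine ⟨(⟨x / 4, by omega⟩, ⟨x % 4, Nat.mod_lt _ (by norm_num)⟩), ?_⟩
    exact congrArg f (Nat.div_add_mod x 4)

theorem Realizes.iso {n r : ℕ} {p lab : ℕ → ℕ} {f : ℕ → D}
    {κ : ℕ → M.CentralCircuit} (h : Realizes M Set.univ n r p lab f κ)
    (N : CombMap (Fin n × Fin 4)) (hrot : ∀ x, N.rot x = (x.1, x.2 + 1))
    (hedge : ∀ x, Code.dart (N.edge x) = p (Code.dart x)) : M.Iso N := by
  obtain ⟨e, he⟩ := h.exists_equiv
  have hnx (x : Fin n × Fin 4) : Code.dart (x.1, x.2 + 1) = nx (Code.dart x) := by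
    unfold Code.dart nx
    rw [Fin.val_add]
    simp only [Fin.val_one]
    omega
  refine ⟨e.symm, fun d => ?_, Or.inl fun d => ?_⟩
  · obtain ⟨x, rfl⟩ := e.surjective d
    rw [Equiv.symm_apply_apply, Equiv.symm_apply_eq, he, he, h.edge_f (Code.dart_lt x), hedge]
  · obtain ⟨x, rfl⟩ := e.surjective d
    rw [Equiv.symm_apply_apply, Equiv.symm_apply_eq, he, he, ← h.f_nx _ (Code.dart_lt x), hrot,
      hnx]

/-- Codes are compared only up to orientation-preserving isomorphism, so the chiral 30-1 appears in
the enumeration together with its mirror image. Negation of the second coordinate reverses the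
rotation. -/
theorem Realizes.iso_of_mirror {n r : ℕ} {p lab : ℕ → ℕ} {f : ℕ → D}
    {κ : ℕ → M.CentralCircuit} (h : Realizes M Set.univ n r p lab f κ)
    (N : CombMap (Fin n × Fin 4)) (hrot : ∀ x, N.rot x = (x.1, x.2 + 1))
    (hedge : ∀ x, Code.dart ((N.edge (x.1, -x.2)).1, -(N.edge (x.1, -x.2)).2) = p (Code.dart x)) :
    M.Iso N := by
  obtain ⟨e, he⟩ := h.exists_equiv
  have hnx (x : Fin n × Fin 4) : Code.dart (x.1, x.2 + 1) = nx (Code.dart x) := by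
    unfold Code.dart nx
    rw [Fin.val_add]
    simp only [Fin.val_one]
    omega
  let m : (Fin n × Fin 4) ≃ (Fin n × Fin 4) := Equiv.prodCongr (Equiv.refl _) (Equiv.neg _)
  have hm (x : Fin n × Fin 4) : m x = (x.1, -x.2) := rfl
  have hmm (x : Fin n × Fin 4) : m (m x) = x := by simp [hm]
  refine ⟨e.symm.trans m, fun d => ?_, Or.inr fun d => ?_⟩
  · obtain ⟨x, rfl⟩ := e.surjective d
    rw [Equiv.trans_apply, Equiv.trans_apply, Equiv.symm_apply_apply]
    have : M.edge (e x) = e (m (N.edge (m x))) := by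
      rw [he, he, h.edge_f (Code.dart_lt x), ← hedge]; rfl
    rw [this, Equiv.symm_apply_apply, hmm]
  · obtain ⟨x, rfl⟩ := e.surjective d
    rw [Equiv.trans_apply, Equiv.trans_apply, Equiv.symm_apply_apply]
    have : M.rot (e x) = e (x.1, x.2 + 1) := by
      rw [he, he, ← h.f_nx _ (Code.dart_lt x), hnx]
    rw [this, Equiv.symm_apply_apply, Equiv.eq_symm_apply, hrot, hm, hm]
    simp

end CombMap

namespace CombMap

/-! ### Two circuits have at most four common vertices, if there is a third one -/

variable {D : Type*} {M : CombMap D}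

/-- The first `m` steps from `c` do not lead to vertices of the circuit `A`. -/
def Avoids (M : CombMap D) (A : M.CentralCircuit) (c : D) (m : ℕ) : Prop :=
  ∀ i, 1 ≤ i → i ≤ m → M.circuit (M.rot ((M.str ^ i) c)) ≠ A

theorem Avoids.add {A : M.CentralCircuit} {c : D} {i j : ℕ} (h : M.Avoids A c i)
    (h' : M.Avoids A ((M.str ^ i) c) j) : M.Avoids A c (i + j) := by
  intro k h1 h2
  rcases Nat.lt_or_ge i k with h3 | h3
  · obtain ⟨l, rfl⟩ := Nat.exists_eq_add_of_le h3.le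
    rw [str_pow_add]
    exact h' l (by omega) (by omega)
  · exact h k h1 h3

/-- The walks from `b` and `c` cross before they reach the circuit `A`. -/
def ArcsCross (M : CombMap D) (A : M.CentralCircuit) (b c : D) : Prop :=
  ∃ m i, 1 ≤ m ∧ 1 ≤ i ∧ M.Avoids A b m ∧ M.Avoids A c i ∧
    ((M.str ^ m) b = M.rot ((M.str ^ i) c) ∨ (M.str ^ i) c = M.rot ((M.str ^ m) b))

theorem ArcsCross.symm {A : M.CentralCircuit} {b c : D} (h : M.ArcsCross A b c) :
    M.ArcsCross A c b := by
  obtain ⟨m, i, h1, h2, h3, h4, h5⟩ := h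
  exact ⟨i, m, h2, h1, h4, h3, h5.symm⟩

/-- The next vertex of a code, straight on. -/
def ahead (P x : ℕ) : ℕ := nx (nx (get P x))

/-- In the code, the walks from the darts 13 and 1 cross before they reach the circuit 0. -/
def Code.crossed (c : Code) : Bool :=
  decide (get c.p 13 ≠ 13 ∧ get c.p 1 ≠ 1 ∧ get c.lab (nx (ahead c.p 13)) ≠ 0 ∧
    get c.lab (nx (ahead c.p 1)) ≠ 0 ∧
    ((ahead c.p 13 = nx (ahead c.p 1) ∨ ahead c.p 1 = nx (ahead c.p 13)) ∨
      (get c.p (ahead c.p 1) ≠ ahead c.p 1 ∧ get c.lab (nx (ahead c.p (ahead c.p 1))) ≠ 0 ∧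
        (ahead c.p 13 = nx (ahead c.p (ahead c.p 1)) ∨
          ahead c.p (ahead c.p 1) = nx (ahead c.p 13)))))

/-- There is no way to continue from the stub `s`. -/
noncomputable def Code.noWay (c : Code) (s : ℕ) : Bool :=
  Nat.beq (get c.p s) s && c.stepsAll s (fun _ => false) (fun _ => false)

/-- Inside a segment the walk does not meet the circuit 0: this circuit lies in `S`, and at a vertex
without a name `S` goes straight on. -/
theorem Realizes.reach {S : Set D} {n r : ℕ} {p lab : ℕ → ℕ} {f : ℕ → D}
    {κ : ℕ → M.CentralCircuit} (h : Realizes M S n r p lab f κ)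
    (hA : ∀ d, M.circuit d = κ 0 → d ∈ S) (hr : 0 < r) {x : ℕ} (hx : x < 4 * n) (hp : p x ≠ x)
    (hl : lab (nx (nx (nx (p x)))) ≠ 0) :
    ∃ m, 1 ≤ m ∧ (M.str ^ m) (f x) = f (nx (nx (p x))) ∧ M.Avoids (κ 0) (f x) m := by
  obtain ⟨j, hj⟩ := h.seg x hx hp
  have hpx := h.p_lt x hx
  have e : (M.str ^ (j + 1)) (f x) = f (nx (nx (p x))) := by
    rw [str_pow_succ, str_apply, hj.1, ← h.f_nx _ hpx, ← h.f_nx _ (nx_lt hpx)]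
  refine ⟨j + 1, by omega, e, fun i h1 h2 => ?_⟩
  rcases Nat.lt_or_ge j i with h3 | h3
  · obtain rfl : i = j + 1 := by omega
    rw [e, ← h.f_nx _ (nx_lt (nx_lt hpx)), h.circuit_f _ (nx_lt (nx_lt (nx_lt hpx)))]
    exact fun e' => hl (h.κ_inj _ (h.lab_lt _ (nx_lt (nx_lt (nx_lt hpx)))) 0 hr e')
  · exact fun e' => (h.straight _ (h.interior_mem hx hp hj h3) (hj.2 i h1 h3)).2 (hA _ e')

/-- The crossing is at the end of the first segment from 13, and of the first or the second segment
from 1, since the arc from 1 may already be divided. -/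
theorem Realizes.arcsCross {S : Set D} {r : ℕ} {c : Code} {f : ℕ → D}
    {κ : ℕ → M.CentralCircuit} (h : Realizes M S c.n r (get c.p) (get c.lab) f κ)
    (hA : ∀ d, M.circuit d = κ 0 → d ∈ S) (hr : 0 < r) (hn : 4 ≤ c.n) (hc : c.crossed = true) :
    M.ArcsCross (κ 0) (f 13) (f 1) := by
  rw [Code.crossed, decide_eq_true_iff] at hc
  obtain ⟨p13, p1, l13, l1, hc⟩ := hc
  have hlt {x : ℕ} (hx : x < 4 * c.n) : ahead c.p x < 4 * c.n := nx_lt (nx_lt (h.p_lt x hx))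
  obtain ⟨m, hm, em, am⟩ := h.reach hA hr (x := 13) (by omega) p13 l13
  replace em : (M.str ^ m) (f 13) = f (ahead c.p 13) := em
  obtain ⟨i, hi, ei, ai⟩ := h.reach hA hr (x := 1) (by omega) p1 l1
  have key {i v : ℕ} (hv : v < 4 * c.n) (hi : 1 ≤ i) (ei : (M.str ^ i) (f 1) = f v)
      (ai : M.Avoids (κ 0) (f 1) i) (h' : ahead c.p 13 = nx v ∨ v = nx (ahead c.p 13)) :
      M.ArcsCross (κ 0) (f 13) (f 1) := by
    refine ⟨m, i, hm, hi, am, ai, ?_⟩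
    rw [em, ei, ← h.f_nx _ hv, ← h.f_nx _ (hlt (x := 13) (by omega))]
    exact h'.imp (congrArg f) (congrArg f)
  rcases hc with hc | ⟨pv, lv, hc⟩
  · exact key (hlt (by omega)) hi ei ai hc
  · obtain ⟨j, hj, ej, aj⟩ := h.reach hA hr (x := ahead c.p 1) (hlt (by omega)) pv lv
    have ei' : (M.str ^ i) (f 1) = f (ahead c.p 1) := ei
    refine key (i := i + j) (hlt (hlt (by omega))) (by omega) ?_ (ai.add ?_) hc
    · rw [str_pow_add, ei', ej]; rfl
    · rw [ei']; exact aj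

/-- In a taut map every stub is continued by an actual walk, so a code with a stub that has no
continuation is not realized. -/
theorem Realizes.not_noWay [Finite D] (hM : M.IsTaut) {S : Set D} {r : ℕ} {c : Code} {f : ℕ → D}
    {κ : ℕ → M.CentralCircuit} (h : Realizes M S c.n r (get c.p) (get c.lab) f κ)
    (hn : 4 * (c.n + 1) ≤ 1024) {s : ℕ} (hs : s < 4 * c.n) : c.noWay s = false := by
  rw [← Bool.not_eq_true]
  intro hc
  rw [Code.noWay, Bool.and_eq_true, natBeq_eq, decide_eq_true_iff] at hc
  obtain ⟨S', -, -, ⟨_, h', -⟩ | ⟨_, _, _, h', -⟩⟩ := h.stepsAll hM hn hs hc.1 hc.2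
  · exact absurd h' (by simp)
  · exact absurd h' (by simp)

/-- A circuit with an arc of another one on its left. -/
def codeArc : Code := ⟨2, 8264142473124034647046, 1180592746618391888896⟩

/-- A third circuit crosses this arc. -/
def codeArcCrossed : Code :=
  ⟨3, 14280095159084251024710404956760070, 2597418556957827026788542232658944⟩

/-- The third circuit starts again on the left, from the segment 0. -/
def codeArcs₀ : Code :=
  ⟨4, 21408733093262126174542969139504624319609186318,
    2854498107673452548181237472922638269143843840⟩

/-- The third circuit starts again on the left, from the segment 4. -/
def codeArcs₄ : Code :=
  ⟨4, 21414308274244846847188689563622513307730061318,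
    2854498107673452548181237472922638269143843840⟩

/-- A circuit that enters one side of the circuit 0 must leave it again through the circuit 0, which
yields a single picture. -/
theorem stepsAll_codeSingle : codeSingle.stepsAll 1 (fun _ => false)
    (fun c => c.p == codeArc.p && c.lab == codeArc.lab) = true := by decide +kernel

/-- Suppose that the third circuit returned from 13 to the circuit 0 without crossing the arc. Then
the region next to the arc would be a quadrangle with the stub 11 on one side and the third circuit
itself on the opposite side; every continuation from 11 would cross its own circuit or leave a
region with more than four corners. -/
theorem stepsAll_codeArcs₀ : codeArcs₀.stepsAll 13 Code.crossed
    (fun c => c.crossed || c.noWay 11) = true := by decide +kernel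

theorem stepsAll_codeArcs₄ : codeArcs₄.stepsAll 13 Code.crossed
    (fun c => c.crossed || c.noWay 9) = true := by decide +kernel

theorem codeArcCrossed_eq : ∀ x < 12, get codeArcCrossed.p x = splitF 2 (get codeArc.p) 1 x ∧
    get codeArcCrossed.lab x = labF 2 (get codeArc.lab) 1 2 x := by decide +kernel

theorem codeArcs₀_eq : ∀ x < 16, get codeArcs₀.p x = splitF 3 (get codeArcCrossed.p) 0 x ∧
    get codeArcs₀.lab x = labF 3 (get codeArcCrossed.lab) 0 2 x := by decide +kernel

theorem codeArcs₄_eq : ∀ x < 16, get codeArcs₄.p x = splitF 3 (get codeArcCrossed.p) 4 x ∧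
    get codeArcs₄.lab x = labF 3 (get codeArcCrossed.lab) 4 2 x := by decide +kernel

theorem codeArc_entries : get codeArc.p 1 = 5 ∧ get codeArc.lab 4 = 0 := by decide +kernel

theorem codeArcCrossed_entries : get codeArcCrossed.p 0 = 6 ∧ get codeArcCrossed.p 4 = 2 := by
  decide +kernel

/-- If the arc from `c` on the left of `A` meets `B`, all arcs of `B` on this side cross it. -/
theorem IsTaut.arcsCross [Finite D] (hM : M.IsTaut) {A B C : M.CentralCircuit} (hAB : A ≠ B)
    (hAC : A ≠ C) (hBC : B ≠ C) {a : D} (ha : M.circuit a = A) (hc : M.circuit (M.rot a) = C)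
    {i : ℕ} (hi : 1 ≤ i) (hav : M.Avoids A (M.rot a) i)
    (hz : M.circuit (M.rot ((M.str ^ i) (M.rot a))) = B) {k : ℕ}
    (hb : M.circuit (M.rot ((M.str ^ k) a)) = B) :
    M.ArcsCross A (M.rot ((M.str ^ k) a)) (M.rot a) := by
  let κ : ℕ → M.CentralCircuit := fun i => if i = 0 then A else if i = 1 then C else B
  obtain ⟨p0, p1, p2, p3⟩ := get_codeSingle_p
  obtain ⟨l0, l1, l2, l3⟩ := get_codeSingle_lab
  have h1 := hM.realizes_single (κ := κ) ha hc hAC p0 p1 p2 p3 l0 l1 l2 l3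
  -- The circuit `B` enters with the label 2.
  have h1 := h1.relabel (r' := 3) (κ' := κ) (by norm_num) (fun _ _ => rfl) (by
    have : ∀ i < 3, i = 0 ∨ i = 1 ∨ i = 2 := by omega
    intro i hi j hj e
    rcases this i hi with rfl | rfl | rfl <;> rcases this j hj with rfl | rfl | rfl <;>
      simp only [κ] at e <;> first | rfl | (simp at e; first
        | exact absurd e hAB | exact absurd e hAC | exact absurd e hBC | exact absurd e.symm hAB
        | exact absurd e.symm hAC | exact absurd e.symm hBC))
  obtain ⟨S, hS, -, ⟨_, h', -⟩ | ⟨p', lab', f, hQ, hf, h2⟩⟩ := Realizes.stepsAll hM (c := codeSingle)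
    h1 (by norm_num [codeSingle]) (t := 1) (by norm_num [codeSingle]) p1 stepsAll_codeSingle
  · exact absurd h' (by simp)
  rw [Bool.and_eq_true, beq_iff_eq, beq_iff_eq] at hQ
  dsimp only at hQ
  rw [hQ.1, hQ.2] at h2
  have h2 : Realizes M S 2 3 (get codeArc.p) (get codeArc.lab) f κ := h2
  have f0 : f 0 = a := hf 0 (by norm_num [codeSingle])
  have f1 : f 1 = M.rot a := (hf 1 (by norm_num [codeSingle])).trans (by rw [pow_one])
  obtain ⟨q1, m4⟩ := codeArc_entries
  -- the crossing with `B`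
  obtain ⟨j, hj⟩ := h2.seg 1 (by norm_num) (by rw [q1]; norm_num)
  -- The arc from 1 ends at the dart 5, on `A`. As the walk avoids `A` up to the crossing with `B`,
  -- this crossing is inside the arc.
  have hij : i ≤ j := by
    by_contra hlt
    refine hav (j + 1) (by omega) (by omega) ?_
    rw [← f1, str_pow_succ, str_apply, hj.1, q1, ← h2.f_nx 5 (by norm_num),
      ← h2.f_nx (nx 5) (by norm_num [nx]), ← h2.f_nx (nx (nx 5)) (by norm_num [nx]),
      h2.circuit_f _ (by norm_num [nx])]
    change κ (get codeArc.lab 4) = A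
    rw [m4]
    rfl
  have h3 := h2.subdivide hM (x := 1) (by norm_num) (by rw [q1]; norm_num) hj hi hij (l := 2)
    (by norm_num) (by rw [f1, hz]; rfl)
  have h3 := h3.mono_f (p' := get codeArcCrossed.p) (lab' := get codeArcCrossed.lab)
    (fun x hx => (codeArcCrossed_eq x hx).1) (fun x hx => (codeArcCrossed_eq x hx).2)
  set g := Realizes.addVertex M 2 f ((M.str ^ i) (f 1)) with hg
  have hgf (x : ℕ) (hx : x < 8) : g x = f x := Realizes.addVertex_of_lt hx
  obtain ⟨r0, r4⟩ := codeArcCrossed_entries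
  -- `A` consists of the segments from 0 and from 4. The crossing with `B` is in the interior of one
  -- of them, since `A` meets `C` at the two ends.
  obtain ⟨x, hx, j', i', hj', hij', e⟩ := h3.exists_segment (X := {0, 4}) (by
    rintro x (rfl | rfl)
    · rw [r0]; exact ⟨by norm_num, by norm_num, Or.inr rfl⟩
    · rw [r4]; exact ⟨by norm_num, by norm_num, Or.inl rfl⟩) (x₀ := 0) (Or.inl rfl) k
  rw [hgf 0 (by norm_num), f0] at e
  have hx' : x < 12 ∧ get codeArcCrossed.p x ≠ x := by
    rcases hx with rfl | rfl
    · rw [r0]; norm_num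
    · rw [r4]; norm_num
  have hi' : 1 ≤ i' := by
    by_contra h0
    obtain rfl : i' = 0 := by omega
    have e : (M.str ^ k) a = g x := e
    rw [e, ← h3.f_nx x hx'.1, h3.circuit_f _ (nx_lt hx'.1)] at hb
    have : κ (get codeArcCrossed.lab (nx x)) = C := by
      have : get codeArcCrossed.lab (nx x) = 1 := by
        rcases hx with rfl | rfl <;> decide +kernel
      rw [this]; rfl
    exact hBC (hb.symm.trans this)
  have h4 := h3.subdivide hM hx'.1 hx'.2 hj' hi' hij' (l := 2) (by norm_num) (by rw [← e, hb]; rfl)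
  rw [← e] at h4
  have hA (d : D) (hd : M.circuit d = κ 0) : d ∈ S := hS hd
  have g13 : Realizes.addVertex M 3 g ((M.str ^ k) a) 13 = M.rot ((M.str ^ k) a) :=
    Realizes.addVertex_add (n := 3) 1
  have g1 : Realizes.addVertex M 3 g ((M.str ^ k) a) 1 = M.rot a := by
    rw [Realizes.addVertex_of_lt (by norm_num), hgf 1 (by norm_num), f1]
  have main (c : Code) (s : ℕ) (hn : c.n = 4) (hs : s < 16) (hcp : get c.p 13 = 13)
      (h4 : Realizes M S c.n 3 (get c.p) (get c.lab) (Realizes.addVertex M 3 g ((M.str ^ k) a)) κ)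
      (hc : c.stepsAll 13 Code.crossed (fun c => c.crossed || c.noWay s) = true) :
      M.ArcsCross A (M.rot ((M.str ^ k) a)) (M.rot a) := by
    obtain ⟨S', hS', -, ⟨u, h', h5⟩ | ⟨p', lab', f', h', hf', h5⟩⟩ :=
      h4.stepsAll hM (by omega) (by omega) hcp hc
    · have := Realizes.arcsCross (c := ⟨c.n, joinP c.p 13 u, c.lab⟩) h5
        (fun d hd => hS' (hA d hd)) (by norm_num) hn.ge h'
      rwa [g13, g1] at this
    · rw [Bool.or_eq_true, Realizes.not_noWay hM (c := ⟨c.n + 1, p', lab'⟩) h5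
        (by dsimp only; omega) (by dsimp only; omega)] at h'
      have := Realizes.arcsCross (c := ⟨c.n + 1, p', lab'⟩) h5
        (fun d hd => hS' (hA d hd)) (by norm_num) (by dsimp only; omega) (h'.resolve_right (by simp))
      rwa [hf' 13 (by omega), hf' 1 (by omega), g13, g1] at this
  rcases hx with rfl | rfl
  · exact main codeArcs₀ 11 rfl (by norm_num) (by decide +kernel)
      (h4.mono_f (fun x hx => (codeArcs₀_eq x hx).1) (fun x hx => (codeArcs₀_eq x hx).2))
      stepsAll_codeArcs₀
  · exact main codeArcs₄ 9 rfl (by norm_num) (by decide +kernel)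
      (h4.mono_f (fun x hx => (codeArcs₄_eq x hx).1) (fun x hx => (codeArcs₄_eq x hx).2))
      stepsAll_codeArcs₄

end CombMap

/-! ### Counting the crossings on one side of a circuit -/

namespace CombMap

variable {D : Type*} {M : CombMap D}

/-- A dart on a walk is determined by what follows, up to the next crossing. -/
theorem Avoids.eq_of_str_pow_eq {A : M.CentralCircuit} {x x' : D} {m m' : ℕ}
    (hx : M.circuit (M.rot x) = A) (hx' : M.circuit (M.rot x') = A) (h : M.Avoids A x m)
    (h' : M.Avoids A x' m') (e : (M.str ^ m) x = (M.str ^ m') x') : x = x' := by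
  wlog hm : m ≤ m' generalizing x x' m m'
  · exact (this hx' hx h' h e.symm (by omega)).symm
  obtain ⟨l, rfl⟩ := Nat.exists_eq_add_of_le hm
  rw [add_comm m l, str_pow_add] at e
  have e := (M.str ^ m).injective e
  rcases Nat.eq_zero_or_pos l with rfl | hl
  · exact e
  · exact absurd (e ▸ hx) (h' l hl (by omega))

open Classical in
/-- The darts at which the circuit `A` crosses the circuit `B`. -/
noncomputable def crossings [Fintype D] (M : CombMap D) (A B : M.CentralCircuit) : Finset D :=
  Finset.univ.filter fun d => M.circuit d = A ∧ M.circuit (M.rot d) = B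

theorem mem_crossings [Fintype D] {A B : M.CentralCircuit} {d : D} :
    d ∈ M.crossings A B ↔ M.circuit d = A ∧ M.circuit (M.rot d) = B := by
  simp [crossings]

theorem card_crossings_comm [Fintype D] (A B : M.CentralCircuit) :
    (M.crossings A B).card ≤ (M.crossings B A).card := by
  refine Finset.card_le_card_of_injOn M.rot ?_ M.rot.injective.injOn
  intro d hd
  have := mem_crossings.1 hd
  exact mem_crossings.2 ⟨this.2, by rw [circuit_rot_rot]; exact this.1⟩

theorem IsTaut.crossings_nonempty [Fintype D] (hM : M.IsTaut) {A B : M.CentralCircuit}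
    (hAB : A ≠ B) : 0 < (M.crossings A B).card := by
  obtain ⟨d, hd⟩ := hM.exists_crossing hAB
  exact Finset.card_pos.2 ⟨d, mem_crossings.2 hd⟩

/-- There is an arc on the left of `A`, suitably directed, on which `B` and `C` cross. -/
theorem IsTaut.exists_arc [Finite D] (hM : M.IsTaut) {A B C : M.CentralCircuit} (hAB : A ≠ B)
    (hAC : A ≠ C) (hBC : B ≠ C) : ∃ a i, M.circuit a = A ∧ M.circuit (M.rot a) = C ∧ 1 ≤ i ∧
      M.Avoids A (M.rot a) i ∧ M.circuit (M.rot ((M.str ^ i) (M.rot a))) = B := by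
  classical
  obtain ⟨d, hd, hd'⟩ := hM.exists_crossing hBC.symm
  have hex : ∃ k, 1 ≤ k ∧ M.circuit (M.rot ((M.str ^ k) d)) = A := by
    obtain ⟨e, he, he'⟩ := hM.exists_crossing hAC.symm
    have hp := orbLen_pos M.str d
    obtain ⟨k, hk⟩ := hM.circuit_eq_iff.1 (he.trans hd.symm)
    refine ⟨orbLen M.str d + k, by omega, ?_⟩
    rw [str_pow_orbLen_add]
    rcases hk with rfl | rfl
    · exact he'
    · rwa [circuit_rot_rot] at he'
  obtain ⟨h1, h2⟩ := Nat.find_spec hex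
  have hmin : ∀ i, 1 ≤ i → i < Nat.find hex → M.circuit (M.rot ((M.str ^ i) d)) ≠ A :=
    fun i h3 h4 h5 => Nat.find_min hex h4 ⟨h3, h5⟩
  generalize Nat.find hex = k at h1 h2 hmin
  obtain ⟨k, rfl⟩ : ∃ j, k = j + 1 := ⟨k - 1, by omega⟩
  -- The walk along `C` from its crossing with `B` to its first meeting with `A` is now followed
  -- backwards. The direction of `A` is chosen such that this arc is on its left.
  have hback : ∀ i ≤ k, (M.str ^ i) (M.edge ((M.str ^ k) d)) = M.edge ((M.str ^ (k - i)) d) := by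
    intro i hi
    have := hM.str_pow_edge d (k - i) i
    rwa [show k - i + i = k by omega] at this
  have hbackrot : ∀ i, 1 ≤ i → i ≤ k → M.circuit (M.rot ((M.str ^ i) (M.edge ((M.str ^ k) d)))) =
      M.circuit (M.rot ((M.str ^ (k + 1 - i)) d)) := by
    intro i hi hik
    rw [hback i hik, ← hM.rot_rot_str, ← str_pow_succ, show k - i + 1 = k + 1 - i by omega,
      circuit_rot_rot]
  have hlast : (M.str ^ (k + 1)) (M.edge ((M.str ^ k) d)) = M.rot (M.rot d) := by
    rw [str_pow_succ, hback k le_rfl, str_apply, M.edge_edge, Nat.sub_self]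
    rfl
  refine ⟨M.rot⁻¹ (M.edge ((M.str ^ k) d)), k + 1, ?_, ?_, by omega, ?_, ?_⟩
  · rw [hM.circuit_inv_rot, ← hM.rot_rot_str, ← str_pow_succ, circuit_rot_rot, h2]
  · rw [M.rot_inv_rot, circuit_edge, circuit_str_pow, hd]
  · rw [M.rot_inv_rot]
    intro i hi hik
    rcases Nat.lt_or_ge k i with h3 | h3
    · obtain rfl : i = k + 1 := by omega
      rw [hlast, circuit_rot_rot, hd']
      exact hAB.symm
    · rw [hbackrot i hi h3]
      exact hmin _ (by omega) (by omega)
  · rw [M.rot_inv_rot, hlast, circuit_rot_rot, hd']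

/-- On the left of `A`, directed as in `exists_arc`, every arc of `B` crosses every arc of `C`. The
sets consist of darts and count each common vertex twice, so for the numbers of common vertices the
inequality reads `x * y ≤ 4 * z`. -/
theorem IsTaut.card_crossings_mul_le [Fintype D] (hM : M.IsTaut) {A B C : M.CentralCircuit}
    (hAB : A ≠ B) (hAC : A ≠ C) (hBC : B ≠ C) :
    (M.crossings A B).card * (M.crossings A C).card ≤ 8 * (M.crossings B C).card := by
  classical
  obtain ⟨a, i, ha, hc, hi, hav, hz⟩ := hM.exists_arc hAB hAC hBC
  have hpow {x y : D} (h : M.str.SameCycle x y) : ∃ k : ℕ, y = (M.str ^ k) x := by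
    obtain ⟨k, hk⟩ := sameCycle_iff_exists_iterate.1 h
    exact ⟨k, hk.symm⟩
  have hcirc {x y : D} (h : M.str.SameCycle x y) : M.circuit y = M.circuit x := by
    obtain ⟨k, rfl⟩ := hpow h
    rw [circuit_str_pow]
  have arc {B C : M.CentralCircuit} (hAB : A ≠ B) (hAC : A ≠ C) (hBC : B ≠ C) {x y : D}
      (hax : M.str.SameCycle a x) (hay : M.str.SameCycle a y) (hx : M.circuit (M.rot x) = C)
      (hy : M.circuit (M.rot y) = B)
      (hm : ∃ i, 1 ≤ i ∧ M.Avoids A (M.rot x) i ∧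
        M.circuit (M.rot ((M.str ^ i) (M.rot x))) = B) :
      M.ArcsCross A (M.rot y) (M.rot x) := by
    obtain ⟨k, rfl⟩ := hpow (hax.symm.trans hay)
    obtain ⟨i, hi, hav, hz⟩ := hm
    exact hM.arcsCross hAB hAC hBC (by rw [hcirc hax, ha]) hx hi hav hz hy
  have meets {x y : D} {B : M.CentralCircuit} (hy : M.circuit (M.rot y) = B)
      (h : M.ArcsCross A (M.rot y) (M.rot x)) : ∃ i, 1 ≤ i ∧ M.Avoids A (M.rot x) i ∧
        M.circuit (M.rot ((M.str ^ i) (M.rot x))) = B := by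
    obtain ⟨m, i, hm, hi, h1, h2, h3 | h3⟩ := h
    · exact ⟨i, hi, h2, by rw [← h3, circuit_str_pow, hy]⟩
    · exact ⟨i, hi, h2, by rw [h3, circuit_rot_rot, circuit_str_pow, hy]⟩
  let s (X : M.CentralCircuit) : Finset D :=
    Finset.univ.filter fun x => M.str.SameCycle a x ∧ M.circuit (M.rot x) = X
  have hs (X : M.CentralCircuit) (x : D) :
      x ∈ s X ↔ M.str.SameCycle a x ∧ M.circuit (M.rot x) = X := by simp [s]
  -- A dart of `A` points in the direction of `a` or in the opposite one, and `s X` contains only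
  -- those of the first kind.
  have hcard (X : M.CentralCircuit) : (M.crossings A X).card ≤ 2 * (s X).card := by
    have : M.crossings A X ⊆ s X ∪ (s X).image fun x => M.rot (M.rot x) := by
      intro d hd
      obtain ⟨h1, h2⟩ := mem_crossings.1 hd
      obtain ⟨k, hk⟩ := hM.circuit_eq_iff.1 (h1.trans ha.symm)
      have hcyc : M.str.SameCycle a ((M.str ^ k) a) := ⟨k, rfl⟩
      rcases hk with rfl | rfl
      · exact Finset.mem_union_left _ ((hs _ _).2 ⟨hcyc, h2⟩)
      · refine Finset.mem_union_right _ (Finset.mem_image.2 ⟨_, (hs _ _).2 ⟨hcyc, ?_⟩, rfl⟩)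
        rwa [circuit_rot_rot] at h2
    calc _ ≤ _ := Finset.card_le_card this
      _ ≤ _ := Finset.card_union_le _ _
      _ ≤ _ := by have := Finset.card_image_le (s := s X) (f := fun x => M.rot (M.rot x)); omega
  -- First, all arcs of `B` cross the arc of `C` that starts at `a`. So each of them meets `C`, and
  -- with the roles of `B` and `C` exchanged it is crossed by all arcs of `C`.
  have hpair : ∀ x ∈ s B, ∀ y ∈ s C, M.ArcsCross A (M.rot x) (M.rot y) := by
    intro x hx y hy
    obtain ⟨hax, hx⟩ := (hs _ _).1 hx
    obtain ⟨hay, hy⟩ := (hs _ _).1 hy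
    have h1 := arc hAB hAC hBC (Perm.SameCycle.refl _ _) hax hc hx ⟨i, hi, hav, hz⟩
    have h2 := arc hAC hAB hBC.symm hax hay hx hy (meets hc h1.symm)
    exact h2.symm
  have hprod : (s B).card * (s C).card ≤ 2 * (M.crossings B C).card := by
    choose! m i hm hi h1 h2 h3 using hpair
    rw [← Finset.card_product, show 2 * (M.crossings B C).card =
      (M.crossings B C ×ˢ (Finset.univ : Finset Bool)).card by
        rw [Finset.card_product, Finset.card_univ, Fintype.card_bool, mul_comm]]
    -- The dart of `B` at the crossing leads back to the start of the arc of `B`. The Boolean tells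
    -- from which side the arc of `C` arrives, and so determines its start as well.
    refine Finset.card_le_card_of_injOn (fun z => ((M.str ^ m z.1 z.2) (M.rot z.1),
      decide ((M.str ^ m z.1 z.2) (M.rot z.1) = M.rot ((M.str ^ i z.1 z.2) (M.rot z.2))))) ?_ ?_
    · rintro ⟨x, y⟩ hz
      obtain ⟨hx, hy⟩ := Finset.mem_product.1 hz
      have hx' := ((hs _ _).1 hx).2
      have hy' := ((hs _ _).1 hy).2
      refine Finset.mem_coe.2 (Finset.mem_product.2 ⟨mem_crossings.2 ⟨?_, ?_⟩, Finset.mem_univ _⟩)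
      · dsimp only
        rw [circuit_str_pow, hx']
      · dsimp only
        rcases h3 x hx y hy with e | e
        · rw [e, circuit_rot_rot, circuit_str_pow, hy']
        · rw [← e, circuit_str_pow, hy']
    · rintro ⟨x, y⟩ hz ⟨x', y'⟩ hz' e
      obtain ⟨hx, hy⟩ := Finset.mem_product.1 hz
      obtain ⟨hx', hy'⟩ := Finset.mem_product.1 hz'
      have hA (z : D) (X : M.CentralCircuit) (hz : z ∈ s X) :
          M.circuit (M.rot (M.rot z)) = A := by
        rw [circuit_rot_rot, hcirc ((hs _ _).1 hz).1, ha]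
      obtain ⟨e1, e2⟩ := Prod.mk.inj e
      dsimp only at hx hy hx' hy' e1 e2
      have ex := (h1 x hx y hy).eq_of_str_pow_eq (hA x _ hx) (hA x' _ hx') (h1 x' hx' y' hy') e1
      have e3 : (M.str ^ i x y) (M.rot y) = (M.str ^ i x' y') (M.rot y') := by
        rw [decide_eq_decide] at e2
        by_cases h4 : (M.str ^ m x y) (M.rot x) = M.rot ((M.str ^ i x y) (M.rot y))
        · have h5 := e2.1 h4
          rw [← e1, h4] at h5
          exact M.rot.injective h5
        · rw [(h3 x hx y hy).resolve_left h4, (h3 x' hx' y' hy').resolve_left (mt e2.2 h4), e1]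
      have ey := (h2 x hx y hy).eq_of_str_pow_eq (hA y _ hy) (hA y' _ hy') (h2 x' hx' y' hy') e3
      rw [M.rot.injective ex, M.rot.injective ey]
  calc _ ≤ (2 * (s B).card) * (2 * (s C).card) := Nat.mul_le_mul (hcard B) (hcard C)
    _ = 4 * ((s B).card * (s C).card) := by ring
    _ ≤ 8 * (M.crossings B C).card := by omega

/-- For the numbers of crossing darts, `x * y ≤ 8 * z` and `x * z ≤ 8 * y`, where `y` and `z` are
positive because any two circuits cross. Hence `x ≤ 8`. -/
theorem IsTaut.fewCrossings [Finite D] (hM : M.IsTaut)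
    (h3 : ∀ A B : M.CentralCircuit, ∃ C, A ≠ C ∧ B ≠ C) : M.FewCrossings := by
  have := Fintype.ofFinite D
  intro A B K hK
  by_cases hAB : A = B
  · have : K = ∅ := Finset.eq_empty_of_forall_notMem fun d hd => by
      obtain ⟨h1, h2⟩ := hK d hd
      exact hM.pure d (h2.trans (hAB ▸ h1.symm))
    simp [this]
  · obtain ⟨C, hAC, hBC⟩ := h3 A B
    have hsub : K ⊆ M.crossings A B := fun d hd => mem_crossings.2 (hK d hd)
    refine (Finset.card_le_card hsub).trans ?_
    have h1 := hM.card_crossings_mul_le hAB hAC hBC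
    have h2 := hM.card_crossings_mul_le (Ne.symm hAB) hBC hAC
    have h4 := le_antisymm (card_crossings_comm (M := M) A B) (card_crossings_comm B A)
    have h5 := hM.crossings_nonempty hAC
    have h6 := hM.crossings_nonempty hBC
    rw [← h4] at h2
    by_contra hlt
    generalize (M.crossings A B).card = x at *
    generalize (M.crossings A C).card = y at *
    generalize (M.crossings B C).card = z at *
    have h7 : 9 * y ≤ x * y := Nat.mul_le_mul_right y (by omega)
    have h8 : 9 * z ≤ x * z := Nat.mul_le_mul_right z (by omega)
    omega

end CombMap

/-! ### Euler's formula, rail-roads, and hedrites as taut maps -/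

namespace CombMap

section

variable {X : Type*}

theorem card_eq_of_two_or_three_or_four [Finite X] (l : X → ℕ)
    (h : ∀ x, l x = 2 ∨ l x = 3 ∨ l x = 4) :
    Nat.card X = Nat.card {x // l x = 2} + Nat.card {x // l x = 3} + Nat.card {x // l x = 4} := by
  classical
  have := Fintype.ofFinite X
  simp only [Nat.card_eq_fintype_card, Fintype.card_subtype, Finset.card_filter]
  rw [← Finset.sum_add_distrib, ← Finset.sum_add_distrib, Fintype.card, Finset.card_eq_sum_ones]
  refine Finset.sum_congr rfl fun x _ => ?_
  rcases h x with h | h | h <;> simp [h]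

theorem card_orbLen_eq [Finite X] (π : Perm X) (k : ℕ) :
    Nat.card {x // orbLen π x = k} = k * Nat.card {c : Cycles π // cycleLength c = k} := by
  have e : {x // orbLen π x = k} ≃
      Σ c : {c : Cycles π // cycleLength c = k}, {x // cycleMk π x = c.1} :=
    { toFun := fun x => ⟨⟨cycleMk π x, by rw [cycleLength_cycleMk, x.2]⟩, ⟨x, rfl⟩⟩
      invFun := fun y => ⟨y.2.1, by rw [← cycleLength_cycleMk, y.2.2, y.1.2]⟩
      left_inv := fun _ => rfl
      right_inv := fun ⟨⟨c, hc⟩, ⟨x, hx⟩⟩ => by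
        obtain rfl : cycleMk π x = c := hx
        rfl }
  have := Fintype.ofFinite {c : Cycles π // cycleLength c = k}
  rw [Nat.card_congr e, Nat.card_sigma, Finset.sum_congr rfl fun c _ => c.2]
  simp [mul_comm, Nat.card_eq_fintype_card]

theorem card_eq_mul_card_cycles [Finite X] {π : Perm X} {k : ℕ} (h : ∀ x, orbLen π x = k) :
    Nat.card X = k * Nat.card (Cycles π) := by
  rw [← Nat.card_congr (Equiv.subtypeUnivEquiv h), card_orbLen_eq]
  congr 1
  refine Nat.card_congr (Equiv.subtypeUnivEquiv fun c => ?_)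
  obtain ⟨x, rfl⟩ := Quotient.exists_rep c
  exact (cycleLength_cycleMk π x).trans (h x)

theorem orbLen_eq_two [Finite X] {π : Perm X} {x : X} (h : π (π x) = x) (h' : π x ≠ x) :
    orbLen π x = 2 := by
  have h1 := orbLen_le_of_iterate (π := π) (k := 2) two_pos (by rw [pow_two]; exact h)
  have h2 := orbLen_pos π x
  have h3 := pow_orbLen_apply π x
  interval_cases orbLen π x
  · exact absurd (by simpa using h3) h'
  · rfl

theorem orbLen_eq_four [Finite X] {π : Perm X} {x : X} (h : π (π (π (π x))) = x)
    (h' : π (π x) ≠ x) : orbLen π x = 4 := by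
  have h1 := orbLen_le_of_iterate (π := π) (k := 4) (by norm_num) (x := x)
    (by simpa [pow_succ] using h)
  have h2 := orbLen_pos π x
  have h3 := pow_orbLen_apply π x
  interval_cases orbLen π x
  · simp only [pow_one] at h3
    exact absurd (by rw [h3, h3]) h'
  · exact absurd (by simpa [pow_succ] using h3) h'
  · simp only [pow_succ, pow_zero, one_mul, Perm.mul_apply] at h3
    rw [h3] at h
    exact absurd (by rw [h, h]) h'
  · rfl

end

variable {D : Type*} {M : CombMap D}

theorem orbLen_edge [Finite D] (d : D) : orbLen M.edge d = 2 :=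
  orbLen_eq_two (M.edge_edge d) (M.edge_ne d)

theorem card_orbLen_facePerm_eq [Finite D] (k : ℕ) :
    Nat.card {d // orbLen M.facePerm d = k} = k * M.faceCount k :=
  card_orbLen_eq M.facePerm k

/-- Euler's formula for a 4-valent map with faces of lengths 2, 3 and 4. -/
theorem card_vertex_add_card_face_iff [Finite D] (h4 : ∀ d, orbLen M.rot d = 4)
    (hf : ∀ d, orbLen M.facePerm d = 2 ∨ orbLen M.facePerm d = 3 ∨ orbLen M.facePerm d = 4) :
    Nat.card M.Vertex + Nat.card M.Face = Nat.card M.Edge + 2 ↔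
      2 * M.faceCount 2 + M.faceCount 3 = 8 := by
  have h1 : Nat.card D = 4 * Nat.card M.Vertex := card_eq_mul_card_cycles h4
  have h2 : Nat.card D = 2 * Nat.card M.Edge := card_eq_mul_card_cycles M.orbLen_edge
  have h3 := card_eq_of_two_or_three_or_four _ hf
  have h5 := card_eq_of_two_or_three_or_four (X := M.Face) cycleLength fun F => by
    obtain ⟨x, rfl⟩ := Quotient.exists_rep F
    exact (cycleLength_cycleMk M.facePerm x) ▸ hf x
  simp only [card_orbLen_facePerm_eq] at h3
  change _ = M.faceCount 2 + M.faceCount 3 + M.faceCount 4 at h5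
  omega

/-- A set of darts that is closed under `rot` and `edge` is a union of components. -/
theorem eq_univ_of_connected [Finite D] (hM : M.graph.Connected) {T : Set D} (hT : T.Nonempty)
    (h1 : ∀ d ∈ T, M.rot d ∈ T) (h2 : ∀ d ∈ T, M.edge d ∈ T) : T = Set.univ := by
  obtain ⟨d, hd⟩ := hT
  refine Set.eq_univ_of_forall fun d' => ?_
  have key : ∀ v, ∀ w : M.graph.Walk (M.vertex d) v, ∀ d', M.vertex d' = v → d' ∈ T := by
    intro v w
    have step {u v : M.Vertex} (h : M.graph.Adj u v) (hu : ∀ d', M.vertex d' = u → d' ∈ T) :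
        ∀ d', M.vertex d' = v → d' ∈ T := by
      obtain ⟨-, x, hx, hx'⟩ := h
      intro d' hd'
      exact mem_of_sameCycle h1 (cycleMk_eq_iff.1 (hx'.trans hd'.symm)) (h2 _ (hu _ hx))
    suffices ∀ u v (w : M.graph.Walk u v), (∀ d', M.vertex d' = u → d' ∈ T) →
        ∀ d', M.vertex d' = v → d' ∈ T from
      this _ _ w fun d' h => mem_of_sameCycle h1 (cycleMk_eq_iff.1 h.symm) hd
    intro u v w
    induction w with
    | nil => exact id
    | cons h _ ih => exact fun hu => ih (step h hu)
  obtain ⟨w⟩ := hM.preconnected (M.vertex d) (M.vertex d')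
  exact key _ w d' rfl

theorem facePerm_edge_facePerm (h4 : ∀ d, M.rot (M.rot (M.rot (M.rot d))) = d) (d : D) :
    M.facePerm (M.edge (M.facePerm d)) = M.str d := by
  rw [facePerm_apply, M.edge_edge, Perm.inv_eq_iff_eq, facePerm_apply, Perm.inv_eq_iff_eq,
    str_apply, h4]

theorem cross_pow_facePerm (h4 : ∀ d, M.rot (M.rot (M.rot (M.rot d))) = d) (k : ℕ) (d : D) :
    (M.cross ^ k) (M.facePerm d) = M.facePerm ((M.str ^ k) d) := by
  induction k with
  | zero => rfl
  | succ k ih =>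
    rw [pow_succ', Perm.mul_apply, ih, str_pow_succ]
    generalize (M.str ^ k) d = x
    rw [cross, Perm.mul_apply, pow_two, Perm.mul_apply, facePerm_edge_facePerm h4]

/-- `facePerm` intertwines `str` with `cross`, so a rail-road amounts to a straight walk that has
only 4-gons on its left. -/
theorem hasRailroad_iff (h4 : ∀ d, M.rot (M.rot (M.rot (M.rot d))) = d) :
    M.HasRailroad ↔ ∃ d, ∀ k : ℕ, orbLen M.facePerm ((M.str ^ k) d) = 4 := by
  have key (d : D) (k : ℕ) : cycleLength (M.face ((M.cross ^ k) (M.facePerm d))) =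
      orbLen M.facePerm ((M.str ^ k) d) := by
    rw [cross_pow_facePerm h4, face, cycleLength_cycleMk]
    exact orbLen_congr (sameCycle_apply_self _).symm
  constructor
  · rintro ⟨d, hd⟩
    obtain ⟨d, rfl⟩ := M.facePerm.surjective d
    exact ⟨d, fun k => key d k ▸ hd k⟩
  · rintro ⟨d, hd⟩
    exact ⟨M.facePerm d, fun k => (key d k).trans (hd k)⟩

theorem isPure_iff : M.IsPure ↔ ∀ d, M.circuit (M.rot d) ≠ M.circuit d :=
  ⟨fun h d hd => h _ ⟨d, rfl, hd⟩, fun h _ ⟨d, h1, h2⟩ => h d (h2.trans h1.symm)⟩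

namespace IsHedrite

variable {i : ℕ}

theorem orbLen_rot (hM : M.IsHedrite i) (d : D) : orbLen M.rot d = 4 :=
  (cycleLength_cycleMk M.rot d).symm.trans (hM.fourValent _)

theorem orbLen_facePerm (hM : M.IsHedrite i) (d : D) :
    orbLen M.facePerm d = 2 ∨ orbLen M.facePerm d = 3 ∨ orbLen M.facePerm d = 4 := by
  rw [← cycleLength_cycleMk]
  exact hM.faces _

theorem rot4 [Finite D] (hM : M.IsHedrite i) (d : D) : M.rot (M.rot (M.rot (M.rot d))) = d := by
  have := pow_orbLen_apply M.rot d
  rw [hM.orbLen_rot] at this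
  simpa [pow_succ] using this

theorem rot2 [Finite D] (hM : M.IsHedrite i) (d : D) : M.rot (M.rot d) ≠ d := fun h => by
  have := orbLen_le_of_iterate (π := M.rot) (k := 2) two_pos (by rw [pow_two]; exact h)
  rw [hM.orbLen_rot] at this
  omega

theorem two_mul_faceCount [Finite D] (hM : M.IsHedrite i) :
    2 * M.faceCount 2 + M.faceCount 3 = 8 :=
  (card_vertex_add_card_face_iff hM.orbLen_rot hM.orbLen_facePerm).1 hM.plane.2

theorem isTame [Finite D] (hM : M.IsHedrite i) (hp : M.IsPure) : M.IsTame where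
  rot4 := hM.rot4
  rot2 := hM.rot2
  face_le d := by have := hM.orbLen_facePerm d; omega
  conn _ hT h1 h2 := eq_univ_of_connected hM.plane.1 hT h1 h2
  pure := isPure_iff.1 hp

theorem isTaut [Finite D] (hM : M.IsHedrite i) (hp : M.IsPure) (hi : M.IsIrreducible) :
    M.IsTaut where
  toIsTame := hM.isTame hp
  irr d := by
    by_contra! h
    exact hi ((hasRailroad_iff hM.rot4).2 ⟨d, h⟩)

theorem nonempty (hM : M.IsHedrite i) : Nonempty D := by
  obtain ⟨v⟩ := hM.plane.1.nonempty
  exact ⟨(Quotient.exists_rep v).choose⟩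

end IsHedrite

/-- If there are only two central circuits, they alternate around a face. -/
theorem IsTame.circuit_facePerm_ne (hM : M.IsTame) (d : D) :
    M.circuit (M.facePerm d) ≠ M.circuit d := by
  rw [facePerm_apply, hM.circuit_inv_rot, ← circuit_edge d]
  exact hM.pure _

/-- Two circuits cannot alternate around a face of odd length. -/
theorem IsTame.orbLen_ne_three [Finite D] (hM : M.IsTame)
    (h2 : ∀ A B C : M.CentralCircuit, A ≠ B → B ≠ C → A = C) (d : D) :
    orbLen M.facePerm d ≠ 3 := by
  intro h
  have := pow_orbLen_apply M.facePerm d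
  rw [h] at this
  simp only [pow_succ, pow_zero, one_mul, Perm.mul_apply] at this
  have h1 := h2 _ _ _ (hM.circuit_facePerm_ne d).symm
    (hM.circuit_facePerm_ne (M.facePerm d)).symm
  have h3 := hM.circuit_facePerm_ne (M.facePerm (M.facePerm d))
  rw [this] at h3
  exact h3 h1

theorem faceCount_three_eq_zero [Finite D] (h : ∀ d, orbLen M.facePerm d ≠ 3) :
    M.faceCount 3 = 0 := by
  have := card_orbLen_facePerm_eq (M := M) 3
  have h0 : Nat.card {x // orbLen M.facePerm x = 3} = 0 :=
    @Nat.card_of_isEmpty _ ⟨fun x => h x.1 x.2⟩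
  omega

end CombMap

/-! ### Hedrites with two central circuits -/

namespace CombMap

/-- A permutation with cycles of length 2 and 4 only has an alternating function. -/
theorem exists_alternating {X : Type*} [Finite X] {π : Perm X} (h4 : ∀ x, (π ^ 4) x = x)
    (h1 : ∀ x, π x ≠ x) : ∃ s : X → ℝ, (∀ x, s x ≠ 0) ∧ ∀ x, s (π x) = -1 * s x := by
  have hrep (x : X) : ∃ k : ℕ, (π ^ k) (Quotient.out (cycleMk π x)) = x :=
    sameCycle_iff_exists_iterate.1 (cycleMk_eq_iff.1 (Quotient.out_eq _))
  choose k hk using hrep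
  refine ⟨fun x => (-1) ^ k x, fun x => pow_ne_zero _ (by norm_num), fun x => ?_⟩
  have hmk : cycleMk π (π x) = cycleMk π x := cycleMk_eq_iff.2 (sameCycle_apply_self x).symm
  have hstep : (π ^ k (π x)) (Quotient.out (cycleMk π x)) =
      (π ^ (k x + 1)) (Quotient.out (cycleMk π x)) := by
    rw [pow_succ', Perm.mul_apply, hk x, ← hmk, hk]
  generalize Quotient.out (cycleMk π x) = r at hstep
  have hmod (n : ℕ) : (π ^ n) r = (π ^ (n % 4)) r := by
    have : ∀ m : ℕ, (π ^ (4 * m)) ((π ^ (n % 4)) r) = (π ^ (n % 4)) r := fun m => by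
      induction m with
      | zero => rfl
      | succ m ih => rw [mul_add, mul_one, pow_add, Perm.mul_apply, h4, ih]
    rw [← this (n / 4), ← Perm.mul_apply, ← pow_add, Nat.div_add_mod]
  rw [hmod, hmod (k x + 1)] at hstep
  have h3 (x : X) : (π ^ 3) x ≠ x := fun h => h1 x (by
    have := h4 x
    rwa [pow_succ', Perm.mul_apply, h] at this)
  -- The index of an element is determined only up to the length of its cycle. This length is even,
  -- so the parity changes with each step.
  have hpar : k (π x) % 2 = (k x + 1) % 2 := by
    have e1 := Nat.mod_lt (k (π x)) (show 0 < 4 by norm_num)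
    have e2 := Nat.mod_lt (k x + 1) (show 0 < 4 by norm_num)
    rw [← Nat.mod_mod_of_dvd (k (π x)) (show 2 ∣ 4 by norm_num),
      ← Nat.mod_mod_of_dvd (k x + 1) (show 2 ∣ 4 by norm_num)]
    generalize k (π x) % 4 = a at *
    generalize (k x + 1) % 4 = b at *
    have cancel {a b : ℕ} (hab : a ≤ b) (h : (π ^ a) r = (π ^ b) r) (h' : b - a = 1 ∨ b - a = 3) :
        False := by
      obtain ⟨c, rfl⟩ := Nat.exists_eq_add_of_le hab
      rw [add_comm, pow_add, Perm.mul_apply] at h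
      obtain rfl | rfl : c = 1 ∨ c = 3 := by omega
      · exact h1 _ (by simpa using h.symm)
      · exact h3 _ h.symm
    rcases le_total a b with hab | hab
    · by_contra hne
      exact cancel hab hstep (by omega)
    · by_contra hne
      exact cancel hab hstep.symm (by omega)
  change (-1 : ℝ) ^ k (π x) = -1 * (-1) ^ k x
  rw [← pow_succ', neg_one_pow_eq_pow_mod_two, hpar, ← neg_one_pow_eq_pow_mod_two]

variable {D : Type*} {M : CombMap D}

/-- The central circuits of a hedrite without triangles are not self-intersecting. -/
theorem IsHedrite.isPure_of_orbLen_ne_three [Finite D] {i : ℕ} (hM : M.IsHedrite i)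
    (h3 : ∀ d, orbLen M.facePerm d ≠ 3) : M.IsPure := by
  have := Fintype.ofFinite D
  have hface (d : D) : (M.facePerm ^ 4) d = d ∧ M.facePerm d ≠ d := by
    have h := pow_orbLen_apply M.facePerm d
    have h' : orbLen M.facePerm d = 2 ∨ orbLen M.facePerm d = 4 := by
      have := hM.orbLen_facePerm d
      have := h3 d
      omega
    refine ⟨?_, fun hd => ?_⟩
    · rcases h' with h' | h' <;> rw [h'] at h
      · rw [show 4 = 2 + 2 by norm_num, pow_add, Perm.mul_apply, h, h]
      · exact h
    · have := orbLen_le_of_iterate (π := M.facePerm) (k := 1) one_pos (x := d) (by simpa using hd)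
      omega
  have hrot (d : D) : (M.rot⁻¹ ^ 4) d = d ∧ M.rot⁻¹ d ≠ d := by
    refine ⟨?_, fun h => hM.rot2 d ?_⟩
    · rw [inv_pow, Perm.inv_eq_iff_eq]
      simpa [pow_succ] using (hM.rot4 d).symm
    · have h := Perm.inv_eq_iff_eq.1 h
      rw [← h, ← h]
  obtain ⟨s, hs, hs'⟩ := exists_alternating (fun d => (hrot d).1) fun d => (hrot d).2
  obtain ⟨t, ht, ht'⟩ := exists_alternating (fun d => (hface d).1) fun d => (hface d).2
  have k1 := card_cycles_le_finrank_eigenfunctions _ _ s hs hs'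
  have k2 := card_cycles_le_finrank_eigenfunctions M.edge 1 1 (fun _ => one_ne_zero)
    fun _ => (one_mul _).symm
  have k3 := card_cycles_le_finrank_eigenfunctions _ _ t ht ht'
  have hdim := finrank_eigenfunctions_add_le M.rot⁻¹ M.edge (a := -1) (b := 1) (by norm_num)
    (by norm_num)
  -- The three eigenspaces have dimensions at least `V`, `E` and `F`. As `V + F = E + 2` and there
  -- are `2 * E` darts, the intersection is not zero.
  have hpos : Module.finrank ℝ (eigenfunctions M.rot⁻¹ (-1) ⊓ eigenfunctions M.edge 1 :
      Submodule ℝ (D → ℝ)) ≠ 0 := by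
    have e1 : Nat.card D = 4 * Nat.card M.Vertex := card_eq_mul_card_cycles hM.orbLen_rot
    have e2 : Nat.card D = 2 * Nat.card M.Edge := card_eq_mul_card_cycles M.orbLen_edge
    have e3 := hM.plane.2
    have e4 : Nat.card M.Vertex ≤ Nat.card (Cycles M.rot⁻¹) := by
      have h1 := card_eq_mul_card_cycles (π := M.rot⁻¹) (k := 4) fun d =>
        orbLen_eq_four (by simpa [pow_succ] using (hrot d).1) fun h => hM.rot2 d (by
          rw [Perm.inv_eq_iff_eq, Perm.inv_eq_iff_eq] at h
          exact h.symm)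
      omega
    rw [show (-1 : ℝ) * 1 = -1 by norm_num] at hdim
    change Nat.card M.Edge ≤ _ at k2
    change Nat.card M.Face ≤ Module.finrank ℝ (eigenfunctions (M.rot⁻¹ * M.edge) (-1)) at k3
    rw [← Nat.card_eq_fintype_card] at hdim
    omega
  obtain ⟨f, ⟨hf1, hf2⟩, hf0⟩ := Submodule.exists_mem_ne_zero_of_ne_bot
    fun h => hpos (Submodule.finrank_eq_zero.2 h)
  -- Thus `f` is constant along each central circuit and changes sign from a circuit to one that
  -- crosses it.
  have hf1' (d : D) : f (M.rot d) = -f d := by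
    have h := mem_eigenfunctions.1 hf1 (M.rot d)
    rw [inv_rot_rot] at h
    linarith
  have hf2' (d : D) : f (M.edge d) = f d := by
    rw [mem_eigenfunctions.1 hf2 d, one_mul]
  have hf : ∀ d, f d ≠ 0 := by
    by_contra! h
    have := eq_univ_of_connected hM.plane.1 (T := {d | f d = 0}) h
      (fun d (hd : f d = 0) => show f (M.rot d) = 0 by rw [hf1', hd, neg_zero])
      (fun d (hd : f d = 0) => show f (M.edge d) = 0 by rw [hf2', hd])
    exact hf0 (funext fun d => Set.eq_univ_iff_forall.1 this d)
  refine isPure_iff.2 fun d hd => hf d ?_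
  have := mem_of_circuit_eq (T := {x | f x = f d})
    (fun x (hx : f x = f d) => show f _ = f d by rw [hf1', hf1', neg_neg, hx])
    (fun x (hx : f x = f d) => show f _ = f d by rw [hf2', hx]) hd rfl
  have h : f (M.rot d) = f d := this
  rw [hf1'] at h
  linarith

/-- A pure hedrite with at most two central circuits has no rail-road. -/
theorem IsHedrite.isIrreducible_of_circuit [Finite D] {i : ℕ} (hM : M.IsHedrite i)
    (hp : M.IsPure) (h2 : ∀ A B C : M.CentralCircuit, A ≠ B → B ≠ C → A = C) :
    M.IsIrreducible := by
  classical
  have := Fintype.ofFinite D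
  have hT := hM.isTame hp
  rw [IsIrreducible, hasRailroad_iff hM.rot4]
  rintro ⟨d, hd⟩
  have hne := hT.circuit_facePerm_ne
  have hff (x : D) : M.circuit (M.facePerm (M.facePerm x)) = M.circuit x :=
    (h2 _ _ _ (hne x).symm (hne _).symm).symm
  -- `S` is the circuit along the rail-road. With two circuits, opposite sides of a 4-gon are on the
  -- same circuit, so `S` bounds the rail-road on both sides, and these 4-gons make up the whole
  -- region on the left of `d`.
  let S : Set D := {x | M.circuit x = M.circuit d}
  have hS : M.EdgeClosed S := fun x (hx : M.circuit x = _) =>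
    show M.circuit _ = _ by rw [circuit_edge, hx]
  have hb : M.NoBend S := fun x (hx : M.circuit x = _) =>
    Or.inr (show M.circuit _ = _ by rw [circuit_rot_rot, hx])
  have hdS (k : ℕ) : (M.str ^ k) d ∈ S := circuit_str_pow k d
  have hφ (k : ℕ) : M.edge (M.facePerm ((M.str ^ k) d)) =
      M.facePerm⁻¹ ((M.str ^ (k + 1)) d) := by
    rw [Perm.eq_inv_iff_eq, str_pow_succ, facePerm_edge_facePerm hM.rot4]
  have hquad (k : ℕ) : M.facePerm (M.facePerm (M.facePerm (M.facePerm ((M.str ^ k) d)))) =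
      (M.str ^ k) d := by
    have := pow_orbLen_apply M.facePerm ((M.str ^ k) d)
    rw [hd] at this
    simpa [pow_succ] using this
  have hleft : ∀ x, M.SameRegion S d x → ∃ k : ℕ, x = (M.str ^ k) d ∨
      x = M.facePerm ((M.str ^ k) d) ∨ x = M.facePerm (M.facePerm ((M.str ^ k) d)) ∨
      x = M.facePerm⁻¹ ((M.str ^ k) d) := by
    intro x hx
    refine hx {x | ∃ k : ℕ, x = (M.str ^ k) d ∨
      x = M.facePerm ((M.str ^ k) d) ∨ x = M.facePerm (M.facePerm ((M.str ^ k) d)) ∨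
      x = M.facePerm⁻¹ ((M.str ^ k) d)} ?_ ?_ ⟨0, Or.inl rfl⟩
    · rintro _ ⟨k, rfl | rfl | rfl | rfl⟩
      · exact ⟨k, Or.inr (Or.inl rfl)⟩
      · exact ⟨k, Or.inr (Or.inr (Or.inl rfl))⟩
      · exact ⟨k, Or.inr (Or.inr (Or.inr (by rw [Equiv.Perm.eq_inv_iff_eq, hquad])))⟩
      · exact ⟨k, Or.inl (M.facePerm.apply_symm_apply _)⟩
    · rintro _ ⟨k, rfl | rfl | rfl | rfl⟩ hxS
      · exact absurd (hdS k) hxS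
      · exact ⟨k + 1, Or.inr (Or.inr (Or.inr (hφ k)))⟩
      · exact absurd ((hff _).trans (hdS k)) hxS
      · have hpos := orbLen_pos M.str d
        refine ⟨orbLen M.str d + k - 1, Or.inr (Or.inl ?_)⟩
        rw [← str_pow_orbLen_add k d,
          show orbLen M.str d + k = orbLen M.str d + k - 1 + 1 by omega, ← hφ, M.edge_edge]
        rfl
  have hfour : ∀ x, M.SameRegion S d x → orbLen M.facePerm x = 4 := by
    intro x hx
    obtain ⟨k, rfl | rfl | rfl | rfl⟩ := hleft x hx <;> rw [← hd k] <;> apply orbLen_congr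
    · exact (sameCycle_apply_self _).symm
    · exact ((sameCycle_apply_self _).trans (sameCycle_apply_self _)).symm
    · exact ⟨1, by simp⟩
  -- The circuit has only two sides: both regions persist along it, and crossing it leads from one
  -- to the other.
  have hcover : ∀ x, M.SameRegion S d x ∨ M.SameRegion S (M.edge d) x := by
    have hstr (x : D) (hx : M.circuit x = M.circuit d) : M.SameRegion S x (M.str x) := by
      have h1 := SameRegion.edge (M := M) (S := S) (d := M.facePerm x)
          fun h => hne _ (h.trans hx.symm)
      have h3 := SameRegion.face (M := M) (S := S) (M.edge (M.facePerm x))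
      rw [facePerm_edge_facePerm hM.rot4] at h3
      exact ((SameRegion.face _).trans h1).trans h3
    have hl : ∀ k : ℕ, M.SameRegion S d ((M.str ^ k) d) := fun k => by
      induction k with
      | zero => exact SameRegion.refl d
      | succ k ih =>
        rw [str_pow_succ]
        exact ih.trans (hstr _ (hdS k))
    have hr : ∀ k : ℕ, M.SameRegion S (M.edge d) (M.edge ((M.str ^ k) d)) := fun k => by
      induction k with
      | zero => exact SameRegion.refl _
      | succ k ih =>
        have h1 := hstr (M.edge ((M.str ^ (k + 1)) d)) (by rw [circuit_edge, circuit_str_pow])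
        rw [str_apply (M := M) (M.edge _), M.edge_edge, str_pow_succ, hT.rot_rot_str] at h1
        rw [str_pow_succ]
        exact ih.trans (h1.symm hS)
    have hsplit : ∀ x, M.circuit x = M.circuit d →
        (M.SameRegion S d x ∧ M.SameRegion S (M.edge d) (M.edge x)) ∨
        (M.SameRegion S (M.edge d) x ∧ M.SameRegion S d (M.edge x)) := by
      intro x hx
      obtain ⟨k, rfl | rfl⟩ := hT.circuit_eq_iff.1 hx
      · exact Or.inl ⟨hl k, hr k⟩
      · have hpos := orbLen_pos M.str d
        have e : M.rot (M.rot ((M.str ^ k) d)) = M.edge ((M.str ^ (orbLen M.str d + k - 1)) d) := by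
          rw [← str_pow_orbLen_add k d,
            show orbLen M.str d + k = orbLen M.str d + k - 1 + 1 by omega, str_pow_succ,
            hT.rot_rot_str]
          rfl
        rw [e, M.edge_edge]
        exact Or.inr ⟨hr _, hl _⟩
    have := hT.conn {x | (M.SameRegion S d x ∨ M.SameRegion S (M.edge d) x)}
      ⟨d, Or.inl (SameRegion.refl d)⟩
    have hedge : ∀ x, (M.SameRegion S d x ∨ M.SameRegion S (M.edge d) x) →
        (M.SameRegion S d (M.edge x) ∨ M.SameRegion S (M.edge d) (M.edge x)) := fun x hx => by
      by_cases hxS : x ∈ S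
      · rcases hsplit x hxS with h | h
        · exact Or.inr h.2
        · exact Or.inl h.2
      · exact hx.imp (fun h => h.trans (SameRegion.edge hxS)) fun h =>
          h.trans (SameRegion.edge hxS)
    have hface : ∀ x, (M.SameRegion S d x ∨ M.SameRegion S (M.edge d) x) →
        (M.SameRegion S d (M.facePerm x) ∨ M.SameRegion S (M.edge d) (M.facePerm x)) := fun x hx =>
      hx.imp (fun h => h.trans (SameRegion.face _)) fun h => h.trans (SameRegion.face _)
    refine fun x => Set.eq_univ_iff_forall.1 (this (fun x hx => ?_) hedge) x
    -- In a 4-valent map `rot` is the third power of `rot⁻¹`, that is, of `facePerm * edge`.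
    have h1 := hface _ (hedge _ (hface _ (hedge _ (hface _ (hedge _ hx)))))
    simp only [facePerm_apply, M.edge_edge] at h1
    rwa [hT.inv_inv_rot, hT.inv_rot, hM.rot4] at h1
  -- The region on the right of `d` contains the whole curvature, which is 8 by Euler's formula. It
  -- has at least one boundary walk, so the bound would give `4 + 8 ≤ 8`.
  have hb := hT.region_bound hS hb (M.edge d) {⟨M.edge d, SameRegion.refl _⟩}
    (by simpa using hS d rfl) (by simp)
  have hsum : ∑ x : {x // M.SameRegion S (M.edge d) x},
      (4 * ((orbLen M.facePerm x.1 : ℝ))⁻¹ - 1) =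
      ∑ x, (4 * ((orbLen M.facePerm x : ℝ))⁻¹ - 1) := by
    rw [← Finset.sum_subtype (Finset.univ.filter fun x => M.SameRegion S (M.edge d) x) (by simp)
      fun x => (4 * ((orbLen M.facePerm x : ℝ))⁻¹ - 1)]
    refine Finset.sum_subset (Finset.subset_univ _) fun x _ hx => ?_
    rw [hfour x ((hcover x).resolve_right (by simpa using hx))]
    norm_num
  have e1 : Nat.card D = 4 * Nat.card M.Vertex := card_eq_mul_card_cycles hM.orbLen_rot
  have e2 : Nat.card D = 2 * Nat.card M.Edge := card_eq_mul_card_cycles M.orbLen_edge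
  have e3 := hM.plane.2
  have e4 : (4 * Nat.card M.Face : ℝ) = Nat.card D + 8 := by
    have : 4 * Nat.card M.Face = Nat.card D + 8 := by omega
    exact_mod_cast this
  rw [hsum, Finset.sum_sub_distrib, ← Finset.mul_sum, sum_inv_orbLen] at hb
  change 4 * _ + _ + (4 * (Nat.card M.Face : ℝ) - _) ≤ _ at hb
  rw [e4] at hb
  simp only [Finset.card_singleton, Finset.sum_const, Finset.card_univ, nsmul_eq_mul, mul_one,
    ← Nat.card_eq_fintype_card, Nat.cast_one] at hb
  have : (0 : ℝ) ≤ ((Finset.univ.filter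
    fun x : {x // M.SameRegion S (M.edge d) x} => x.1 ∈ S ∧ M.rot x.1 ∈ S).card : ℝ) := by
    positivity
  linarith

end CombMap

/-! ### Certificates for connectedness, purity and irreducibility -/

/-- A graph with an st-numbering is connected, and stays so after the removal of a vertex. -/
theorem SimpleGraph.connected_of_stNumbering {V : Type*} [Finite V] {G : SimpleGraph V}
    (σ : V → ℕ) (hσ : Function.Injective σ) {s t : V} (hst : G.Adj s t)
    (hs : ∀ v, v ≠ s → ∃ w, G.Adj v w ∧ σ w < σ v)
    (ht : ∀ v, v ≠ t → ∃ w, G.Adj v w ∧ σ v < σ w) :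
    G.Connected ∧ ∀ v, (G.induce {v}ᶜ).Preconnected := by
  constructor
  · have key : ∀ m v, σ v = m → G.Reachable v s := fun m => by
      induction m using Nat.strong_induction_on with
      | _ m ih =>
        rintro v rfl
        by_cases hv : v = s
        · exact hv ▸ SimpleGraph.Reachable.refl _
        · obtain ⟨w, hw, hlt⟩ := hs v hv
          exact hw.reachable.trans (ih _ hlt w rfl)
    have : Nonempty V := ⟨s⟩
    exact ⟨fun v w => (key _ v rfl).trans (key _ w rfl).symm⟩
  · intro v
    have hne {a b : V} (h : σ a < σ b) : a ≠ b := fun e => absurd h (e ▸ lt_irrefl _)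
    have adj {a b : V} (ha : a ∈ ({v}ᶜ : Set V)) (hb : b ∈ ({v}ᶜ : Set V)) (h : G.Adj a b) :
        (G.induce {v}ᶜ).Reachable ⟨a, ha⟩ ⟨b, hb⟩ :=
      SimpleGraph.Adj.reachable (G := G.induce {v}ᶜ) (u := ⟨a, ha⟩) (v := ⟨b, hb⟩) h
    -- From a vertex numbered below `v`, descending leads to `s` without meeting `v`; from one
    -- above, ascending leads to `t`. Since `s` and `t` are adjacent, the two parts are connected
    -- whenever both occur.
    have hdown : ∀ m a (ha : a ∈ ({v}ᶜ : Set V)), σ a = m → σ a < σ v → ∃ hs' : s ∈ ({v}ᶜ : Set V),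
        (G.induce {v}ᶜ).Reachable ⟨a, ha⟩ ⟨s, hs'⟩ := fun m => by
      induction m using Nat.strong_induction_on with
      | _ m ih =>
        rintro a ha rfl hlt
        by_cases has : a = s
        · subst has
          exact ⟨ha, SimpleGraph.Reachable.refl _⟩
        · obtain ⟨w, hw, hlt'⟩ := hs a has
          have hw' : w ∈ ({v}ᶜ : Set V) := hne (hlt'.trans hlt)
          obtain ⟨hs', h⟩ := ih _ hlt' w hw' rfl (hlt'.trans hlt)
          exact ⟨hs', (adj ha hw' hw).trans h⟩
    obtain ⟨B, hB⟩ := (Set.finite_range σ).bddAbove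
    have hup : ∀ m a (ha : a ∈ ({v}ᶜ : Set V)), B - σ a = m → σ v < σ a → ∃ ht' : t ∈ ({v}ᶜ : Set V),
        (G.induce {v}ᶜ).Reachable ⟨a, ha⟩ ⟨t, ht'⟩ := fun m => by
      induction m using Nat.strong_induction_on with
      | _ m ih =>
        rintro a ha rfl hlt
        by_cases hat : a = t
        · subst hat
          exact ⟨ha, SimpleGraph.Reachable.refl _⟩
        · obtain ⟨w, hw, hlt'⟩ := ht a hat
          have hw' : w ∈ ({v}ᶜ : Set V) := (hne (hlt.trans hlt')).symm
          have hwB : σ w ≤ B := hB ⟨w, rfl⟩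
          obtain ⟨ht', h⟩ := ih (B - σ w) (by omega) w hw' rfl (hlt.trans hlt')
          exact ⟨ht', (adj ha hw' hw).trans h⟩
    rintro ⟨a, ha⟩ ⟨b, hb⟩
    have hcases {a : V} (ha : a ∈ ({v}ᶜ : Set V)) : σ a < σ v ∨ σ v < σ a :=
      lt_or_gt_of_ne fun h => ha (hσ h)
    rcases hcases ha with h1 | h1 <;> rcases hcases hb with h2 | h2
    · obtain ⟨_, r1⟩ := hdown _ a ha rfl h1
      obtain ⟨_, r2⟩ := hdown _ b hb rfl h2
      exact r1.trans r2.symm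
    · obtain ⟨h3, r1⟩ := hdown _ a ha rfl h1
      obtain ⟨h4, r2⟩ := hup _ b hb rfl h2
      exact (r1.trans (adj h3 h4 hst)).trans r2.symm
    · obtain ⟨h3, r1⟩ := hup _ a ha rfl h1
      obtain ⟨h4, r2⟩ := hdown _ b hb rfl h2
      exact (r1.trans (adj h3 h4 hst.symm)).trans r2.symm
    · obtain ⟨_, r1⟩ := hup _ a ha rfl h1
      obtain ⟨_, r2⟩ := hup _ b hb rfl h2
      exact r1.trans r2.symm

namespace CombMap

theorem orbLen_eq_three {X : Type*} [Finite X] {π : Perm X} {x : X} (h : π (π (π x)) = x)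
    (h' : π x ≠ x) : orbLen π x = 3 := by
  have h1 := orbLen_le_of_iterate (π := π) (k := 3) (by norm_num) (x := x)
    (by simpa [pow_succ] using h)
  have h2 := orbLen_pos π x
  have h3 := pow_orbLen_apply π x
  interval_cases orbLen π x
  · exact absurd (by simpa using h3) h'
  · rw [pow_two, Perm.mul_apply] at h3
    rw [h3] at h
    exact absurd h h'
  · rfl

/-- The number of elements with a given property. -/
noncomputable def countLt (k : ℕ) (Q : ℕ → Bool) : ℕ :=
  Nat.rec 0 (fun x ih => bif Q x then ih + 1 else ih) k

theorem countLt_eq (k : ℕ) (Q : ℕ → Bool) :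
    countLt k Q = ((Finset.range k).filter fun x => Q x = true).card := by
  induction k with
  | zero => rfl
  | succ k ih =>
    rw [show countLt (k + 1) Q = bif Q k then countLt k Q + 1 else countLt k Q from rfl, ih,
      Finset.range_add_one, Finset.filter_insert]
    cases hQ : Q k <;> simp

/-- The length of a face with 2, 3 or 4 edges, on the level of codes. -/
def faceLen (p : ℕ → ℕ) (x : ℕ) : ℕ :=
  bif Nat.beq (wk p (wk p x)) x then 2 else bif Nat.beq (wk p (wk p (wk p x))) x then 3 else
    bif Nat.beq (wk p (wk p (wk p (wk p x)))) x then 4 else 0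

/-- There is a face with less than four edges on the left of one of the next `k` edges. -/
noncomputable def shortFace (p : ℕ → ℕ) (k : ℕ) : ℕ → Bool :=
  Nat.rec (fun _ => false)
    (fun _ ih x => !(Nat.beq (faceLen p x) 4) || force (nx (nx (p x))) ih) k

/-- The properties of a code that make it the code of a pure irreducible `i`-hedrite; `σ` is an
st-numbering of the vertices. -/
noncomputable def hedriteCheck (n i : ℕ) (p lab σ : ℕ → ℕ) : Bool :=
  allLt (4 * n) (fun x =>
    Nat.beq (lab (p x)) (lab x) && Nat.beq (lab (nx (nx x))) (lab x) &&
    !(Nat.beq (lab (nx x)) (lab x)) && !(Nat.beq (wk p x) x) && !(Nat.beq (faceLen p x) 0) &&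
    !(Nat.beq (p x / 4) (x / 4)) && shortFace p (4 * n) x) &&
  Nat.beq (countLt (4 * n) (fun x => Nat.beq (faceLen p x) 2) + 2 * i) 16 &&
  Nat.beq (countLt (4 * n) (fun x => Nat.beq (faceLen p x) 3) + 24) (6 * i) &&
  allLt n (fun v => allLt v fun w => !(Nat.beq (σ v) (σ w))) &&
  allLt n (fun v => Nat.beq v 0 || anyLt 4 fun k => Nat.ble (σ (p (4 * v + k) / 4) + 1) (σ v)) &&
  allLt n (fun v => Nat.beq v (p 0 / 4) ||
    anyLt 4 fun k => Nat.ble (σ v + 1) (σ (p (4 * v + k) / 4)))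

/-- A map with darts `0, …, 4 * n - 1`. -/
structure Drawn {D : Type*} (M : CombMap D) (n : ℕ) (p : ℕ → ℕ) (f : ℕ → D) : Prop where
  pos : 0 < n
  f_nx : ∀ x < 4 * n, f (nx x) = M.rot (f x)
  p_lt : ∀ x < 4 * n, p x < 4 * n
  f_p : ∀ x < 4 * n, f (p x) = M.edge (f x)
  f_inj : ∀ x < 4 * n, ∀ y < 4 * n, f x = f y → x = y
  f_surj : ∀ d, ∃ x < 4 * n, f x = d

namespace Drawn

variable {D : Type*} {M : CombMap D} {n : ℕ} {p : ℕ → ℕ} {f : ℕ → D}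

theorem wk_lt (h : Drawn M n p f) {x : ℕ} (hx : x < 4 * n) : wk p x < 4 * n := pv_lt (h.p_lt x hx)

theorem f_wk (h : Drawn M n p f) {x : ℕ} (hx : x < 4 * n) : f (wk p x) = M.facePerm (f x) := by
  rw [facePerm_apply, ← Perm.inv_eq_iff_eq, inv_inv, ← h.f_p x hx, ← h.f_nx _ (h.wk_lt hx), wk, nx_pv]

theorem orbLen_facePerm [Finite D] (h : Drawn M n p f) {x : ℕ} (hx : x < 4 * n)
    (h1 : wk p x ≠ x) (h0 : faceLen p x ≠ 0) : orbLen M.facePerm (f x) = faceLen p x := by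
  have l1 := h.wk_lt hx
  have l2 := h.wk_lt l1
  have l3 := h.wk_lt l2
  have l4 := h.wk_lt l3
  have h1' : M.facePerm (f x) ≠ f x := fun e => h1 (h.f_inj _ l1 _ hx (by rw [h.f_wk hx, e]))
  have e2 := h.f_wk l1
  have e3 := h.f_wk l2
  have e4 := h.f_wk l3
  rw [h.f_wk hx] at e2
  rw [e2] at e3
  rw [e3] at e4
  unfold faceLen at h0 ⊢
  simp only [natBeq_eq, Bool.cond_decide] at h0 ⊢
  split_ifs at h0 ⊢ with c2 c3 c4
  · exact orbLen_eq_two (by rw [← e2, c2]) h1'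
  · exact orbLen_eq_three (by rw [← e3, c3]) h1'
  · exact orbLen_eq_four (by rw [← e4, c4]) fun e => c2 (h.f_inj _ l2 _ hx (e2.trans e))
  · exact absurd rfl h0

theorem rot4 (h : Drawn M n p f) (d : D) : M.rot (M.rot (M.rot (M.rot d))) = d := by
  obtain ⟨x, hx, rfl⟩ := h.f_surj d
  rw [← h.f_nx _ hx, ← h.f_nx _ (nx_lt hx), ← h.f_nx _ (nx_lt (nx_lt hx)),
    ← h.f_nx _ (nx_lt (nx_lt (nx_lt hx))), nx_nx_nx_nx]

theorem rot2 (h : Drawn M n p f) (d : D) : M.rot (M.rot d) ≠ d := by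
  obtain ⟨x, hx, rfl⟩ := h.f_surj d
  rw [← h.f_nx _ hx, ← h.f_nx _ (nx_lt hx)]
  intro e
  have := h.f_inj _ (nx_lt (nx_lt hx)) _ hx e
  unfold nx at this
  omega

theorem vertex_eq_iff [Finite D] (h : Drawn M n p f) {x y : ℕ} (hx : x < 4 * n) (hy : y < 4 * n) :
    M.vertex (f x) = M.vertex (f y) ↔ x / 4 = y / 4 := by
  constructor
  · intro e
    obtain ⟨z, hz, hzy, hzx⟩ := mem_of_sameCycle (s := {d | ∃ z < 4 * n, f z = d ∧ z / 4 = x / 4})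
      (by
        rintro _ ⟨z, hz, rfl, e⟩
        exact ⟨nx z, nx_lt hz, h.f_nx z hz, by rw [← e]; unfold nx; omega⟩)
      (cycleMk_eq_iff.1 e) ⟨x, hx, rfl, rfl⟩
    rw [← h.f_inj z hz y hy hzy, hzx]
  · intro e
    have step {z : ℕ} (hz : z < 4 * n) : M.vertex (f (nx z)) = M.vertex (f z) := by
      rw [h.f_nx z hz]
      exact cycleMk_eq_iff.2 (sameCycle_apply_self _).symm
    have h1 := step hx
    have h2 := step (nx_lt hx)
    have h3 := step (nx_lt (nx_lt hx))
    have : y = x ∨ y = nx x ∨ y = nx (nx x) ∨ y = nx (nx (nx x)) := by unfold nx; omega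
    rcases this with rfl | rfl | rfl | rfl
    · rfl
    · exact h1.symm
    · exact (h2.trans h1).symm
    · exact (h3.trans (h2.trans h1)).symm

theorem card_orbLen_facePerm_eq [Finite D] (h : Drawn M n p f)
    (hlen : ∀ x < 4 * n, orbLen M.facePerm (f x) = faceLen p x) (k : ℕ) :
    Nat.card {d // orbLen M.facePerm d = k} =
      countLt (4 * n) (fun x => Nat.beq (faceLen p x) k) := by
  let s := (Finset.range (4 * n)).filter fun x => Nat.beq (faceLen p x) k = true
  have hs {x : ℕ} (hx : x ∈ s) : x < 4 * n ∧ faceLen p x = k :=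
    (Finset.mem_filter.1 hx).imp Finset.mem_range.1 Nat.eq_of_beq_eq_true
  rw [countLt_eq, ← Nat.card_eq_finsetCard]
  refine (Nat.card_congr (Equiv.ofBijective
    (fun x : s => (⟨f x, by rw [hlen x (hs x.2).1, (hs x.2).2]⟩ :
      {d // orbLen M.facePerm d = k})) ⟨fun x y e => ?_, ?_⟩)).symm
  · exact Subtype.ext (h.f_inj _ (hs x.2).1 _ (hs y.2).1 (congrArg Subtype.val e))
  · rintro ⟨d, hd⟩
    obtain ⟨x, hx, rfl⟩ := h.f_surj d
    rw [hlen x hx] at hd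
    exact ⟨⟨x, Finset.mem_filter.2 ⟨Finset.mem_range.2 hx, hd ▸ Nat.beq_refl _⟩⟩, rfl⟩

theorem exists_short (h : Drawn M n p f) [Finite D]
    (hlen : ∀ x < 4 * n, orbLen M.facePerm (f x) = faceLen p x) {m : ℕ} : ∀ {x : ℕ}, x < 4 * n →
    shortFace p m x = true → ∃ k : ℕ, orbLen M.facePerm ((M.str ^ k) (f x)) ≠ 4 := by
  induction m with
  | zero => exact fun _ hs => absurd hs (by simp [shortFace])
  | succ m ih =>
    intro x hx hs
    rw [show shortFace p (m + 1) x = (!(Nat.beq (faceLen p x) 4) ||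
      force (nx (nx (p x))) (shortFace p m)) from rfl, force_eq, Bool.or_eq_true, natBeq_eq] at hs
    rcases hs with hs | hs
    · refine ⟨0, ?_⟩
      rw [pow_zero, Perm.one_apply, hlen x hx]
      simpa using hs
    · have hp := h.p_lt x hx
      obtain ⟨k, hk⟩ := ih (nx_lt (nx_lt hp)) hs
      rw [h.f_nx _ (nx_lt hp), h.f_nx _ hp, h.f_p _ hx] at hk
      exact ⟨k + 1, by rwa [pow_succ, Perm.mul_apply]⟩

theorem isHedrite [Finite D] (h : Drawn M n p f) {i : ℕ} {lab σ : ℕ → ℕ}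
    (hc : hedriteCheck n i p lab σ = true) : M.IsHedrite i ∧ M.IsPure ∧ M.IsIrreducible := by
  simp only [hedriteCheck, Bool.and_eq_true, allLt_iff, anyLt_iff, natBeq_eq, natBle_eq,
    Bool.or_eq_true, decide_eq_true_iff, Bool.not_eq_true', decide_eq_false_iff_not] at hc
  obtain ⟨⟨⟨⟨⟨hloc, hc2⟩, hc3⟩, hσ⟩, hdown⟩, hup⟩ := hc
  have hlen (x : ℕ) (hx : x < 4 * n) : orbLen M.facePerm (f x) = faceLen p x :=
    h.orbLen_facePerm hx (hloc x hx).1.1.1.2 (hloc x hx).1.1.2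
  have hf (d : D) : orbLen M.facePerm d = 2 ∨ orbLen M.facePerm d = 3 ∨ orbLen M.facePerm d = 4 := by
    obtain ⟨x, hx, rfl⟩ := h.f_surj d
    have h0 := (hloc x hx).1.1.2
    rw [hlen x hx]
    unfold faceLen at h0 ⊢
    simp only [natBeq_eq, Bool.cond_decide] at h0 ⊢
    split_ifs at h0 ⊢ <;> simp_all
  have h4 (d : D) : orbLen M.rot d = 4 := orbLen_eq_four (h.rot4 d) (h.rot2 d)
  have k2 := h.card_orbLen_facePerm_eq hlen 2
  have k3 := h.card_orbLen_facePerm_eq hlen 3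
  rw [CombMap.card_orbLen_facePerm_eq] at k2 k3
  simp only [natBeq_eq] at k2 k3 hc2 hc3
  -- The check counts darts: `2 * p₂ = 16 - 2 * i` is the definition of `i`, and `3 * p₃ = 6 * i -
  -- 24` is then Euler's formula `2 * p₂ + p₃ = 8`.
  rw [← k2] at hc2
  rw [← k3] at hc3
  have hconn : M.graph.Connected ∧ ∀ v, (M.graph.induce {v}ᶜ).Preconnected := by
    choose g hg hfg using h.f_surj
    have hpos := h.pos
    have hv (v : M.Vertex) : ∃ x < 4 * n, M.vertex (f x) = v := by
      obtain ⟨d, rfl⟩ := Quotient.exists_rep v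
      exact ⟨g d, hg d, by rw [hfg]; rfl⟩
    choose x hx hxv using hv
    have hxd {y : ℕ} (hy : y < 4 * n) : x (M.vertex (f y)) / 4 = y / 4 :=
      (h.vertex_eq_iff (hx _) hy).1 (hxv _)
    have hadj {y : ℕ} (hy : y < 4 * n) : M.graph.Adj (M.vertex (f y)) (M.vertex (f (p y))) :=
      ⟨fun e => (hloc y hy).1.2 ((h.vertex_eq_iff hy (h.p_lt y hy)).1 e).symm, f y, rfl, by
        rw [h.f_p y hy]⟩
    have hadj' (v : M.Vertex) {k : ℕ} (hk : k < 4) :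
        M.graph.Adj v (M.vertex (f (p (4 * (x v / 4) + k)))) := by
      have hx := hx v
      have h1 := hadj (y := 4 * (x v / 4) + k) (by omega)
      rwa [(h.vertex_eq_iff (y := x v) (by omega) hx).2 (by omega), hxv] at h1
    have hlt (v : M.Vertex) {k : ℕ} (hk : k < 4) : 4 * (x v / 4) + k < 4 * n := by
      have := hx v
      omega
    -- The numbering runs from the vertex of the dart 0 to the other end of its edge.
    refine SimpleGraph.connected_of_stNumbering (fun v => σ (x v / 4)) ?_ (hadj (y := 0) (by omega))
      (fun v hne => ?_) fun v hne => ?_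
    · intro v w e
      have e : σ (x v / 4) = σ (x w / 4) := e
      have h1 := hx v
      have h2 := hx w
      rw [← hxv v, ← hxv w]
      rw [h.vertex_eq_iff h1 h2]
      rcases lt_trichotomy (x v / 4) (x w / 4) with hl | hl | hl
      · exact absurd e.symm (hσ _ (by omega) _ hl)
      · exact hl
      · exact absurd e (hσ _ (by omega) _ hl)
    · have h1 := hx v
      rcases hdown (x v / 4) (by omega) with h0 | ⟨k, hk, hlt'⟩
      · refine absurd ?_ hne
        rw [← hxv v, h.vertex_eq_iff h1 (by omega), h0]
      · refine ⟨_, hadj' v hk, ?_⟩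
        rw [hxd (h.p_lt _ (hlt v hk))]
        exact hlt'
    · have h1 := hx v
      rcases hup (x v / 4) (by omega) with h0 | ⟨k, hk, hlt'⟩
      · refine absurd ?_ hne
        rw [← hxv v, h.vertex_eq_iff h1 (h.p_lt 0 (by omega)), h0]
      · refine ⟨_, hadj' v hk, ?_⟩
        rw [hxd (h.p_lt _ (hlt v hk))]
        exact hlt'
  refine ⟨⟨⟨hconn.1, (card_vertex_add_card_face_iff h4 hf).2 (by omega)⟩, hconn, ?_, ?_,
    by omega⟩, ?_, ?_⟩
  · intro v
    obtain ⟨d, rfl⟩ := Quotient.exists_rep v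
    exact (cycleLength_cycleMk M.rot d).trans (h4 d)
  · intro F
    obtain ⟨d, rfl⟩ := Quotient.exists_rep F
    exact (cycleLength_cycleMk M.facePerm d) ▸ hf d
  · refine isPure_iff.2 fun d hd => ?_
    obtain ⟨x, hx, rfl⟩ := h.f_surj d
    -- The darts with the label of `x` form a union of circuits, while the labels of crossing
    -- circuits differ.
    have := mem_of_circuit_eq (T := {d | ∃ y < 4 * n, f y = d ∧ lab y = lab x})
      (by
        rintro _ ⟨y, hy, rfl, e⟩
        exact ⟨nx (nx y), nx_lt (nx_lt hy), by rw [h.f_nx _ (nx_lt hy), h.f_nx _ hy],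
          by rw [← e]; exact (hloc y hy).1.1.1.1.1.2⟩)
      (by
        rintro _ ⟨y, hy, rfl, e⟩
        exact ⟨p y, h.p_lt y hy, h.f_p y hy, by rw [← e]; exact (hloc y hy).1.1.1.1.1.1⟩)
      hd ⟨x, hx, rfl, rfl⟩
    obtain ⟨y, hy, e, e'⟩ := this
    rw [← h.f_nx x hx] at e
    rw [h.f_inj y hy _ (nx_lt hx) e] at e'
    exact (hloc x hx).1.1.1.1.2 e'
  · rw [IsIrreducible, hasRailroad_iff h.rot4]
    rintro ⟨d, hd⟩
    obtain ⟨x, hx, rfl⟩ := h.f_surj d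
    obtain ⟨k, hk⟩ := h.exists_short hlen hx (hloc x hx).2
    exact hk (hd k)

end Drawn

end CombMap

/-! ### The listed graphs have the required properties -/

namespace CombMap

variable {D : Type*} {M : CombMap D}

theorem drawn_of_equiv {n : ℕ} [NeZero n] {p : ℕ → ℕ} (e : Fin n × Fin 4 ≃ D)
    (hrot : ∀ x, M.rot (e x) = e (x.1, x.2 + 1))
    (hedge : ∀ x, ∃ y, M.edge (e x) = e y ∧ Code.dart y = p (Code.dart x)) :
    ∃ f, Drawn M n p f := by
  let f : ℕ → D := fun x => e (Fin.ofNat n (x / 4), Fin.ofNat 4 x)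
  have hf (x : Fin n × Fin 4) : f (Code.dart x) = e x := by
    have h1 : (4 * x.1.1 + x.2.1) / 4 = x.1.1 := by omega
    have h2 : (4 * x.1.1 + x.2.1) % 4 = x.2.1 := by omega
    refine congrArg e (Prod.ext (Fin.ext ?_) (Fin.ext ?_))
    · change (4 * x.1.1 + x.2.1) / 4 % n = x.1.1
      rw [h1, Nat.mod_eq_of_lt x.1.2]
    · exact h2
  have hsurj (x : ℕ) (hx : x < 4 * n) : ∃ y : Fin n × Fin 4, Code.dart y = x :=
    ⟨(⟨x / 4, by omega⟩, ⟨x % 4, Nat.mod_lt _ (by norm_num)⟩), Nat.div_add_mod x 4⟩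
  have hnx (x : Fin n × Fin 4) : Code.dart (x.1, x.2 + 1) = nx (Code.dart x) := by
    unfold Code.dart nx
    rw [Fin.val_add]
    simp only [Fin.val_one]
    omega
  refine ⟨f, Nat.pos_of_ne_zero (NeZero.ne n), ?_, ?_, ?_, ?_, ?_⟩
  · intro x hx
    obtain ⟨x, rfl⟩ := hsurj x hx
    rw [← hnx, hf, hf, hrot]
  · intro x hx
    obtain ⟨x, rfl⟩ := hsurj x hx
    obtain ⟨y, -, hy⟩ := hedge x
    exact hy ▸ Code.dart_lt y
  · intro x hx
    obtain ⟨x, rfl⟩ := hsurj x hx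
    obtain ⟨y, hy', hy⟩ := hedge x
    rw [← hy, hf, hf, hy']
  · intro x hx y hy h
    obtain ⟨x, rfl⟩ := hsurj x hx
    obtain ⟨y, rfl⟩ := hsurj y hy
    rw [hf, hf] at h
    rw [e.injective h]
  · intro d
    exact ⟨_, Code.dart_lt (e.symm d), by rw [hf, e.apply_symm_apply]⟩

/-- The dart with the same vertex and the opposite direction of rotation. -/
def mirrorDart (x : ℕ) : ℕ := 4 * (x / 4) + (4 - x % 4) % 4

/-- An isomorphism may reverse the orientation. In that case the map is drawn with the mirrored
code, for which the check is evaluated separately. -/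
theorem Iso.isHedrite [Finite D] {n : ℕ} [NeZero n] {N : CombMap (Fin n × Fin 4)}
    {i : ℕ} {p lab σ : ℕ → ℕ} (h : M.Iso N) (hrot : ∀ x, N.rot x = (x.1, x.2 + 1))
    (hedge : ∀ x, Code.dart (N.edge x) = p (Code.dart x))
    (hc : hedriteCheck n i p lab σ = true)
    (hc' : hedriteCheck n i (fun x => mirrorDart (p (mirrorDart x))) (fun x => lab (mirrorDart x))
      σ = true) : M.IsHedrite i ∧ M.IsPure ∧ M.IsIrreducible := by
  obtain ⟨e, he, he' | he'⟩ := h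
  · obtain ⟨f, hf⟩ := drawn_of_equiv (M := M) (p := p) e.symm
      (fun x => by rw [← hrot, eq_symm_apply, he', apply_symm_apply])
      (fun x => ⟨N.edge x, by rw [eq_symm_apply, he, apply_symm_apply], hedge x⟩)
    exact hf.isHedrite hc
  · let m : (Fin n × Fin 4) ≃ (Fin n × Fin 4) := prodCongr (Equiv.refl _) (Equiv.neg _)
    have hm (x : Fin n × Fin 4) : m x = (x.1, -x.2) := rfl
    have hmm (x : Fin n × Fin 4) : m (m x) = x := by simp [hm]
    have hmd (x : Fin n × Fin 4) : Code.dart (m x) = mirrorDart (Code.dart x) := by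
      have h1 : (m x).1.1 = x.1.1 := rfl
      have h2 : (m x).2.1 = (4 - x.2.1) % 4 := rfl
      unfold Code.dart mirrorDart
      rw [h1, h2]
      omega
    obtain ⟨f, hf⟩ := drawn_of_equiv (M := M) (p := fun x => mirrorDart (p (mirrorDart x)))
      (m.trans e.symm)
      (fun x => by
        rw [trans_apply, trans_apply, eq_symm_apply, he', apply_symm_apply, symm_apply_eq, hrot,
          hm, hm]
        simp)
      (fun x => ⟨m (N.edge (m x)), by
        rw [trans_apply, trans_apply, hmm, eq_symm_apply, he, apply_symm_apply], by
        rw [hmd, hedge, hmd]⟩)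
    exact hf.isHedrite hc'

set_option maxRecDepth 10000

theorem hedrite5_6_2_edge (x : Fin 6 × Fin 4) :
    Code.dart (hedrite5_6_2.edge x) = get code5_6_2.p (Code.dart x) := by
  revert x
  decide +kernel

/-- The number given for `σ`, here and for the other graphs, encodes an st-numbering of the
vertices. -/
theorem isHedrite_of_iso_5_6_2 [Finite D] (h : M.Iso hedrite5_6_2) :
    M.IsHedrite 5 ∧ M.IsPure ∧ M.IsIrreducible :=
  h.isHedrite (lab := get code5_6_2.lab) (σ := get
    2256198937089024) (fun _ => rfl) hedrite5_6_2_edge (by decide +kernel) (by decide +kernel)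

theorem hedrite6_8_5_edge (x : Fin 8 × Fin 4) :
    Code.dart (hedrite6_8_5.edge x) = get code6_8_5.p (Code.dart x) := by
  revert x
  decide +kernel

theorem isHedrite_of_iso_6_8_5 [Finite D] (h : M.Iso hedrite6_8_5) :
    M.IsHedrite 6 ∧ M.IsPure ∧ M.IsIrreducible :=
  h.isHedrite (lab := get code6_8_5.lab) (σ := get
    1185210065435967364096) (fun _ => rfl) hedrite6_8_5_edge (by decide +kernel) (by decide +kernel)

theorem hedrite6_14_20_edge (x : Fin 14 × Fin 4) :
    Code.dart (hedrite6_14_20.edge x) = get code6_14_20.p (Code.dart x) := by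
  revert x
  decide +kernel

theorem isHedrite_of_iso_6_14_20 [Finite D] (h : M.Iso hedrite6_14_20) :
    M.IsHedrite 6 ∧ M.IsPure ∧ M.IsIrreducible :=
  h.isHedrite (lab := get code6_14_20.lab) (σ := get
    14985722919923301473753066613137951699968) (fun _ => rfl) hedrite6_14_20_edge (by decide +kernel) (by decide +kernel)

theorem hedrite8_6_1_edge (x : Fin 6 × Fin 4) :
    Code.dart (hedrite8_6_1.edge x) = get code8_6_1.p (Code.dart x) := by
  revert x
  decide +kernel

theorem isHedrite_of_iso_8_6_1 [Finite D] (h : M.Iso hedrite8_6_1) :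
    M.IsHedrite 8 ∧ M.IsPure ∧ M.IsIrreducible :=
  h.isHedrite (lab := get code8_6_1.lab) (σ := get
    3378801383838720) (fun _ => rfl) hedrite8_6_1_edge (by decide +kernel) (by decide +kernel)

theorem hedrite8_12_4_edge (x : Fin 12 × Fin 4) :
    Code.dart (hedrite8_12_4.edge x) = get code8_12_4.p (Code.dart x) := by
  revert x
  decide +kernel

theorem isHedrite_of_iso_8_12_4 [Finite D] (h : M.Iso hedrite8_12_4) :
    M.IsHedrite 8 ∧ M.IsPure ∧ M.IsIrreducible :=
  h.isHedrite (lab := get code8_12_4.lab) (σ := get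
    11686473365438207325778378466798592) (fun _ => rfl) hedrite8_12_4_edge (by decide +kernel) (by decide +kernel)

theorem hedrite8_12_5_edge (x : Fin 12 × Fin 4) :
    Code.dart (hedrite8_12_5.edge x) = get code8_12_5.p (Code.dart x) := by
  revert x
  decide +kernel

theorem isHedrite_of_iso_8_12_5 [Finite D] (h : M.Iso hedrite8_12_5) :
    M.IsHedrite 8 ∧ M.IsPure ∧ M.IsIrreducible :=
  h.isHedrite (lab := get code8_12_5.lab) (σ := get
    11686473366647130839549999501552640) (fun _ => rfl) hedrite8_12_5_edge (by decide +kernel) (by decide +kernel)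

theorem hedrite8_14_7_edge (x : Fin 14 × Fin 4) :
    Code.dart (hedrite8_14_7.edge x) = get code8_14_7.p (Code.dart x) := by
  revert x
  decide +kernel

theorem isHedrite_of_iso_8_14_7 [Finite D] (h : M.Iso hedrite8_14_7) :
    M.IsHedrite 8 ∧ M.IsPure ∧ M.IsIrreducible :=
  h.isHedrite (lab := get code8_14_7.lab) (σ := get
    16336215975103204511408238780159391446016) (fun _ => rfl) hedrite8_14_7_edge (by decide +kernel) (by decide +kernel)

theorem hedrite8_20_1_edge (x : Fin 20 × Fin 4) :
    Code.dart (hedrite8_20_1.edge x) = get code8_20_1.p (Code.dart x) := by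
  revert x
  decide +kernel

theorem isHedrite_of_iso_8_20_1 [Finite D] (h : M.Iso hedrite8_20_1) :
    M.IsHedrite 8 ∧ M.IsPure ∧ M.IsIrreducible :=
  h.isHedrite (lab := get code8_20_1.lab) (σ := get
    25119161370662058577030014041118014817906988670098389093376) (fun _ => rfl) hedrite8_20_1_edge (by decide +kernel) (by decide +kernel)

theorem hedrite8_22_1_edge (x : Fin 22 × Fin 4) :
    Code.dart (hedrite8_22_1.edge x) = get code8_22_1.p (Code.dart x) := by
  revert x
  decide +kernel

theorem isHedrite_of_iso_8_22_1 [Finite D] (h : M.Iso hedrite8_22_1) :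
    M.IsHedrite 8 ∧ M.IsPure ∧ M.IsIrreducible :=
  h.isHedrite (lab := get code8_22_1.lab) (σ := get
    24687397044873416095596423780693393209710383747883678658391462912) (fun _ => rfl) hedrite8_22_1_edge (by decide +kernel) (by decide +kernel)

theorem hedrite8_30_1_edge (x : Fin 30 × Fin 4) :
    Code.dart (hedrite8_30_1.edge x) = get code8_30_1.p (Code.dart x) := by
  revert x
  decide +kernel

theorem isHedrite_of_iso_8_30_1 [Finite D] (h : M.Iso hedrite8_30_1) :
    M.IsHedrite 8 ∧ M.IsPure ∧ M.IsIrreducible :=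
  h.isHedrite (lab := get code8_30_1.lab) (σ := get
    45763500430876635427019749083093455208170580739341297988215169044551930406128866589438976) (fun _ => rfl) hedrite8_30_1_edge (by decide +kernel) (by decide +kernel)

theorem hedrite8_32_1_edge (x : Fin 32 × Fin 4) :
    Code.dart (hedrite8_32_1.edge x) = get code8_32_1.p (Code.dart x) := by
  revert x
  decide +kernel

theorem isHedrite_of_iso_8_32_1 [Finite D] (h : M.Iso hedrite8_32_1) :
    M.IsHedrite 8 ∧ M.IsPure ∧ M.IsIrreducible :=
  h.isHedrite (lab := get code8_32_1.lab) (σ := get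
    10470412692487886953955500907048292172792549950917854846332988831892480413190613210777903987712) (fun _ => rfl) hedrite8_32_1_edge (by decide +kernel) (by decide +kernel)
end CombMap

/-! ### The classification -/

namespace CombMap

variable {D : Type*} {M : CombMap D}

theorem IsHedrite.unique {i j : ℕ} (h : M.IsHedrite i) (h' : M.IsHedrite j) : i = j := by
  have h1 := h.count
  have h2 := h'.count
  omega

theorem hedrite8_30_1_edge_mirror (x : Fin 30 × Fin 4) :
    Code.dart ((hedrite8_30_1.edge (x.1, -x.2)).1, -(hedrite8_30_1.edge (x.1, -x.2)).2) =
      get code8_30_1_mirror.p (Code.dart x) := by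
  revert x
  decide +kernel

theorem card_circuit_eq_two_iff : Nat.card M.CentralCircuit = 2 ↔
    ∃ A B : M.CentralCircuit, A ≠ B ∧ ∀ C, A = C ∨ B = C := by
  rw [Nat.card_eq_two_iff]
  refine exists_congr fun A => exists_congr fun B => and_congr_right fun _ => ?_
  rw [Set.eq_univ_iff_forall]
  exact forall_congr' fun C => or_congr eq_comm eq_comm

theorem IsHedrite.isPure_and_isIrreducible [Finite D] (hM : M.IsHedrite 4)
    (h2 : Nat.card M.CentralCircuit = 2) : M.IsPure ∧ M.IsIrreducible := by
  have hp : M.IsPure := hM.isPure_of_orbLen_ne_three fun d hd => by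
    have h1 := hM.two_mul_faceCount
    have h2 := hM.count
    have h3 := card_orbLen_facePerm_eq (M := M) 3
    rw [show M.faceCount 3 = 0 by omega, mul_zero] at h3
    have : Nonempty {x // orbLen M.facePerm x = 3} := ⟨⟨d, hd⟩⟩
    exact Nat.card_pos.ne' h3
  obtain ⟨A, B, -, hAB⟩ := card_circuit_eq_two_iff.1 h2
  refine ⟨hp, hM.isIrreducible_of_circuit hp fun X Y Z h1 h2 => ?_⟩
  rcases hAB X with rfl | rfl <;> rcases hAB Y with rfl | rfl <;> rcases hAB Z with rfl | rfl <;>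
    first | rfl | exact absurd rfl h1 | exact absurd rfl h2

/-- Two circuits alternate around each face, so there are no triangles and Euler's formula gives `p₂
= 4`. By purity the two circuits are distinct. -/
theorem IsHedrite.eq_four [Finite D] {i : ℕ} (hM : M.IsHedrite i) (hp : M.IsPure)
    (h2 : ∃ A B : M.CentralCircuit, ∀ C, A = C ∨ B = C) :
    i = 4 ∧ M.IsHedrite 4 ∧ Nat.card M.CentralCircuit = 2 := by
  obtain ⟨A, B, hAB⟩ := h2
  have hT := hM.isTame hp
  have h0 := faceCount_three_eq_zero (hT.orbLen_ne_three fun X Y Z h1 h2 => by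
    rcases hAB X with rfl | rfl <;> rcases hAB Y with rfl | rfl <;>
      rcases hAB Z with rfl | rfl <;>
      first | rfl | exact absurd rfl h1 | exact absurd rfl h2)
  have h1 := hM.two_mul_faceCount
  have h2 := hM.count
  obtain rfl : i = 4 := by omega
  refine ⟨rfl, hM, card_circuit_eq_two_iff.2 ⟨A, B, ?_, hAB⟩⟩
  rintro rfl
  obtain ⟨d⟩ := hM.nonempty
  exact hT.pure d (((or_self_iff.1 (hAB _)).symm).trans (or_self_iff.1 (hAB _)))

/-- The existence of a third circuit bounds the numbers of crossings, so that the enumeration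
applies, and prevents it from stopping at two circuits. -/
theorem IsTaut.iso_of_three_circuits [Finite D] (hM : M.IsTaut) [Nonempty D]
    (h3 : ∀ A B : M.CentralCircuit, ∃ C, A ≠ C ∧ B ≠ C) :
    M.Iso hedrite5_6_2 ∨ M.Iso hedrite6_8_5 ∨ M.Iso hedrite6_14_20 ∨ M.Iso hedrite8_6_1 ∨
      M.Iso hedrite8_12_4 ∨ M.Iso hedrite8_12_5 ∨ M.Iso hedrite8_14_7 ∨ M.Iso hedrite8_20_1 ∨
      M.Iso hedrite8_22_1 ∨ M.Iso hedrite8_30_1 ∨ M.Iso hedrite8_32_1 := by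
  have hX := hM.fewCrossings h3
  obtain ⟨d⟩ := ‹Nonempty D›
  obtain ⟨r, hr, H, hH, f, κ, h, hκ⟩ :=
    hM.exists_code_of_hasCode hX (hM.hasCode_two hX (hM.pure d))
  match r, hr with
  | 2, _ =>
    obtain ⟨C, h0, h1⟩ := h3 (κ 0) (κ 1)
    obtain ⟨i, hi, rfl⟩ := hκ C
    interval_cases i
    · exact absurd rfl h0
    · exact absurd rfl h1
  | 3, _ =>
    simp only [codes, List.mem_cons, List.not_mem_nil, or_false] at hH
    rcases hH with rfl | rfl | rfl
    · have := h.iso hedrite5_6_2 (fun _ => rfl) hedrite5_6_2_edge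
      tauto
    · have := h.iso hedrite6_8_5 (fun _ => rfl) hedrite6_8_5_edge
      tauto
    · have := h.iso hedrite8_6_1 (fun _ => rfl) hedrite8_6_1_edge
      tauto
  | 4, _ =>
    simp only [codes, List.mem_cons, List.not_mem_nil, or_false] at hH
    rcases hH with rfl | rfl | rfl | rfl
    · have := h.iso hedrite6_14_20 (fun _ => rfl) hedrite6_14_20_edge
      tauto
    · have := h.iso hedrite8_12_4 (fun _ => rfl) hedrite8_12_4_edge
      tauto
    · have := h.iso hedrite8_12_5 (fun _ => rfl) hedrite8_12_5_edge
      tauto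
    · have := h.iso hedrite8_14_7 (fun _ => rfl) hedrite8_14_7_edge
      tauto
  | 5, _ =>
    simp only [codes, List.mem_cons, List.not_mem_nil, or_false] at hH
    rcases hH with rfl | rfl
    · have := h.iso hedrite8_20_1 (fun _ => rfl) hedrite8_20_1_edge
      tauto
    · have := h.iso hedrite8_22_1 (fun _ => rfl) hedrite8_22_1_edge
      tauto
  | 6, _ =>
    simp only [codes, List.mem_cons, List.not_mem_nil, or_false] at hH
    rcases hH with rfl | rfl | rfl
    · have := h.iso hedrite8_30_1 (fun _ => rfl) hedrite8_30_1_edge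
      tauto
    · have := h.iso hedrite8_32_1 (fun _ => rfl) hedrite8_32_1_edge
      tauto
    · have := h.iso_of_mirror hedrite8_30_1 (fun _ => rfl) hedrite8_30_1_edge_mirror
      tauto
  | n + 7, _ => exact absurd hH (by simp [codes])

end CombMap

theorem mainTheorem3 {D : Type*} [Finite D] (G : CombMap D) (i : ℕ) :
    (G.IsHedrite i ∧ G.IsPure ∧ G.IsIrreducible) ↔
      (i = 4 ∧ G.IsHedrite 4 ∧ Nat.card G.CentralCircuit = 2) ∨
      (i = 5 ∧ G.Iso CombMap.hedrite5_6_2) ∨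
      (i = 6 ∧ (G.Iso CombMap.hedrite6_8_5 ∨ G.Iso CombMap.hedrite6_14_20)) ∨
      (i = 8 ∧
        (G.Iso CombMap.hedrite8_6_1 ∨ G.Iso CombMap.hedrite8_12_4 ∨
          G.Iso CombMap.hedrite8_12_5 ∨ G.Iso CombMap.hedrite8_14_7 ∨
          G.Iso CombMap.hedrite8_20_1 ∨ G.Iso CombMap.hedrite8_22_1 ∨
          G.Iso CombMap.hedrite8_30_1 ∨ G.Iso CombMap.hedrite8_32_1)) := by

  constructor
  · rintro ⟨hG, hp, hi⟩
    -- Either no two circuits exhaust all of them, and the enumeration applies, or there are at most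
    -- two.
    by_cases h3 : ∀ A B : G.CentralCircuit, ∃ C, A ≠ C ∧ B ≠ C
    · have := hG.nonempty
      -- The enumeration only identifies the graph; `i` is then determined by its number of 2-gons.
      have eq {j : ℕ} (h : G.IsHedrite j ∧ G.IsPure ∧ G.IsIrreducible) : i = j := hG.unique h.1
      rcases (hG.isTaut hp hi).iso_of_three_circuits h3 with
        h | h | h | h | h | h | h | h | h | h | h
      · have := eq (CombMap.isHedrite_of_iso_5_6_2 h); tauto
      · have := eq (CombMap.isHedrite_of_iso_6_8_5 h); tauto
      · have := eq (CombMap.isHedrite_of_iso_6_14_20 h); tauto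
      · have := eq (CombMap.isHedrite_of_iso_8_6_1 h); tauto
      · have := eq (CombMap.isHedrite_of_iso_8_12_4 h); tauto
      · have := eq (CombMap.isHedrite_of_iso_8_12_5 h); tauto
      · have := eq (CombMap.isHedrite_of_iso_8_14_7 h); tauto
      · have := eq (CombMap.isHedrite_of_iso_8_20_1 h); tauto
      · have := eq (CombMap.isHedrite_of_iso_8_22_1 h); tauto
      · have := eq (CombMap.isHedrite_of_iso_8_30_1 h); tauto
      · have := eq (CombMap.isHedrite_of_iso_8_32_1 h); tauto
    · push Not at h3
      obtain ⟨A, B, hAB⟩ := h3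
      exact Or.inl (hG.eq_four hp ⟨A, B, fun C => or_iff_not_imp_left.2 (hAB C)⟩)
  · rintro (⟨rfl, hG, h2⟩ | ⟨rfl, h⟩ | ⟨rfl, h | h⟩ | ⟨rfl, h | h | h | h | h | h | h | h⟩)
    · exact ⟨hG, hG.isPure_and_isIrreducible h2⟩
    · exact CombMap.isHedrite_of_iso_5_6_2 h
    · exact CombMap.isHedrite_of_iso_6_8_5 h
    · exact CombMap.isHedrite_of_iso_6_14_20 h
    · exact CombMap.isHedrite_of_iso_8_6_1 h
    · exact CombMap.isHedrite_of_iso_8_12_4 h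
    · exact CombMap.isHedrite_of_iso_8_12_5 h
    · exact CombMap.isHedrite_of_iso_8_14_7 h
    · exact CombMap.isHedrite_of_iso_8_20_1 h
    · exact CombMap.isHedrite_of_iso_8_22_1 h
    · exact CombMap.isHedrite_of_iso_8_30_1 h
    · exact CombMap.isHedrite_of_iso_8_32_1 h
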